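/- There is a randomized algorithm with the following properties. It is given two finite simple graphs $H$ and $G$ (by their adjacency matrices), where $G$ is a forest (in particular, both $H$ and $G$ may be forests), and it decides Subgraph Isomorphism, that is, whether there is an injective map $\eta\colon V(H)\to V(G)$ such that $\eta(u)\eta(v)\in E(G)$ whenever $uv\in E(H)$. Let $k=\mathbf{cc}(H)$ be the number of connected components of $H$ and let $n=\max(2,|V(H)|+|V(G)|)$. For every outcome of its coin tosses the algorithm halts with an answer YES or NO within time $$2^{O(k\log k)}\cdot n^{O(1)},$$ that is, within $c\cdot 2^{c\,k\log_2 k}\cdot n^{c}$ steps for an absolute constant $c$ (where $k\log_2 k=0$ for $k=0$); in particular the time is $f(\mathbf{cc}(H))\cdot n^{O(1)}$ for a computable function $f$. The algorithm has only false negatives: if there is no such map $\eta$, it always answers NO; if there is one, it answers NO with probability at most $\tfrac12$. -/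

import Mathlib

/-! ### The machine model

Programs of a small LISP-like language without recursion (composition, construction of pairs,
conditionals, while loops), acting on binary trees, with an instruction that tosses a fair coin.
Data are never copied or compared as a whole: every instruction only follows, creates or tests one
pointer, so a computation with `t` steps is carried out by a random access machine in time `O(t)`
on words of `O(log t)` bits.  Conversely a random access machine or a Turing machine is simulated
with polynomial overhead. -/

/-- The data: binary trees (`LISP` S-expressions over the single atom `nil`). -/
inductive Data : Type
  | nil : Data
  | cons : Data → Data → Data

namespace Data

/-- First component; `nil` on the atom. -/
def fst : Data → Data
  | nil => nil
  | cons a _ => a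

/-- Second component; `nil` on the atom. -/
def snd : Data → Data
  | nil => nil
  | cons _ b => b

/-- The two answers / truth values: `nil` is NO and `(nil . nil)` is YES. -/
def ofBool : Bool → Data
  | false => nil
  | true => cons nil nil

/-- A list as nested pairs `(a₁ . (a₂ . ( … . nil)))`. -/
def ofList : List Data → Data
  | [] => nil
  | a :: l => cons a (ofList l)

end Data

/-- Programs; each denotes a (partial, randomized) map from data to data. -/
inductive Prog : Type
  /-- return the input -/
  | id : Prog
  /-- return the atom -/
  | nil : Prog
  /-- return the first component of the input -/
  | fst : Prog
  /-- return the second component of the input -/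
  | snd : Prog
  /-- toss a fair coin and return the outcome -/
  | flip : Prog
  /-- run `p` and `q` on the input and pair the results -/
  | pair (p q : Prog) : Prog
  /-- run `p` on the input, then `q` on the result -/
  | seq (p q : Prog) : Prog
  /-- if `b` returns something other than `nil` on the input, run `p` on the input, otherwise `q` -/
  | ite (b p q : Prog) : Prog
  /-- while `b` returns something other than `nil` on the current value, replace that value by the
  result of `p` on it -/
  | loop (b p : Prog) : Prog

/-- `Eval p x r y s t`: the program `p`, started on the input `x` when the outcomes of the coin
tosses still to come are listed in `r`, halts with output `y` after exactly `t` steps, and `s` is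
what remains of `r`, the outcomes used having been removed from the front. -/
inductive Eval : Prog → Data → List Bool → Data → List Bool → ℕ → Prop
  | id (x : Data) (r : List Bool) : Eval Prog.id x r x r 1
  | nil (x : Data) (r : List Bool) : Eval Prog.nil x r Data.nil r 1
  | fst (x : Data) (r : List Bool) : Eval Prog.fst x r x.fst r 1
  | snd (x : Data) (r : List Bool) : Eval Prog.snd x r x.snd r 1
  | flip (x : Data) (b : Bool) (r : List Bool) : Eval Prog.flip x (b :: r) (Data.ofBool b) r 1
  | pair {p q : Prog} {x y z : Data} {r₀ r₁ r₂ : List Bool} {t₁ t₂ : ℕ} :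
      Eval p x r₀ y r₁ t₁ → Eval q x r₁ z r₂ t₂ →
      Eval (Prog.pair p q) x r₀ (Data.cons y z) r₂ (t₁ + t₂ + 1)
  | seq {p q : Prog} {x y z : Data} {r₀ r₁ r₂ : List Bool} {t₁ t₂ : ℕ} :
      Eval p x r₀ y r₁ t₁ → Eval q y r₁ z r₂ t₂ →
      Eval (Prog.seq p q) x r₀ z r₂ (t₁ + t₂ + 1)
  | ite_true {b p q : Prog} {x v y : Data} {r₀ r₁ r₂ : List Bool} {t₁ t₂ : ℕ} :
      Eval b x r₀ v r₁ t₁ → v ≠ Data.nil → Eval p x r₁ y r₂ t₂ →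
      Eval (Prog.ite b p q) x r₀ y r₂ (t₁ + t₂ + 1)
  | ite_false {b p q : Prog} {x y : Data} {r₀ r₁ r₂ : List Bool} {t₁ t₂ : ℕ} :
      Eval b x r₀ Data.nil r₁ t₁ → Eval q x r₁ y r₂ t₂ →
      Eval (Prog.ite b p q) x r₀ y r₂ (t₁ + t₂ + 1)
  | loop_done {b p : Prog} {x : Data} {r₀ r₁ : List Bool} {t : ℕ} :
      Eval b x r₀ Data.nil r₁ t →
      Eval (Prog.loop b p) x r₀ x r₁ (t + 1)
  | loop_step {b p : Prog} {x v y z : Data} {r₀ r₁ r₂ r₃ : List Bool} {t₁ t₂ t₃ : ℕ} :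
      Eval b x r₀ v r₁ t₁ → v ≠ Data.nil → Eval p x r₁ y r₂ t₂ →
      Eval (Prog.loop b p) y r₂ z r₃ t₃ →
      Eval (Prog.loop b p) x r₀ z r₃ (t₁ + t₂ + t₃ + 1)

/-- On input `x`, with the coin outcomes `r`, the program halts within `T` steps with answer `a`. -/
def Prog.Answers (p : Prog) (x : Data) (T : ℕ) (r : List Bool) (a : Bool) : Prop :=
  ∃ (s : List Bool) (t : ℕ), t ≤ T ∧ Eval p x r (Data.ofBool a) s t

/-- The probability that `p` gives the answer `a` on input `x` within `T` steps.  As each coin toss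
is a step, at most `T` coins are tossed in that time, so the probability is taken over a uniformly
random string of `T` coin outcomes. -/
noncomputable def Prog.answerProb (p : Prog) (x : Data) (T : ℕ) (a : Bool) : ℝ :=
  (Nat.card {r : Fin T → Bool // p.Answers x T (List.ofFn r) a} : ℝ) / 2 ^ T

/-- On input `x`, the randomized program `p` decides the question `Q` in time `T` with false
negatives: whatever the coins, it halts within `T` steps with an answer YES or NO; if `Q` fails, the
answer is always NO; if `Q` holds, the answer is NO with probability at most `1/2`. -/
def Prog.DecidesWithFalseNegatives (p : Prog) (x : Data) (Q : Prop) (T : ℕ) : Prop :=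
  (∀ r : Fin T → Bool, ∃ a : Bool, p.Answers x T (List.ofFn r) a) ∧
  (¬ Q → ∀ r : Fin T → Bool, p.Answers x T (List.ofFn r) false) ∧
  (Q → p.answerProb x T false ≤ 1 / 2)

/-! ### The input -/

open Classical in
/-- A graph on the vertices `0, …, n - 1`, given by its adjacency matrix, row by row. -/
noncomputable def encodeGraph {n : ℕ} (G : SimpleGraph (Fin n)) : Data :=
  Data.ofList (List.ofFn fun i : Fin n =>
    Data.ofList (List.ofFn fun j : Fin n => Data.ofBool (decide (G.Adj i j))))

/-- The number of connected components of a finite graph. -/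
noncomputable def cc {V : Type*} (H : SimpleGraph V) : ℕ :=
  Nat.card H.ConnectedComponent

/-! The algorithm is a polynomial identity test. For an arc from `a` to `x` of the pattern and an
arc from `v` to `w` of the host, `arcValue` is a determinant. Each nonzero term of its expansion
matches the neighbours of `x` other than `a` with distinct neighbours of `w` other than `v`, and
multiplies the values of the arcs so paired. A host neighbour left over carries a free value,
`branchValue`: either nothing is placed there, which is expressed by an extra isolated pattern
vertex `o`, or some vertex `x` is placed there as the root of its component. The pair `(x, x)`
stands for an arc without predecessor. In a forest the branches behind different neighbours are
disjoint, so a term of the product over the host components is a disjoint placement of some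
components of the pattern, possibly with repetitions.

Inclusion-exclusion over the `2 ^ k` sets of components (`altSum`) keeps the terms in which every
component occurs; repetitions do no harm, since one copy of each can be selected. Formally, as a
function of the set `t` of allowed components, the product is a linear combination of indicators `t
⊇ S` with `S` embeddable (`arcValue_mem_zetaSpan`), and the alternating sum annihilates every
indicator whose `S` misses a component (`sum_setSign_zeta`). Hence a nonzero value at any point
proves containment (`exists_embedsOn`), and there are no false positives. Cycles in the pattern need
no separate test: values are zero at depth zero, so only arcs with a finite non-backtracking
unfolding (`FinUnfold`) contribute.

Conversely, an embedding yields a point at which at most one permutation contributes to each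
determinant (`det_matchMatrix_place`). There the full set of components contributes a unit and every
other set contributes zero (`altSum_place_ne_zero`), so signs cannot make the polynomial cancel. Its
degree is polynomial in the number of vertices, and Schwartz-Zippel over a prime field of polynomial
size bounds the error by one half (`card_eval_eq_zero_le`).

For the running time, determinants modulo the prime are computed by Bird's division-free iteration,
and the predicate `PT` of polynomial time computability is closed under composition and bounded
loops. The size measure of the input includes `2 ^ k`, so the time is polynomial in `2 ^ k` and `n`,
which is better than required. -/

/-! ### A division-free determinant algorithm -/

section Bird

open Finset Matrix

variable {R : Type*} [CommRing R] {n : ℕ}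

/-- One round of Bird's division-free determinant algorithm. -/
def birdStep (A X : Matrix (Fin n) (Fin n) R) : Matrix (Fin n) (Fin n) R :=
  of fun i j => ∑ r, (if r = i then ∑ s, (if i < s then X s s else 0)
    else if i < r then -X i r else 0) * A r j

/-- The matrix whose rows with index in `α` are those of `A`, the others those of the identity. -/
def partialRows (A : Matrix (Fin n) (Fin n) R) (α : Finset (Fin n)) : Matrix (Fin n) (Fin n) R :=
  of fun r => if r ∈ α then A r else Pi.single r 1

/-- The minor of `A` with rows `α ∪ {i}` and columns `α ∪ {j}`. -/
def borderedMinor (A : Matrix (Fin n) (Fin n) R) (α : Finset (Fin n)) (i j : Fin n) : R :=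
  if j ∈ α then 0 else ((partialRows A α).updateRow j (A i)).det

theorem partialRows_insert_updateRow (A : Matrix (Fin n) (Fin n) R) (α : Finset (Fin n))
    (r : Fin n) (b : Fin n → R) :
    (partialRows A (insert r α)).updateRow r b = (partialRows A α).updateRow r b := by
  ext s t
  by_cases hs : s = r
  · subst hs; simp
  · simp [partialRows, hs]

theorem borderedMinor_self (A : Matrix (Fin n) (Fin n) R) {α : Finset (Fin n)} {r : Fin n}
    (hr : r ∉ α) : borderedMinor A α r r = (partialRows A (insert r α)).det := by
  rw [borderedMinor, if_neg hr, ← partialRows_insert_updateRow]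
  congr 1
  ext s t
  by_cases hs : s = r
  · subst hs; simp [partialRows]
  · simp [updateRow_ne hs]

/-- Cramer's rule for the transpose of `partialRows A β` with right-hand side the row `A i`, read at
coordinate `j`. The rows outside `β` are unit vectors, so among them only the index `j` contributes,
and its contribution is the bordered minor itself. -/
theorem borderedMinor_expand (A : Matrix (Fin n) (Fin n) R) (β : Finset (Fin n)) (i j : Fin n) :
    borderedMinor A β i j = A i j * (partialRows A β).det
      - ∑ r ∈ β, A r j * ((partialRows A β).updateRow r (A i)).det := by
  have h := congrFun (mulVec_cramer (partialRows A β)ᵀ (A i)) j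
  simp only [mulVec, dotProduct, cramer_transpose_apply, transpose_apply, det_transpose,
    Pi.smul_apply, smul_eq_mul] at h
  rw [mul_comm (A i j), ← h, ← sum_add_sum_compl β]
  have h1 : ∑ r ∈ β, partialRows A β r j * ((partialRows A β).updateRow r (A i)).det
      = ∑ r ∈ β, A r j * ((partialRows A β).updateRow r (A i)).det :=
    sum_congr rfl fun r hr => by simp [partialRows, hr]
  rw [h1, add_sub_cancel_left, borderedMinor]
  have h2 : ∑ r ∈ βᶜ, partialRows A β r j * ((partialRows A β).updateRow r (A i)).det
      = ∑ r ∈ βᶜ, if r = j then ((partialRows A β).updateRow r (A i)).det else 0 :=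
    sum_congr rfl fun r hr => by
      rw [mem_compl] at hr
      by_cases hrj : r = j
      · subst hrj; simp [partialRows, hr]
      · simp [partialRows, hr, hrj, Ne.symm hrj]
  rw [h2, sum_ite_eq' βᶜ j]
  simp only [mem_compl]
  split_ifs <;> simp_all

/-- A nonempty set is its least element together with a set of larger elements, in exactly one way.
-/
theorem sum_insert_lt (f : Finset (Fin n) → R) (i : Fin n) (p : ℕ) :
    ∑ r ∈ Ioi i, ∑ α ∈ powersetCard p (Ioi r), f (insert r α)
      = ∑ β ∈ powersetCard (p + 1) (Ioi i), f β := by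
  rw [sum_sigma']
  refine sum_bij (fun x _ => insert x.1 x.2) ?_ ?_ ?_ ?_
  · rintro ⟨r, α⟩ h
    simp only [mem_sigma, mem_Ioi, mem_powersetCard] at h ⊢
    refine ⟨?_, ?_⟩
    · intro s hs
      rcases mem_insert.1 hs with rfl | hs
      · exact mem_Ioi.2 h.1
      · exact mem_Ioi.2 (h.1.trans (mem_Ioi.1 (h.2.1 hs)))
    · rw [card_insert_of_notMem, h.2.2]
      intro hr
      exact lt_irrefl _ (mem_Ioi.1 (h.2.1 hr))
  · rintro ⟨r, α⟩ h ⟨r', α'⟩ h' e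
    simp only [mem_sigma, mem_Ioi, mem_powersetCard] at h h' e
    have key : ∀ {r : Fin n} {α : Finset (Fin n)}, α ⊆ Ioi r → r ∉ α := fun hα hr =>
      lt_irrefl _ (mem_Ioi.1 (hα hr))
    have hr : r = r' := by
      have h1 : r ∈ insert r' α' := e ▸ mem_insert_self _ _
      have h2 : r' ∈ insert r α := e ▸ mem_insert_self _ _
      rcases mem_insert.1 h1 with h1 | h1
      · exact h1
      rcases mem_insert.1 h2 with h2 | h2
      · exact h2.symm
      exact absurd (mem_Ioi.1 (h'.2.1 h1)) (mem_Ioi.1 (h.2.1 h2)).asymm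
    subst hr
    have : α = α' := by
      rw [← erase_insert (key h.2.1), e, erase_insert (key h'.2.1)]
    subst this; rfl
  · intro β hβ
    rw [mem_powersetCard] at hβ
    have hne : β.Nonempty := card_pos.1 (by omega)
    refine ⟨⟨β.min' hne, β.erase (β.min' hne)⟩, ?_, insert_erase (min'_mem _ hne)⟩
    simp only [mem_sigma, mem_powersetCard]
    refine ⟨hβ.1 (min'_mem _ _), ?_, ?_⟩
    · intro s hs
      exact mem_Ioi.2 (min'_lt_of_mem_erase_min' _ _ hs)
    · rw [card_erase_of_mem (min'_mem _ _), hβ.2]; rfl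
  · intros; rfl

/-- Both sides run over the pairs of a set `β` with `p + 1` elements and a marked element `r` of it.
-/
theorem sum_insert_notMem (f : Fin n → Finset (Fin n) → R) (s : Finset (Fin n)) (p : ℕ) :
    ∑ r ∈ s, ∑ α ∈ powersetCard p s, (if r ∈ α then 0 else f r (insert r α))
      = ∑ β ∈ powersetCard (p + 1) s, ∑ r ∈ β, f r β := by
  simp_rw [← ite_not (_ ∈ _), ← sum_filter]
  rw [sum_sigma', sum_sigma']
  refine sum_bij' (fun x _ => ⟨insert x.1 x.2, x.1⟩) (fun y _ => ⟨y.2, y.1.erase y.2⟩)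
    ?_ ?_ ?_ ?_ ?_
  · rintro ⟨r, α⟩ h
    simp only [mem_sigma, mem_filter, mem_powersetCard] at h ⊢
    exact ⟨⟨insert_subset h.1 h.2.1.1, by rw [card_insert_of_notMem h.2.2, h.2.1.2]⟩,
      mem_insert_self _ _⟩
  · rintro ⟨β, r⟩ h
    simp only [mem_sigma, mem_filter, mem_powersetCard] at h ⊢
    exact ⟨h.1.1 h.2, ⟨(erase_subset _ _).trans h.1.1, by rw [card_erase_of_mem h.2, h.1.2]; rfl⟩,
      notMem_erase _ _⟩
  · rintro ⟨r, α⟩ h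
    simp only [mem_sigma, mem_filter, mem_powersetCard] at h
    simp [erase_insert h.2.2]
  · rintro ⟨β, r⟩ h
    simp only [mem_sigma, mem_powersetCard] at h
    simp [insert_erase h.2]
  · intros; rfl

/-- The invariant of Bird's algorithm. Expanding the bordered minors for the sets `β` of size `p +
1` gives a main term and corrections. Grouping the main terms by the least element of `β` gives the
diagonal sums of `X`; grouping the corrections by the marked element `r` gives the entries `X i r`.
Sets `α` containing `r` drop out because the bordered minor is zero there. -/
theorem birdStep_borderedMinor (A X : Matrix (Fin n) (Fin n) R) (p : ℕ)
    (hX : ∀ i j, X i j = ∑ α ∈ powersetCard p (Ioi i), borderedMinor A α i j) (i j : Fin n) :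
    birdStep A X i j = ∑ α ∈ powersetCard (p + 1) (Ioi i), borderedMinor A α i j := by
  have h1 : birdStep A X i j = (∑ r ∈ Ioi i, X r r) * A i j - ∑ r ∈ Ioi i, X i r * A r j := by
    have e : ∀ r, (if r = i then ∑ s, (if i < s then X s s else 0)
        else if i < r then -X i r else 0) * A r j
        = (if r = i then (∑ s ∈ Ioi i, X s s) * A i j else 0)
          - (if i < r then X i r * A r j else 0) := by
      intro r
      have e1 : ∑ s, (if i < s then X s s else 0) = ∑ s ∈ Ioi i, X s s := by
        rw [← sum_filter]; congr 1; ext s; simp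
      rw [e1]
      by_cases h : r = i
      · subst h; simp
      · by_cases h' : i < r <;> simp [h, h']
    simp only [birdStep, of_apply, e, sum_sub_distrib, sum_ite_eq', mem_univ, if_true]
    congr 1
    rw [← sum_filter]; congr 1; ext s; simp
  rw [h1]
  have h2 : ∑ r ∈ Ioi i, X r r
      = ∑ β ∈ powersetCard (p + 1) (Ioi i), (partialRows A β).det := by
    rw [← sum_insert_lt]
    refine sum_congr rfl fun r _ => ?_
    rw [hX]
    refine sum_congr rfl fun α hα => borderedMinor_self A fun hr => ?_
    exact lt_irrefl _ (mem_Ioi.1 ((mem_powersetCard.1 hα).1 hr))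
  have h3 : ∑ r ∈ Ioi i, X i r * A r j = ∑ β ∈ powersetCard (p + 1) (Ioi i),
      ∑ r ∈ β, A r j * ((partialRows A β).updateRow r (A i)).det := by
    rw [← sum_insert_notMem]
    refine sum_congr rfl fun r _ => ?_
    rw [hX, sum_mul]
    refine sum_congr rfl fun α hα => ?_
    rw [borderedMinor, partialRows_insert_updateRow]
    split_ifs <;> ring
  rw [h2, h3, sum_mul, ← sum_sub_distrib]
  refine sum_congr rfl fun β _ => ?_
  rw [borderedMinor_expand, mul_comm]

/-- Bird's algorithm computes the determinant. -/
theorem birdStep_iterate_eq_det (A : Matrix (Fin (n + 1)) (Fin (n + 1)) R) :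
    ((birdStep A)^[n] A) 0 0 = A.det := by
  have key : ∀ p i j, ((birdStep A)^[p] A) i j
      = ∑ α ∈ powersetCard p (Ioi i), borderedMinor A α i j := by
    intro p
    induction p with
    | zero =>
      intro i j
      have h0 : partialRows A ∅ = 1 := by
        ext r s; simp [partialRows, one_apply, Pi.single_apply, eq_comm]
      have h1 := borderedMinor_expand A ∅ i j
      simp only [sum_empty, sub_zero, h0, det_one, mul_one] at h1
      simp [h1]
    | succ p ih =>
      intro i j
      rw [Function.iterate_succ_apply']
      exact birdStep_borderedMinor A _ p ih i j
  -- In row `0` the only set of size `n` consists of all other indices, so a single minor remains,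
  -- the determinant.
  have hc : (Ioi (0 : Fin (n + 1))).card = n := by simp
  have hp : powersetCard n (Ioi (0 : Fin (n + 1))) = {Ioi 0} := by
    have := powersetCard_self (Ioi (0 : Fin (n + 1)))
    rwa [hc] at this
  rw [key, hp, sum_singleton, borderedMinor_self _ (by simp)]
  congr 1
  ext r s
  have : r ∈ insert 0 (Ioi (0 : Fin (n + 1))) := by
    rcases Fin.eq_zero_or_eq_succ r with rfl | ⟨k, rfl⟩ <;> simp
  rw [partialRows, of_apply, if_pos this]

end Bird

/-! ### Polynomial time functions -/

/-- Types whose elements are encoded as data and come with a numerical parameter, in terms of which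
running times are measured. -/
class Enc (α : Type) where
  /-- The encoding. -/
  enc : α → Data
  /-- The parameter that running times refer to. -/
  mu : α → ℕ

open Enc

instance : Enc Bool := ⟨Data.ofBool, fun _ => 0⟩

instance : Enc ℕ := ⟨fun n => n.rec Data.nil fun _ d => Data.cons Data.nil d, fun n => n⟩

instance {α β : Type} [Enc α] [Enc β] : Enc (α × β) :=
  ⟨fun x => Data.cons (enc x.1) (enc x.2), fun x => mu x.1 + mu x.2⟩

instance {α : Type} [Enc α] : Enc (List α) :=
  ⟨fun l => Data.ofList (l.map enc), fun l => (l.map fun a => mu a + 1).sum⟩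

@[simp] theorem enc_zero : enc (0 : ℕ) = Data.nil := rfl
@[simp] theorem enc_succ (n : ℕ) : enc (n + 1) = Data.cons Data.nil (enc n) := rfl
@[simp] theorem enc_prod {α β : Type} [Enc α] [Enc β] (a : α) (b : β) :
    enc (a, b) = Data.cons (enc a) (enc b) := rfl
@[simp] theorem enc_list_nil {α : Type} [Enc α] : enc ([] : List α) = Data.nil := rfl
@[simp] theorem enc_list_cons {α : Type} [Enc α] (a : α) (l : List α) :
    enc (a :: l) = Data.cons (enc a) (enc l) := rfl
@[simp] theorem mu_nat (n : ℕ) : mu n = n := rfl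
@[simp] theorem mu_bool (b : Bool) : mu b = 0 := rfl
@[simp] theorem mu_prod {α β : Type} [Enc α] [Enc β] (a : α) (b : β) :
    mu (a, b) = mu a + mu b := rfl
@[simp] theorem mu_list_nil {α : Type} [Enc α] : mu ([] : List α) = 0 := rfl
@[simp] theorem mu_list_cons {α : Type} [Enc α] (a : α) (l : List α) :
    mu (a :: l) = mu a + 1 + mu l := rfl

/-- `f` is polynomially bounded in terms of the parameter. -/
def PolyBdd {α : Type} [Enc α] (f : α → ℕ) : Prop :=
  ∃ c : ℕ, ∀ a, f a ≤ (mu a + 2) ^ c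

namespace PolyBdd

variable {α β : Type} [Enc α] [Enc β] {f g : α → ℕ}

theorem mono (hg : PolyBdd g) (h : ∀ a, f a ≤ g a) : PolyBdd f :=
  let ⟨c, hc⟩ := hg
  ⟨c, fun a => (h a).trans (hc a)⟩

/-- The base `mu a + 2` is at least two, so constants and sums can be absorbed into the exponent. -/
theorem const (k : ℕ) : PolyBdd fun _ : α => k :=
  ⟨k, fun a => Nat.lt_two_pow_self.le.trans (Nat.pow_le_pow_left (by omega) k)⟩

theorem mu : PolyBdd fun a : α => mu a :=
  ⟨1, fun a => by simp⟩

theorem add (hf : PolyBdd f) (hg : PolyBdd g) : PolyBdd fun a => f a + g a := by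
  obtain ⟨c, hc⟩ := hf
  obtain ⟨d, hd⟩ := hg
  refine ⟨max c d + 1, fun a => ?_⟩
  have h1 : f a ≤ (Enc.mu a + 2) ^ max c d :=
    (hc a).trans (Nat.pow_le_pow_right (by omega) (le_max_left _ _))
  have h2 : g a ≤ (Enc.mu a + 2) ^ max c d :=
    (hd a).trans (Nat.pow_le_pow_right (by omega) (le_max_right _ _))
  rw [pow_succ]
  nlinarith [Nat.zero_le (Enc.mu a), Nat.zero_le ((Enc.mu a + 2) ^ max c d)]

theorem mul (hf : PolyBdd f) (hg : PolyBdd g) : PolyBdd fun a => f a * g a := by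
  obtain ⟨c, hc⟩ := hf
  obtain ⟨d, hd⟩ := hg
  exact ⟨c + d, fun a => by rw [pow_add]; exact Nat.mul_le_mul (hc a) (hd a)⟩

theorem comp {T : β → ℕ} {u : α → β} (hT : PolyBdd T) (hu : PolyBdd fun a => Enc.mu (u a)) :
    PolyBdd fun a => T (u a) := by
  obtain ⟨c, hc⟩ := hT
  obtain ⟨d, hd⟩ := hu.add (const 2)
  exact ⟨d * c, fun a => (hc _).trans (by rw [pow_mul]; exact Nat.pow_le_pow_left (hd a) c)⟩

/-- A polynomially bounded function is dominated by a monotone function of the parameter. -/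
theorem exists_mono {T : β → ℕ} (hT : PolyBdd T) {N : α → ℕ} (hN : PolyBdd N) :
    ∃ S : α → ℕ, PolyBdd S ∧ ∀ a b, Enc.mu b ≤ N a → T b ≤ S a := by
  obtain ⟨c, hc⟩ := hT
  obtain ⟨d, hd⟩ := hN.add (const 2)
  exact ⟨fun a => (N a + 2) ^ c, ⟨d * c, fun a => by
    rw [pow_mul]; exact Nat.pow_le_pow_left (hd a) c⟩,
    fun a b h => (hc b).trans (Nat.pow_le_pow_left (by omega) c)⟩

end PolyBdd

/-- The function `f` is computed by a program without coin tosses in polynomial time. -/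
def PT {α β : Type} [Enc α] [Enc β] (f : α → β) : Prop :=
  ∃ (p : Prog) (T : α → ℕ), PolyBdd T ∧ (PolyBdd fun a => mu (f a)) ∧
    ∀ a, ∃ t ≤ T a, ∀ r, Eval p (enc a) r (enc (f a)) r t

/-- `Nat.rec` for simple types: `F (n - 1) (… (F 1 (F 0 s)))`. -/
def foldn {σ : Type} (n : ℕ) (F : ℕ → σ → σ) (s : σ) : σ :=
  match n with
  | 0 => s
  | n + 1 => F n (foldn n F s)

namespace PT

variable {α β γ σ : Type} [Enc α] [Enc β] [Enc γ] [Enc σ]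

theorem polyBdd {f : α → β} (hf : PT f) : PolyBdd fun a => mu (f a) :=
  let ⟨_, _, _, h, _⟩ := hf
  h

theorem of_eq {f g : α → β} (hf : PT f) (h : ∀ a, f a = g a) : PT g :=
  (funext h : f = g) ▸ hf

theorem id : PT fun a : α => a :=
  ⟨Prog.id, fun _ => 1, .const 1, .mu, fun _ => ⟨1, le_rfl, fun _ => Eval.id _ _⟩⟩

/-- The time of `g` is measured at `f a`; this is why `PT` also bounds the parameter of the output.
-/
theorem comp {g : β → γ} {f : α → β} (hg : PT g) (hf : PT f) : PT fun a => g (f a) := by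
  obtain ⟨p, T, hT, hm, h⟩ := hf
  obtain ⟨q, S, hS, hn, k⟩ := hg
  refine ⟨p.seq q, fun a => T a + S (f a) + 1, (hT.add (hS.comp hm)).add (.const 1), hn.comp hm,
    fun a => ?_⟩
  obtain ⟨t, ht, h⟩ := h a
  obtain ⟨s, hs, k⟩ := k (f a)
  exact ⟨t + s + 1, by dsimp only; omega, fun r => Eval.seq (h r) (k r)⟩

theorem pair {f : α → β} {g : α → γ} (hf : PT f) (hg : PT g) : PT fun a => (f a, g a) := by
  obtain ⟨p, T, hT, hm, h⟩ := hf
  obtain ⟨q, S, hS, hn, k⟩ := hg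
  refine ⟨p.pair q, fun a => T a + S a + 1, (hT.add hS).add (.const 1), hm.add hn, fun a => ?_⟩
  obtain ⟨t, ht, h⟩ := h a
  obtain ⟨s, hs, k⟩ := k a
  exact ⟨t + s + 1, by dsimp only; omega, fun r => Eval.pair (h r) (k r)⟩

theorem fst : PT fun x : α × β => x.1 :=
  ⟨Prog.fst, fun _ => 1, .const 1, PolyBdd.mu.mono fun _ => Nat.le_add_right _ _,
    fun _ => ⟨1, le_rfl, fun _ => Eval.fst _ _⟩⟩

theorem snd : PT fun x : α × β => x.2 :=
  ⟨Prog.snd, fun _ => 1, .const 1, PolyBdd.mu.mono fun _ => Nat.le_add_left _ _,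
    fun _ => ⟨1, le_rfl, fun _ => Eval.snd _ _⟩⟩

theorem of_nil {b : β} (h : enc b = Data.nil) : PT fun _ : α => b :=
  ⟨Prog.nil, fun _ => 1, .const 1, .const _, fun _ => ⟨1, le_rfl, fun _ => h ▸ Eval.nil _ _⟩⟩

theorem ite {b : α → Bool} {f g : α → β} (hb : PT b) (hf : PT f) (hg : PT g) :
    PT fun a => if b a then f a else g a := by
  obtain ⟨p, T, hT, _, h⟩ := hb
  obtain ⟨q, S, hS, hm, k⟩ := hf
  obtain ⟨q', S', hS', hm', k'⟩ := hg
  refine ⟨p.ite q q', fun a => T a + (S a + S' a) + 1, (hT.add (hS.add hS')).add (.const 1),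
    (hm.add hm').mono fun a => by dsimp only; split_ifs <;> omega, fun a => ?_⟩
  obtain ⟨t, ht, h⟩ := h a
  obtain ⟨s, hs, k⟩ := k a
  obtain ⟨s', hs', k'⟩ := k' a
  cases hba : b a with
  | true =>
    refine ⟨t + s + 1, by dsimp only; omega, fun r => ?_⟩
    have := h r
    rw [hba] at this
    simp only [hba, if_true]
    exact Eval.ite_true this (by simp [enc, Data.ofBool]) (k r)
  | false =>
    refine ⟨t + s' + 1, by dsimp only; omega, fun r => ?_⟩
    have := h r
    rw [hba] at this
    simp only [hba, Bool.false_eq_true, if_false]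
    exact Eval.ite_false this (k' r)

theorem succ : PT fun n : ℕ => n + 1 :=
  ⟨Prog.pair Prog.nil Prog.id, fun _ => 3, .const 3, PolyBdd.mu.add (.const 1),
    fun _ => ⟨3, le_rfl, fun _ => Eval.pair (Eval.nil _ _) (Eval.id _ _)⟩⟩

theorem pred : PT fun n : ℕ => n - 1 :=
  ⟨Prog.snd, fun _ => 1, .const 1, PolyBdd.mu.mono fun n => Nat.sub_le n 1,
    fun n => ⟨1, le_rfl, fun r => by cases n <;> exact Eval.snd _ r⟩⟩

theorem false : PT fun _ : α => false := of_nil rfl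

theorem true : PT fun _ : α => true :=
  ⟨Prog.pair Prog.nil Prog.nil, fun _ => 3, .const 3, .const 0,
    fun _ => ⟨3, le_rfl, fun _ => Eval.pair (Eval.nil _ _) (Eval.nil _ _)⟩⟩

theorem nil : PT fun _ : α => ([] : List β) := of_nil rfl

theorem cons {f : α → β} {g : α → List β} (hf : PT f) (hg : PT g) : PT fun a => f a :: g a := by
  obtain ⟨p, T, hT, hm, h⟩ := hf.pair hg
  exact ⟨p, T, hT, (hm.add (.const 1)).mono fun a => by simp; omega, h⟩

theorem tail : PT fun l : List α => l.tail :=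
  ⟨Prog.snd, fun _ => 1, .const 1, PolyBdd.mu.mono fun l => by cases l <;> simp,
    fun l => ⟨1, le_rfl, fun r => by cases l <;> exact Eval.snd _ r⟩⟩

/-- The default must be encoded by the atom, because that is what `Prog.fst` returns on the empty
list. -/
theorem headD (d : α) (hd : enc d = Data.nil) : PT fun l : List α => l.headD d :=
  ⟨Prog.fst, fun _ => 1, .const 1,
    (PolyBdd.mu.add (.const (mu d))).mono fun l => by cases l <;> simp; omega,
    fun l => ⟨1, le_rfl, fun r => by
      cases l with
      | nil => show Eval _ _ _ (enc d) _ _; rw [hd]; exact Eval.fst _ r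
      | cons a l => exact Eval.fst _ r⟩⟩

theorem nat_ne_zero : PT fun n : ℕ => decide (n ≠ 0) :=
  ⟨Prog.ite Prog.id (Prog.pair Prog.nil Prog.nil) Prog.nil, fun _ => 5, .const 5, .const 0,
    fun n => by
      cases n with
      | zero => exact ⟨3, by norm_num, fun r => Eval.ite_false (Eval.id _ _) (Eval.nil _ _)⟩
      | succ n => exact ⟨5, le_rfl, fun r => Eval.ite_true (Eval.id _ _) (by simp)
          (Eval.pair (Eval.nil _ _) (Eval.nil _ _))⟩⟩

/-- Bounded iteration. -/
theorem foldn {n : α → ℕ} {s : α → σ} {F : α → ℕ → σ → σ} (hn : PT n) (hs : PT s)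
    (hF : PT fun x : α × ℕ × σ => F x.1 x.2.1 x.2.2) {B : α → ℕ} (hB : PolyBdd B)
    (hb : ∀ a, ∀ i ≤ n a, mu (_root_.foldn i (F a) (s a)) ≤ B a) :
    PT fun a => _root_.foldn (n a) (F a) (s a) := by
  obtain ⟨pn, Tn, hTn, hmn, kn⟩ := hn
  obtain ⟨ps, Ts, hTs, hms, ks⟩ := hs
  obtain ⟨pF, TF, hTF, hmF, kF⟩ := hF
  -- The loop body is only run at indices up to `n a` and states of parameter at most `B a`, so one
  -- bound `S a` serves all rounds.
  obtain ⟨S, hS, hTS⟩ := hTF.exists_mono ((PolyBdd.mu (α := α).add hmn).add hB)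
  -- The loop state is `(a, i, m, s)`: the input, the index of the round, the number of rounds still
  -- to go, which `test` reads, and the current value.
  let body : Prog := Prog.pair Prog.fst
    (Prog.pair (Prog.pair Prog.nil (Prog.seq Prog.snd Prog.fst))
      (Prog.pair (Prog.seq Prog.snd (Prog.seq Prog.snd (Prog.seq Prog.fst Prog.snd)))
        (Prog.seq (Prog.pair Prog.fst (Prog.pair (Prog.seq Prog.snd Prog.fst)
          (Prog.seq Prog.snd (Prog.seq Prog.snd Prog.snd)))) pF)))
  let test : Prog := Prog.seq Prog.snd (Prog.seq Prog.snd Prog.fst)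
  have loop : ∀ a, ∀ m i, i + m = n a → ∃ t ≤ m * (S a + 40) + 10, ∀ r,
      Eval (Prog.loop test body)
        (enc (a, i, m, _root_.foldn i (F a) (s a))) r
        (enc (a, i + m, 0, _root_.foldn (i + m) (F a) (s a))) r t := by
    intro a m
    induction m with
    | zero =>
      intro i hi
      refine ⟨6, by omega, fun r => ?_⟩
      refine Eval.loop_done (r₁ := r) (t := 5) ?_
      exact Eval.seq (Eval.snd _ _) (Eval.seq (Eval.snd _ _) (Eval.fst _ _))
    | succ m ih =>
      intro i hi
      obtain ⟨t, ht, h⟩ := ih (i + 1) (by omega)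
      obtain ⟨u, hu, k⟩ := kF (a, i, _root_.foldn i (F a) (s a))
      have hu' : u ≤ S a := hu.trans (hTS a _ (by
        have := hb a i (by omega)
        simp only [mu_prod, mu_nat]
        omega))
      refine ⟨5 + (1 + ((1 + 3 + 1) + (7 + (11 + u + 1) + 1) + 1) + 1) + t + 1, by
        rw [Nat.succ_mul]; omega, fun r => ?_⟩
      have e : i + 1 + m = i + (m + 1) := by omega
      rw [e] at h
      refine Eval.loop_step (v := enc (m + 1)) (r₁ := r) (r₂ := r) ?_ (by simp) ?_ (h r)
      · exact Eval.seq (Eval.snd _ _) (Eval.seq (Eval.snd _ _) (Eval.fst _ _))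
      · refine Eval.pair (Eval.fst _ _) (Eval.pair
          (Eval.pair (Eval.nil _ _) (Eval.seq (Eval.snd _ _) (Eval.fst _ _))) (Eval.pair (r₁ := r) ?_ ?_))
        · exact Eval.seq (Eval.snd _ _) (Eval.seq (Eval.snd _ _)
            (Eval.seq (Eval.fst _ _) (Eval.snd _ _)))
        · exact Eval.seq (Eval.pair (Eval.fst _ _) (Eval.pair (Eval.seq (Eval.snd _ _)
            (Eval.fst _ _)) (Eval.seq (Eval.snd _ _) (Eval.seq (Eval.snd _ _) (Eval.snd _ _)))))
            (k r)
  refine ⟨Prog.seq (Prog.seq (Prog.pair Prog.id (Prog.pair Prog.nil (Prog.pair pn ps)))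
      (Prog.loop test body)) (Prog.seq Prog.snd (Prog.seq Prog.snd Prog.snd)),
    fun a => Tn a + Ts a + n a * (S a + 40) + 30,
    ((hTn.add hTs).add (PolyBdd.mul hmn (hS.add (.const 40)))).add (.const 30),
    hB.mono fun a => hb a _ le_rfl, fun a => ?_⟩
  obtain ⟨tn, htn, kn⟩ := kn a
  obtain ⟨ts, hts, ks⟩ := ks a
  obtain ⟨t, ht, h⟩ := loop a (n a) 0 (by omega)
  refine ⟨((1 + (1 + (tn + ts + 1) + 1) + 1) + t + 1) + 5 + 1, by dsimp only; omega, fun r => ?_⟩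
  rw [Nat.zero_add] at h
  refine Eval.seq (t₁ := (1 + (1 + (tn + ts + 1) + 1) + 1) + t + 1) (t₂ := 5)
    (Eval.seq (Eval.pair (Eval.id _ _) (Eval.pair (Eval.nil _ _)
      (Eval.pair (kn r) (ks r)))) (h r)) ?_
  exact Eval.seq (Eval.snd _ _) (Eval.seq (Eval.snd _ _) (Eval.snd _ _))

end PT

attribute [fun_prop] PT PT.id PT.comp PT.pair PT.cons

/-! ### Arithmetic, lists and iteration in polynomial time. -/

namespace PT

variable {α β γ σ : Type} [Enc α] [Enc β] [Enc γ] [Enc σ]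

@[fun_prop] theorem const (b : β) : PT fun _ : α => b := by
  have h : ∀ d : Data, ∃ (p : Prog) (t : ℕ), ∀ x r, Eval p x r d r t := by
    intro d
    induction d with
    | nil => exact ⟨Prog.nil, 1, fun x r => Eval.nil x r⟩
    | cons d e hd he =>
      obtain ⟨p, t, hp⟩ := hd
      obtain ⟨q, s, hq⟩ := he
      exact ⟨Prog.pair p q, t + s + 1, fun x r => Eval.pair (hp x r) (hq x r)⟩
  obtain ⟨p, t, hp⟩ := h (enc b)
  exact ⟨p, fun _ => t, .const t, .const _, fun a => ⟨t, le_rfl, fun r => hp _ r⟩⟩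

@[fun_prop] theorem fst_comp {f : α → β × γ} (hf : PT f) : PT fun a => (f a).1 := fst.comp hf

@[fun_prop] theorem snd_comp {f : α → β × γ} (hf : PT f) : PT fun a => (f a).2 := snd.comp hf

@[fun_prop] theorem ite_prop {P : α → Prop} [DecidablePred P] {f g : α → β}
    (hp : PT fun a => decide (P a)) (hf : PT f) (hg : PT g) :
    PT fun a => if P a then f a else g a :=
  (ite hp hf hg).of_eq fun a => by by_cases h : P a <;> simp [h]

@[fun_prop] theorem decide_bool {b : α → Bool} (hb : PT b) : PT fun a => decide (b a = Bool.true) :=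
  hb.of_eq fun a => by simp

@[fun_prop] theorem decide_and {P Q : α → Prop} [DecidablePred P] [DecidablePred Q]
    (hP : PT fun a => decide (P a)) (hQ : PT fun a => decide (Q a)) :
    PT fun a => decide (P a ∧ Q a) :=
  (ite hP hQ false).of_eq fun a => by by_cases h : P a <;> simp [h]

@[fun_prop] theorem decide_or {P Q : α → Prop} [DecidablePred P] [DecidablePred Q]
    (hP : PT fun a => decide (P a)) (hQ : PT fun a => decide (Q a)) :
    PT fun a => decide (P a ∨ Q a) :=
  (ite hP true hQ).of_eq fun a => by by_cases h : P a <;> simp [h]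

@[fun_prop] theorem decide_not {P : α → Prop} [DecidablePred P]
    (hP : PT fun a => decide (P a)) : PT fun a => decide (¬ P a) :=
  (ite hP false true).of_eq fun a => by by_cases h : P a <;> simp [h]

@[fun_prop] theorem succ_comp {f : α → ℕ} (hf : PT f) : PT fun a => f a + 1 := succ.comp hf

@[fun_prop] theorem add {f g : α → ℕ} (hf : PT f) (hg : PT g) : PT fun a => f a + g a := by
  have e : ∀ a i, _root_.foldn i (fun _ s => s + 1) (f a) = f a + i := by
    intro a i
    induction i with
    | zero => rfl
    | succ i ih => rw [_root_.foldn, ih]; rfl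
  refine (foldn (F := fun _ _ s => s + 1) hg hf (by fun_prop) (hf.polyBdd.add hg.polyBdd)
    fun a i hi => ?_).of_eq fun a => e a _
  rw [e, mu_nat, mu_nat, mu_nat]
  omega

@[fun_prop] theorem sub {f g : α → ℕ} (hf : PT f) (hg : PT g) : PT fun a => f a - g a := by
  have e : ∀ a i, _root_.foldn i (fun _ s => s - 1) (f a) = f a - i := by
    intro a i
    induction i with
    | zero => rfl
    | succ i ih => rw [_root_.foldn, ih]; rfl
  refine (foldn (F := fun _ _ s => s - 1) hg hf (pred.comp (by fun_prop)) hf.polyBdd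
    fun a i hi => ?_).of_eq fun a => e a _
  rw [e, mu_nat, mu_nat]
  omega

@[fun_prop] theorem mul {f g : α → ℕ} (hf : PT f) (hg : PT g) : PT fun a => f a * g a := by
  have e : ∀ a i, _root_.foldn i (fun _ s => s + f a) 0 = f a * i := by
    intro a i
    induction i with
    | zero => rfl
    | succ i ih => rw [_root_.foldn, ih]; rfl
  refine (foldn (F := fun a _ s => s + f a) hg (const 0) (by fun_prop)
    (hf.polyBdd.mul hg.polyBdd) fun a i hi => ?_).of_eq fun a => e a _
  rw [e]
  exact Nat.mul_le_mul_left _ hi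

@[fun_prop] theorem decide_lt {f g : α → ℕ} (hf : PT f) (hg : PT g) :
    PT fun a => decide (f a < g a) :=
  (nat_ne_zero.comp (hg.sub hf)).of_eq fun a => by
    rw [decide_eq_decide]; omega

@[fun_prop] theorem decide_le {f g : α → ℕ} (hf : PT f) (hg : PT g) :
    PT fun a => decide (f a ≤ g a) :=
  (hg.decide_lt hf).decide_not.of_eq fun a => by simp

@[fun_prop] theorem decide_eq {f g : α → ℕ} (hf : PT f) (hg : PT g) :
    PT fun a => decide (f a = g a) :=
  ((hf.decide_le hg).decide_and (hg.decide_le hf)).of_eq fun a => by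
    rw [decide_eq_decide]; omega

@[fun_prop] theorem min {f g : α → ℕ} (hf : PT f) (hg : PT g) : PT fun a => min (f a) (g a) :=
  (ite_prop (hf.decide_le hg) hf hg).of_eq fun a => by rw [min_def]

/-- A counter that returns to zero on reaching `d`; for `d = 0` it never does, in agreement with `n
% 0 = n`. -/
theorem mod_eq_foldn (n d : ℕ) :
    n % d = _root_.foldn n (fun _ r => if r + 1 = d then 0 else r + 1) 0 := by
  induction n with
  | zero => simp [_root_.foldn]
  | succ n ih =>
    rw [_root_.foldn, ← ih]
    rcases Nat.eq_zero_or_pos d with rfl | hd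
    · simp
    split_ifs with h
    · rw [Nat.add_mod_eq_ite]
      rcases Nat.lt_or_ge 1 d with h1 | h1
      · rw [Nat.mod_eq_of_lt h1, if_pos (by omega)]; omega
      · have : d = 1 := by omega
        subst this
        have := Nat.mod_one n
        rw [if_neg (by omega)]
        omega
    · have := Nat.mod_lt n hd
      rcases Nat.lt_or_ge 1 d with h1 | h1
      · rw [Nat.add_mod_eq_ite, Nat.mod_eq_of_lt h1, if_neg (by omega)]
      · omega

@[fun_prop] theorem mod {f g : α → ℕ} (hf : PT f) (hg : PT g) : PT fun a => f a % g a := by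
  refine (foldn (F := fun a _ r => if r + 1 = g a then 0 else r + 1) hf (const 0) (by fun_prop)
    hf.polyBdd fun a i hi => ?_).of_eq fun a => (mod_eq_foldn _ _).symm
  rw [← mod_eq_foldn]
  exact (Nat.mod_le _ _).trans hi

theorem foldn_add (f : ℕ → ℕ) (n : ℕ) :
    _root_.foldn n (fun i s => s + f i) 0 = ∑ i ∈ Finset.range n, f i := by
  induction n with
  | zero => rfl
  | succ n ih => rw [_root_.foldn, ih, Finset.sum_range_succ]

/-- A polynomial bound for the values of a polynomial time function at indices below `n a`. -/
theorem exists_bound {n : α → ℕ} {f : α → ℕ → β} (hn : PT n)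
    (hf : PT fun x : α × ℕ => f x.1 x.2) :
    ∃ S : α → ℕ, PolyBdd S ∧ ∀ a, ∀ i < n a, mu (f a i) ≤ S a := by
  obtain ⟨S, hS, h⟩ := hf.polyBdd.exists_mono (PolyBdd.mu.add hn.polyBdd)
  exact ⟨S, hS, fun a i hi => h a (a, i) (by simp only [mu_prod, mu_nat]; omega)⟩

@[fun_prop] theorem sum {n : α → ℕ} {f : α → ℕ → ℕ} (hn : PT n)
    (hf : PT fun x : α × ℕ => f x.1 x.2) : PT fun a => ∑ i ∈ Finset.range (n a), f a i := by
  obtain ⟨S, hS, h⟩ := exists_bound hn hf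
  have hf' : PT fun x : α × ℕ × ℕ => f x.1 x.2.1 :=
    hf.comp (f := fun x : α × ℕ × ℕ => (x.1, x.2.1)) (by fun_prop)
  refine (foldn (F := fun a i s => s + f a i) hn (const 0) (by fun_prop)
    (hn.polyBdd.mul hS) fun a i hi => ?_).of_eq fun a => foldn_add _ _
  rw [foldn_add, mu_nat, mu_nat]
  calc ∑ j ∈ Finset.range i, f a j ≤ ∑ j ∈ Finset.range i, S a :=
        Finset.sum_le_sum fun j hj => h a j (by have := Finset.mem_range.1 hj; omega)
    _ = i * S a := by simp
    _ ≤ n a * S a := Nat.mul_le_mul_right _ hi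

/-- Exactly `n / 2` of the numbers below `n` are odd. -/
theorem half_eq_sum (n : ℕ) : n / 2 = ∑ i ∈ Finset.range n, i % 2 := by
  induction n with
  | zero => rfl
  | succ n ih => rw [Finset.sum_range_succ, ← ih]; omega

@[fun_prop] theorem half {f : α → ℕ} (hf : PT f) : PT fun a => f a / 2 := by
  have : PT fun a => ∑ i ∈ Finset.range (f a), i % 2 := by fun_prop
  exact this.of_eq fun a => (half_eq_sum _).symm

@[fun_prop] theorem testBit {f g : α → ℕ} (hf : PT f) (hg : PT g) :
    PT fun a => (f a).testBit (g a) := by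
  have e : ∀ a i, _root_.foldn i (fun _ s => s / 2) (f a) = f a / 2 ^ i := by
    intro a i
    induction i with
    | zero => simp [_root_.foldn]
    | succ i ih => rw [_root_.foldn, ih, Nat.div_div_eq_div_mul, pow_succ]
  have h : PT fun a => _root_.foldn (g a) (fun _ s => s / 2) (f a) := by
    refine foldn (F := fun _ _ s => s / 2) hg hf (by fun_prop) hf.polyBdd fun a i hi => ?_
    rw [e]
    exact Nat.div_le_self _ _
  have h' : PT fun a => decide (_root_.foldn (g a) (fun _ s => s / 2) (f a) % 2 = 1) := by
    fun_prop
  exact h'.of_eq fun a => by rw [e, Nat.testBit_eq_decide_div_mod_eq]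

theorem mu_drop_le (l : List α) (i : ℕ) : mu (l.drop i) ≤ mu l := by
  induction i generalizing l with
  | zero => simp
  | succ i ih =>
    cases l with
    | nil => simp
    | cons a l => exact (ih l).trans (by simp)

theorem getD_of_nil {l : α → List β} {i : α → ℕ} (d : β) (hd : enc d = Data.nil) (hl : PT l)
    (hi : PT i) : PT fun a => (l a).getD (i a) d := by
  have e : ∀ a j, _root_.foldn j (fun _ s => s.tail) (l a) = (l a).drop j := by
    intro a j
    induction j with
    | zero => rfl
    | succ j ih => rw [_root_.foldn, ih, List.tail_drop]
  have h : PT fun a => _root_.foldn (i a) (fun _ s => s.tail) (l a) := by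
    refine foldn (F := fun _ _ s => s.tail) hi hl (tail.comp (by fun_prop)) hl.polyBdd
      fun a j hj => ?_
    rw [e]
    exact mu_drop_le _ _
  refine ((headD d hd).comp h).of_eq fun a => ?_
  rw [e, List.headD_eq_head?_getD, List.head?_drop, List.getD_eq_getElem?_getD]

@[fun_prop] theorem getD_zero {l : α → List ℕ} {i : α → ℕ} (hl : PT l) (hi : PT i) :
    PT fun a => (l a).getD (i a) 0 := getD_of_nil 0 rfl hl hi

@[fun_prop] theorem getD_false {l : α → List Bool} {i : α → ℕ} (hl : PT l) (hi : PT i) :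
    PT fun a => (l a).getD (i a) Bool.false := getD_of_nil _ rfl hl hi

@[fun_prop] theorem getD_nil {l : α → List (List β)} {i : α → ℕ} (hl : PT l) (hi : PT i) :
    PT fun a => (l a).getD (i a) [] := getD_of_nil [] rfl hl hi

-- This needs a loop of its own, controlled by the list: `foldn` presupposes that the number of
-- rounds has been computed already.
@[fun_prop] theorem length {f : α → List β} (hf : PT f) : PT fun a => (f a).length := by
  have key : PT fun l : List β => l.length := by
    have hlen : ∀ l : List β, l.length ≤ mu l := by
      intro l
      induction l with
      | nil => simp
      | cons a l ih => simp only [List.length_cons, mu_list_cons]; omega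
    let body : Prog := Prog.pair (Prog.seq Prog.fst Prog.snd) (Prog.pair Prog.nil Prog.snd)
    have loop : ∀ (l : List β) (n : ℕ), ∀ r, Eval (Prog.loop Prog.fst body) (enc (l, n)) r
        (enc (([] : List β), n + l.length)) r (9 * l.length + 2) := by
      intro l
      induction l with
      | nil => intro n r; exact Eval.loop_done (Eval.fst _ _)
      | cons a l ih =>
        intro n r
        have e : 9 * (a :: l).length + 2
            = 1 + ((1 + 1 + 1) + (1 + 1 + 1) + 1) + (9 * l.length + 2) + 1 := by
          simp only [List.length_cons]; omega
        have e' : n + (a :: l).length = (n + 1) + l.length := by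
          simp only [List.length_cons]; omega
        rw [e, e']
        refine Eval.loop_step (v := enc (a :: l)) (r₁ := r) (r₂ := r) (Eval.fst _ _) (by simp) ?_
          (ih (n + 1) r)
        exact Eval.pair (t₁ := 1 + 1 + 1) (t₂ := 1 + 1 + 1) (Eval.seq (Eval.fst _ _) (Eval.snd _ _))
          (Eval.pair (Eval.nil _ _) (Eval.snd _ _))
    refine ⟨Prog.seq (Prog.seq (Prog.pair Prog.id Prog.nil) (Prog.loop Prog.fst body)) Prog.snd,
      fun l => 9 * mu l + 20, (PolyBdd.mul (.const 9) .mu).add (.const 20),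
      PolyBdd.mu.mono hlen, fun l => ?_⟩
    refine ⟨((1 + 1 + 1) + (9 * l.length + 2) + 1) + 1 + 1, ?_, fun r => ?_⟩
    · have := hlen l
      dsimp only
      omega
    · have := loop l 0 r
      rw [Nat.zero_add] at this
      exact Eval.seq (t₁ := (1 + 1 + 1) + (9 * l.length + 2) + 1) (t₂ := 1)
        (Eval.seq (Eval.pair (Eval.id _ _) (Eval.nil _ _)) this) (Eval.snd _ _)
  exact key.comp hf

/-- A list grows at its front, so the entries are produced from the last index downwards. -/
theorem foldn_cons {δ : Type} (f : ℕ → δ) (n : ℕ) : ∀ i ≤ n,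
    _root_.foldn i (fun i s => f (n - 1 - i) :: s) [] = (List.range' (n - i) i).map f := by
  intro i
  induction i with
  | zero => intro _; rfl
  | succ i ih =>
    intro hi
    rw [_root_.foldn, ih (by omega)]
    have e : List.range' (n - (i + 1)) (i + 1) = (n - 1 - i) :: List.range' (n - i) i := by
      have h1 : n - (i + 1) = n - 1 - i := by omega
      have h2 : n - 1 - i + 1 = n - i := by omega
      rw [h1, List.range'_succ, h2]
    rw [e]; rfl

theorem mu_map_le {ι : Type} (f : ι → β) (l : List ι) (S : ℕ) (h : ∀ i ∈ l, mu (f i) ≤ S) :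
    mu (l.map f) ≤ l.length * (S + 1) := by
  induction l with
  | nil => simp
  | cons a l ih =>
    have h1 := h a (by simp)
    have h2 := ih fun i hi => h i (by simp [hi])
    rw [List.map_cons, mu_list_cons, List.length_cons, Nat.succ_mul]
    omega

@[fun_prop] theorem map_range {n : α → ℕ} {f : α → ℕ → β} (hn : PT n)
    (hf : PT fun x : α × ℕ => f x.1 x.2) : PT fun a => (List.range (n a)).map (f a) := by
  obtain ⟨S, hS, h⟩ := exists_bound hn hf
  have hf' : PT fun x : α × ℕ × List β => f x.1 (n x.1 - 1 - x.2.1) :=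
    hf.comp (f := fun x : α × ℕ × List β => (x.1, n x.1 - 1 - x.2.1)) (by fun_prop)
  refine (foldn (F := fun a i s => f a (n a - 1 - i) :: s) hn nil (by fun_prop)
    (hn.polyBdd.mul (hS.add (.const 1))) fun a i hi => ?_).of_eq fun a => ?_
  · rw [foldn_cons _ _ _ hi]
    refine (mu_map_le _ _ (S a) fun j hj => h a j ?_).trans ?_
    · rw [List.mem_range'_1] at hj
      omega
    · rw [List.length_range']
      exact Nat.mul_le_mul_right _ hi
  · rw [foldn_cons _ _ _ le_rfl, Nat.sub_self, List.range_eq_range']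

/-- Iteration of a function all of whose values are small. -/
theorem iterate {n : α → ℕ} {s : α → σ} {F : α → σ → σ} (hn : PT n) (hs : PT s)
    (hF : PT fun x : α × σ => F x.1 x.2) {B : α → ℕ} (hB : PolyBdd B)
    (hb : ∀ a s, mu (F a s) ≤ B a) : PT fun a => (F a)^[n a] (s a) := by
  have e : ∀ a i, _root_.foldn i (fun _ => F a) (s a) = (F a)^[i] (s a) := by
    intro a i
    induction i with
    | zero => rfl
    | succ i ih => rw [_root_.foldn, ih, Function.iterate_succ_apply']
  have hF' : PT fun x : α × ℕ × σ => F x.1 x.2.2 :=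
    hF.comp (f := fun x : α × ℕ × σ => (x.1, x.2.2)) (by fun_prop)
  refine (foldn (F := fun a _ => F a) hn hs hF' (hB.add hs.polyBdd) fun a i hi => ?_).of_eq
    fun a => e a _
  cases i with
  | zero => exact Nat.le_add_left _ _
  | succ i => exact (hb a _).trans (Nat.le_add_right _ _)

/-- Bounded iteration of a function that preserves a bound. -/
theorem foldn_of_bounded {n : α → ℕ} {s : α → σ} {F : α → ℕ → σ → σ} (hn : PT n) (hs : PT s)
    (hF : PT fun x : α × ℕ × σ => F x.1 x.2.1 x.2.2) {B : α → ℕ} (hB : PolyBdd B)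
    (hb₀ : ∀ a, mu (s a) ≤ B a) (hb : ∀ a i s, mu s ≤ B a → mu (F a i s) ≤ B a) :
    PT fun a => _root_.foldn (n a) (F a) (s a) := by
  refine foldn hn hs hF hB fun a i _ => ?_
  induction i with
  | zero => exact hb₀ a
  | succ i ih => exact hb a i _ (ih (by omega))

end PT

/-! ### The algorithm -/

/-- An adjacency matrix as the program sees it. -/
abbrev BoolMat := List (List Bool)

/-- The entry of an adjacency matrix; `false` outside the range. -/
def adjAt (A : BoolMat) (i j : ℕ) : Bool := (A.getD i []).getD j false

/-- One round of the propagation of the least vertex of each component. -/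
def labelStep (A : BoolMat) (l : List ℕ) : List ℕ :=
  (List.range A.length).map fun v => foldn A.length
    (fun u s => if adjAt A v u then min s (l.getD u 0) else s) (min (l.getD v 0) v)

/-- The list of the least vertices of the components of the vertices. -/
def labels (A : BoolMat) : List ℕ :=
  -- Mapping the identity puts the initial list into the form covered by `PT.map_range`.
  (labelStep A)^[A.length] ((List.range A.length).map fun i => i)

/-- The vertex `i` is the least one of its component. -/
def IsRep (A : BoolMat) (i : ℕ) : Prop := (labels A).getD i 0 = i

instance (A : BoolMat) : DecidablePred (IsRep A) := fun i =>
  inferInstanceAs (Decidable ((labels A).getD i 0 = i))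

/-- The number of components whose least vertex is below `n`. -/
def countReps (A : BoolMat) (n : ℕ) : ℕ := ∑ i ∈ Finset.range n, if IsRep A i then 1 else 0

/-- The number of the component of the vertex `x`. -/
def compIndex (A : BoolMat) (x : ℕ) : ℕ := countReps A ((labels A).getD x 0)

/-- Entry of a matrix of numbers; `0` outside the range. -/
def entry₂ (M : List (List ℕ)) (i j : ℕ) : ℕ := (M.getD i []).getD j 0

/-- Entry of a table with four indices; `0` outside the range. -/
def entry₄ (T : List (List (List (List ℕ)))) (a x v w : ℕ) : ℕ :=
  (((T.getD a []).getD x []).getD v []).getD w 0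

/-- A matrix given by its entries. -/
def table₂ (n : ℕ) (f : ℕ → ℕ → ℕ) : List (List ℕ) :=
  (List.range n).map fun i => (List.range n).map fun j => f i j

/-- One round of Bird's algorithm modulo `p + 1`. -/
def birdMod (p n : ℕ) (M X : List (List ℕ)) : List (List ℕ) :=
  table₂ n fun i j => (∑ r ∈ Finset.range n,
    (if r = i then ∑ s ∈ Finset.range n, (if i < s then entry₂ X s s else 0)
      else if i < r then p * entry₂ X i r else 0) * entry₂ M r j) % (p + 1)

/-- The determinant modulo `p + 1`. -/
def detMod (p n : ℕ) (M : List (List ℕ)) : ℕ := entry₂ ((birdMod p n M)^[n - 1] M) 0 0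

/-- The adjacency matrices of the two graphs, the number of sets of components of the first graph,
the predecessor of a prime number, the number of random bits for each random number, and the random
bits. -/
abbrev Env := (BoolMat × BoolMat × ℕ × ℕ × ℕ) × List Bool

namespace Env

/-- The adjacency matrix of the pattern. -/
def matH (e : Env) : BoolMat := e.1.1
/-- The adjacency matrix of the host. -/
def matG (e : Env) : BoolMat := e.1.2.1
/-- The number of sets of components. -/
def sets (e : Env) : ℕ := e.1.2.2.1
/-- The predecessor of the prime number. -/
def pred (e : Env) : ℕ := e.1.2.2.2.1
/-- The number of bits for each random number. -/
def width (e : Env) : ℕ := e.1.2.2.2.2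
/-- The random bits. -/
def bits (e : Env) : List Bool := e.2
/-- The number of vertices of the pattern. -/
def h (e : Env) : ℕ := e.matH.length
/-- The number of vertices of the host. -/
def g (e : Env) : ℕ := e.matG.length

/-- The random number for the vertex `x` of the pattern and the vertex `w` of the host. -/
def point (e : Env) (x w : ℕ) : ℕ :=
  foldn e.width (fun i s =>
    (s + s + if e.bits.getD ((x * e.g + w) * e.width + i) false then 1 else 0) % (e.pred + 1)) 0

/-- The random numbers, for a set `t` of components replaced by zero outside these components. -/
def rootPoint (e : Env) (t x w : ℕ) : ℕ :=
  if x = e.h ∨ t.testBit (compIndex e.matH x) then e.point x w else 0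

/-- The vertex `y` follows the arc from `a` to `x` in the pattern. -/
def succH (e : Env) (a x y : ℕ) : Prop := adjAt e.matH x y = true ∧ y ≠ a

/-- The vertex `i` follows the arc from `v` to `w` in the host. -/
def succG (e : Env) (v w i : ℕ) : Prop := adjAt e.matG w i = true ∧ i ≠ v

instance (e : Env) (a x y : ℕ) : Decidable (e.succH a x y) :=
  inferInstanceAs (Decidable (_ ∧ _))

instance (e : Env) (v w i : ℕ) : Decidable (e.succG v w i) :=
  inferInstanceAs (Decidable (_ ∧ _))

/-- The value of the branch behind the arc from `v` to `w` of the host without an obligation. -/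
def freeValue (e : Env) (t : ℕ) (T : List (List (List (List ℕ)))) (v w : ℕ) : ℕ :=
  (∑ x ∈ Finset.range (e.h + 1), e.rootPoint t x w * entry₄ T x x v w) % (e.pred + 1)

/-- The entries of the matrix whose determinant is the value for the arc from `a` to `x` of the
pattern at the arc from `v` to `w` of the host. -/
def matchEntry (e : Env) (t : ℕ) (T : List (List (List (List ℕ)))) (a x v w i j : ℕ) : ℕ :=
  if i < e.g then
    if j < e.g then
      if i = j then (if e.succG v w i then e.freeValue t T w i else 1) else 0
    else
      if e.succG v w i ∧ e.succH a x (j - e.g) then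
        e.point (j - e.g) i * entry₄ T x (j - e.g) w i else 0
  else
    if j < e.g then
      if e.succG v w j ∧ e.succH a x (i - e.g) then e.point (i - e.g) j else 0
    else
      if i = j then (if e.succH a x (i - e.g) then 0 else 1) else 0

/-- The next table of values. -/
def tableStep (e : Env) (t : ℕ) (T : List (List (List (List ℕ)))) :
    List (List (List (List ℕ))) :=
  (List.range (e.h + 1)).map fun a => (List.range (e.h + 1)).map fun x =>
    (List.range e.g).map fun v => (List.range e.g).map fun w =>
      -- The outer reduction bounds every entry by `e.pred` for an arbitrary table `T`, without any
      -- knowledge of `detMod`.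
      detMod e.pred (e.g + (e.h + 1))
        (table₂ (e.g + (e.h + 1)) fun i j => e.matchEntry t T a x v w i j) % (e.pred + 1)

/-- The table of values. -/
def valueTable (e : Env) (t : ℕ) : List (List (List (List ℕ))) := (e.tableStep t)^[e.g] []

/-- The product of the values of the components of the host. -/
def total (e : Env) (t : ℕ) : ℕ :=
  foldn e.g (fun w s => if IsRep e.matG w then
    s * e.freeValue t (e.valueTable t) w w % (e.pred + 1) else s) 1

/-- The sign of a set of components. -/
def sign (e : Env) (t : ℕ) : ℕ :=
  foldn (countReps e.matH e.h) (fun j s => if t.testBit j then s else s * e.pred % (e.pred + 1)) 1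

/-- The alternating sum over all sets of components. -/
def result (e : Env) : ℕ := (∑ t ∈ Finset.range e.sets, e.sign t * e.total t) % (e.pred + 1)

end Env

/-! ### The algorithm takes polynomial time -/

namespace PT

variable {α : Type} [Enc α]

@[fun_prop] theorem adjAt {A : α → BoolMat} {i j : α → ℕ} (hA : PT A) (hi : PT i) (hj : PT j) :
    PT fun a => adjAt (A a) (i a) (j a) := by
  unfold _root_.adjAt; fun_prop

theorem foldn_min_le {s : ℕ} (n : ℕ) (P : ℕ → Bool) (l : List ℕ) :
    _root_.foldn n (fun u s => if P u then Min.min s (l.getD u 0) else s) s ≤ s := by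
  induction n with
  | zero => exact le_rfl
  | succ n ih =>
    rw [_root_.foldn]
    split_ifs
    · exact (min_le_left _ _).trans ih
    · exact ih

-- The minimum with `v` in the definition of `labelStep` bounds the new labels for an arbitrary
-- incoming list, as `iterate` demands.
@[fun_prop] theorem labelStep {A : α → BoolMat} {l : α → List ℕ} (hA : PT A) (hl : PT l) :
    PT fun a => labelStep (A a) (l a) := by
  unfold _root_.labelStep
  have key : PT fun x : (BoolMat × List ℕ) × ℕ => _root_.foldn x.1.1.length
      (fun u s => if _root_.adjAt x.1.1 x.2 u then Min.min s (x.1.2.getD u 0) else s)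
      (Min.min (x.1.2.getD x.2 0) x.2) := by
    refine foldn_of_bounded (F := fun (x : (BoolMat × List ℕ) × ℕ) u s =>
      if _root_.adjAt x.1.1 x.2 u then Min.min s (x.1.2.getD u 0) else s)
      (B := fun x => x.2) (by fun_prop) (by fun_prop) (by fun_prop)
      (PT.polyBdd (f := fun x : (BoolMat × List ℕ) × ℕ => x.2) (by fun_prop)) ?_ ?_
    · intro a; exact min_le_right _ _
    · intro a i s hs
      simp only [mu_nat] at hs ⊢
      split_ifs
      · exact (min_le_left _ _).trans hs
      · exact hs
  refine map_range (by fun_prop) ?_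
  exact key.comp (f := fun x : α × ℕ => ((A x.1, l x.1), x.2)) (by fun_prop)

@[fun_prop] theorem labels {A : α → BoolMat} (hA : PT A) : PT fun a => labels (A a) := by
  have key : PT _root_.labels := by
    refine iterate (F := _root_.labelStep) (B := fun A : BoolMat => A.length * (A.length + 1))
      (by fun_prop) (by fun_prop) (by fun_prop) ?_ ?_
    · exact PT.polyBdd (f := fun A : BoolMat => A.length * (A.length + 1)) (by fun_prop)
    · intro A l
      refine (mu_map_le _ _ A.length fun i hi => ?_).trans (by rw [List.length_range])
      rw [mu_nat]
      exact (foldn_min_le _ _ _).trans ((min_le_right _ _).trans (List.mem_range.1 hi).le)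
  exact key.comp hA

@[fun_prop] theorem decide_isRep {A : α → BoolMat} {i : α → ℕ} (hA : PT A) (hi : PT i) :
    PT fun a => decide (IsRep (A a) (i a)) := by
  have : PT fun a => decide ((_root_.labels (A a)).getD (i a) 0 = i a) := by fun_prop
  exact this

@[fun_prop] theorem countReps {A : α → BoolMat} {i : α → ℕ} (hA : PT A) (hi : PT i) :
    PT fun a => countReps (A a) (i a) := by
  unfold _root_.countReps; fun_prop

@[fun_prop] theorem compIndex {A : α → BoolMat} {i : α → ℕ} (hA : PT A) (hi : PT i) :
    PT fun a => compIndex (A a) (i a) := by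
  unfold _root_.compIndex; fun_prop

@[fun_prop] theorem entry₂ {M : α → List (List ℕ)} {i j : α → ℕ} (hM : PT M) (hi : PT i)
    (hj : PT j) : PT fun a => entry₂ (M a) (i a) (j a) := by
  unfold _root_.entry₂; fun_prop

@[fun_prop] theorem entry₄ {T : α → List (List (List (List ℕ)))} {i j k l : α → ℕ} (hT : PT T)
    (hi : PT i) (hj : PT j) (hk : PT k) (hl : PT l) :
    PT fun a => entry₄ (T a) (i a) (j a) (k a) (l a) := by
  unfold _root_.entry₄; fun_prop

@[fun_prop] theorem table₂ {n : α → ℕ} {f : α → ℕ → ℕ → ℕ} (hn : PT n)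
    (hf : PT fun x : (α × ℕ) × ℕ => f x.1.1 x.1.2 x.2) : PT fun a => table₂ (n a) (f a) :=
  map_range hn (map_range (f := fun (x : α × ℕ) j => f x.1 x.2 j) (by fun_prop) hf)

@[fun_prop] theorem birdMod {p n : α → ℕ} {M X : α → List (List ℕ)} (hp : PT p) (hn : PT n)
    (hM : PT M) (hX : PT X) : PT fun a => birdMod (p a) (n a) (M a) (X a) := by
  unfold _root_.birdMod; fun_prop

theorem mu_map_range_le {β : Type} [Enc β] {n S : ℕ} {f : ℕ → β} (h : ∀ i, mu (f i) ≤ S) :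
    mu ((List.range n).map f) ≤ n * (S + 1) :=
  (mu_map_le _ _ S fun i _ => h i).trans (by rw [List.length_range])

/-- Reduction modulo the prime keeps the computed numbers small whatever the previous state was;
this supplies the size bounds for `iterate` and `foldn_of_bounded`. -/
theorem mod_succ_le (a p : ℕ) : a % (p + 1) ≤ p := Nat.lt_succ_iff.1 (Nat.mod_lt _ p.succ_pos)

@[fun_prop] theorem detMod {p n : α → ℕ} {M : α → List (List ℕ)} (hp : PT p) (hn : PT n)
    (hM : PT M) : PT fun a => detMod (p a) (n a) (M a) := by
  have key : PT fun a => (_root_.birdMod (p a) (n a) (M a))^[n a - 1] (M a) := by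
    refine iterate (F := fun a => _root_.birdMod (p a) (n a) (M a))
      (B := fun a => n a * (n a * (p a + 1) + 1)) (by fun_prop) hM (by fun_prop) ?_ ?_
    · exact PT.polyBdd (f := fun a => n a * (n a * (p a + 1) + 1)) (by fun_prop)
    · intro a X
      exact mu_map_range_le fun i => mu_map_range_le fun j => mod_succ_le _ _
  unfold _root_.detMod
  fun_prop

@[fun_prop] theorem matH {e : α → Env} (he : PT e) : PT fun a => (e a).matH := by
  unfold Env.matH; fun_prop

@[fun_prop] theorem matG {e : α → Env} (he : PT e) : PT fun a => (e a).matG := by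
  unfold Env.matG; fun_prop

@[fun_prop] theorem sets {e : α → Env} (he : PT e) : PT fun a => (e a).sets := by
  unfold Env.sets; fun_prop

@[fun_prop] theorem env_pred {e : α → Env} (he : PT e) : PT fun a => (e a).pred := by
  unfold Env.pred; fun_prop

@[fun_prop] theorem width {e : α → Env} (he : PT e) : PT fun a => (e a).width := by
  unfold Env.width; fun_prop

@[fun_prop] theorem bits {e : α → Env} (he : PT e) : PT fun a => (e a).bits := by
  unfold Env.bits; fun_prop

@[fun_prop] theorem env_h {e : α → Env} (he : PT e) : PT fun a => (e a).h := by
  unfold Env.h; fun_prop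

@[fun_prop] theorem env_g {e : α → Env} (he : PT e) : PT fun a => (e a).g := by
  unfold Env.g; fun_prop

@[fun_prop] theorem point {e : α → Env} {x w : α → ℕ} (he : PT e) (hx : PT x) (hw : PT w) :
    PT fun a => (e a).point (x a) (w a) := by
  unfold Env.point
  refine foldn_of_bounded (F := fun a i s => (s + s + if (e a).bits.getD
    ((x a * (e a).g + w a) * (e a).width + i) Bool.false then 1 else 0) % ((e a).pred + 1))
    (B := fun a => (e a).pred) (by fun_prop) (by fun_prop) (by fun_prop)
    (PT.polyBdd (f := fun a => (e a).pred) (by fun_prop)) (fun a => Nat.zero_le _)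
    fun a i s _ => mod_succ_le _ _

@[fun_prop] theorem rootPoint {e : α → Env} {t x w : α → ℕ} (he : PT e) (ht : PT t) (hx : PT x)
    (hw : PT w) : PT fun a => (e a).rootPoint (t a) (x a) (w a) := by
  unfold Env.rootPoint; fun_prop

@[fun_prop] theorem freeValue {e : α → Env} {t v w : α → ℕ} {T : α → List (List (List (List ℕ)))}
    (he : PT e) (ht : PT t) (hT : PT T) (hv : PT v) (hw : PT w) :
    PT fun a => (e a).freeValue (t a) (T a) (v a) (w a) := by
  unfold Env.freeValue; fun_prop

@[fun_prop] theorem matchEntry {e : α → Env} {t a x v w i j : α → ℕ}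
    {T : α → List (List (List (List ℕ)))} (he : PT e) (ht : PT t) (hT : PT T) (ha : PT a)
    (hx : PT x) (hv : PT v) (hw : PT w) (hi : PT i) (hj : PT j) :
    PT fun b => (e b).matchEntry (t b) (T b) (a b) (x b) (v b) (w b) (i b) (j b) := by
  unfold Env.matchEntry; fun_prop

@[fun_prop] theorem tableStep {e : α → Env} {t : α → ℕ} {T : α → List (List (List (List ℕ)))}
    (he : PT e) (ht : PT t) (hT : PT T) : PT fun a => (e a).tableStep (t a) (T a) := by
  unfold Env.tableStep; fun_prop

@[fun_prop] theorem valueTable {e : α → Env} {t : α → ℕ} (he : PT e) (ht : PT t) :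
    PT fun a => (e a).valueTable (t a) := by
  unfold Env.valueTable
  refine iterate (F := fun a => (e a).tableStep (t a)) (B := fun a => ((e a).h + 1) *
    (((e a).h + 1) * ((e a).g * ((e a).g * ((e a).pred + 1) + 1) + 1) + 1)) (by fun_prop)
    (by fun_prop) (by fun_prop) ?_ ?_
  · exact PT.polyBdd (f := fun a => ((e a).h + 1) *
      (((e a).h + 1) * ((e a).g * ((e a).g * ((e a).pred + 1) + 1) + 1) + 1)) (by fun_prop)
  · intro a T
    exact mu_map_range_le fun _ => mu_map_range_le fun _ => mu_map_range_le fun _ =>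
      mu_map_range_le fun _ => mod_succ_le _ _

@[fun_prop] theorem total {e : α → Env} {t : α → ℕ} (he : PT e) (ht : PT t) :
    PT fun a => (e a).total (t a) := by
  unfold Env.total
  refine foldn_of_bounded (F := fun a w s => if IsRep (e a).matG w then
      s * (e a).freeValue (t a) ((e a).valueTable (t a)) w w % ((e a).pred + 1) else s)
    (B := fun a => (e a).pred + 1) (by fun_prop) (by fun_prop) (by fun_prop)
    (PT.polyBdd (f := fun a => (e a).pred + 1) (by fun_prop))
    (fun a => Nat.le_add_left _ _) fun a i s hs => ?_
  split_ifs
  · exact (mod_succ_le _ _).trans (Nat.le_succ _)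
  · exact hs

@[fun_prop] theorem sign {e : α → Env} {t : α → ℕ} (he : PT e) (ht : PT t) :
    PT fun a => (e a).sign (t a) := by
  unfold Env.sign
  refine foldn_of_bounded (F := fun a j s => if (t a).testBit j then s else
      s * (e a).pred % ((e a).pred + 1))
    (B := fun a => (e a).pred + 1) (by fun_prop) (by fun_prop) (by fun_prop)
    (PT.polyBdd (f := fun a => (e a).pred + 1) (by fun_prop))
    (fun a => Nat.le_add_left _ _) fun a i s hs => ?_
  split_ifs
  · exact hs
  · exact (mod_succ_le _ _).trans (Nat.le_succ _)

-- The number of summands `e.sets` is part of the data in unary, so an exponential number of sets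
-- still counts as polynomial in the parameter.
@[fun_prop] theorem result {e : α → Env} (he : PT e) : PT fun a => (e a).result := by
  unfold Env.result; fun_prop

end PT

/-! ### Parameters and coin tosses -/

/-- A number `b` with `D ≤ 2 ^ b`, together with `2 ^ b`. -/
def widthPow (D : ℕ) : ℕ × ℕ :=
  foldn D (fun _ s => if s.2 < D then (s.1 + 1, s.2 + s.2) else s) (0, 1)

/-- The invariant of the doubling loop. The last clause keeps the power of two linear in `D`, which
matters because numbers are written in unary. -/
theorem foldn_widthPow (D i : ℕ) :
    let s := foldn i (fun _ s => if s.2 < D then (s.1 + 1, s.2 + s.2) else s) ((0, 1) : ℕ × ℕ)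
    s.2 = 2 ^ s.1 ∧ s.1 ≤ i ∧ (D ≤ s.2 ∨ s.1 = i) ∧ s.2 ≤ 2 * D + 1 := by
  induction i with
  | zero => simp [foldn]
  | succ i ih =>
    simp only [foldn] at ih ⊢
    generalize foldn i (fun _ s => if s.2 < D then (s.1 + 1, s.2 + s.2) else s)
      ((0, 1) : ℕ × ℕ) = s at ih ⊢
    obtain ⟨h1, h2, h3, h4⟩ := ih
    split_ifs with h
    · refine ⟨by simp only [pow_succ]; omega, by simp only; omega, Or.inr ?_, by simp only; omega⟩
      rcases h3 with h3 | h3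
      · omega
      · simp [h3]
    · exact ⟨h1, by omega, Or.inl (by omega), h4⟩

theorem widthPow_snd (D : ℕ) : (widthPow D).2 = 2 ^ (widthPow D).1 := (foldn_widthPow D D).1

theorem le_widthPow (D : ℕ) : D ≤ (widthPow D).2 := by
  obtain ⟨h1, h2, h3, h4⟩ := foldn_widthPow D D
  rcases h3 with h3 | h3
  · exact h3
  · rw [widthPow_snd, show (widthPow D).1 = D from h3]
    exact Nat.lt_two_pow_self.le

/-- A primality test by trial division. -/
def primeTest (n : ℕ) : Prop :=
  2 ≤ n ∧ ∑ d ∈ Finset.range n, (if 2 ≤ d ∧ n % d = 0 then 1 else 0) = 0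

instance : DecidablePred primeTest := fun _ => inferInstanceAs (Decidable (_ ∧ _))

theorem primeTest_iff (n : ℕ) : primeTest n ↔ n.Prime := by
  rw [primeTest, Nat.prime_def_lt']
  refine and_congr_right fun hn => ?_
  rw [Finset.sum_eq_zero_iff]
  refine ⟨fun h d hd hdn hdvd => ?_, fun h d hd => if_neg fun hd' => ?_⟩
  · have := h d (Finset.mem_range.2 hdn)
    rw [if_pos ⟨hd, Nat.mod_eq_zero_of_dvd hdvd⟩] at this
    omega
  · exact h d hd'.1 (Finset.mem_range.1 hd) (Nat.dvd_of_mod_eq_zero hd'.2)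

/-- The predecessor of a prime number between `Q` and `2 * Q`. -/
def primePred (Q : ℕ) : ℕ :=
  foldn (2 * Q) (fun i s => if Q ≤ i ∧ primeTest (i + 1) then i else s) 0

/-- Bertrand's postulate provides a prime `p` with `Q < p ≤ 2 * Q`; the scan keeps the last
candidate found, and from `p` on there is one. -/
theorem primePred_spec {Q : ℕ} (hQ : Q ≠ 0) : Q ≤ primePred Q ∧ (primePred Q + 1).Prime := by
  obtain ⟨p, hp, h1, h2⟩ := Nat.exists_prime_lt_and_le_two_mul Q hQ
  have key : ∀ n, p ≤ n → let s := foldn n (fun i s => if Q ≤ i ∧ primeTest (i + 1) then i else s) 0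
      Q ≤ s ∧ (s + 1).Prime := by
    intro n hn
    induction n, hn using Nat.le_induction with
    | base =>
      obtain ⟨q, rfl⟩ : ∃ q, p = q + 1 := ⟨p - 1, by have := hp.pos; omega⟩
      rw [foldn, if_pos ⟨by omega, (primeTest_iff _).2 hp⟩]
      exact ⟨by omega, hp⟩
    | succ n hn ih =>
      rw [foldn]
      split_ifs with h
      · exact ⟨h.1, (primeTest_iff _).1 h.2⟩
      · exact ih
  exact key _ h2

/-- The input: two adjacency matrices. -/
structure Inp where
  /-- The adjacency matrix of the pattern. -/
  matH : BoolMat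
  /-- The adjacency matrix of the host. -/
  matG : BoolMat

/-- Including `2 ^ k`, with `k` the number of components of the pattern, in the parameter turns a
polynomial bound in `mu` into a bound polynomial in `2 ^ k` and the sizes of the matrices. -/
instance : Enc Inp := ⟨fun i => Data.cons (enc i.matH) (enc i.matG),
  fun i => 2 ^ countReps i.matH i.matH.length + (mu i.matH + mu i.matG)⟩

namespace Inp

/-- A strict upper bound for twice the degree of the polynomial that is tested. -/
def degBound (i : Inp) : ℕ := 2 * ((i.matG.length + (i.matH.length + 1) + 1) * i.matG.length) + 1

/-- The number of sets of components of the pattern. -/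
def sets (i : Inp) : ℕ := foldn (countReps i.matH i.matH.length) (fun _ s => s + s) 1

/-- The parameters of the computation and the number of coins needed. -/
def params (i : Inp) : (BoolMat × BoolMat × ℕ × ℕ × ℕ) × ℕ :=
  ((i.matH, i.matG, i.sets, primePred (widthPow i.degBound).2, (widthPow i.degBound).1),
    (i.matH.length + 1) * i.matG.length * (widthPow i.degBound).1)

end Inp

theorem foldn_double (n : ℕ) : foldn n (fun _ s => s + s) 1 = 2 ^ n := by
  induction n with
  | zero => rfl
  | succ n ih => rw [foldn, ih, pow_succ]; omega

namespace PT

variable {α β : Type} [Enc α] [Enc β]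

@[fun_prop] theorem widthPow {D : α → ℕ} (hD : PT D) : PT fun a => widthPow (D a) := by
  unfold _root_.widthPow
  refine foldn (F := fun a _ s => if s.2 < D a then (s.1 + 1, s.2 + s.2) else s)
    (B := fun a => D a + (2 * D a + 1)) hD (by fun_prop) (by fun_prop)
    (PT.polyBdd (f := fun a => D a + (2 * D a + 1)) (by fun_prop)) fun a i hi => ?_
  obtain ⟨h1, h2, h3, h4⟩ := foldn_widthPow (D a) i
  exact Nat.add_le_add (h2.trans hi) h4

@[fun_prop] theorem decide_primeTest {n : α → ℕ} (hn : PT n) :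
    PT fun a => decide (primeTest (n a)) := by
  have : PT fun a => decide (2 ≤ n a ∧
      ∑ d ∈ Finset.range (n a), (if 2 ≤ d ∧ n a % d = 0 then 1 else 0) = 0) := by fun_prop
  exact this.of_eq fun a => by rw [decide_eq_decide]; rfl

@[fun_prop] theorem primePred {Q : α → ℕ} (hQ : PT Q) : PT fun a => primePred (Q a) := by
  unfold _root_.primePred
  refine foldn (F := fun a i s => if Q a ≤ i ∧ primeTest (i + 1) then i else s)
    (B := fun a => 2 * Q a) (by fun_prop) (by fun_prop) (by fun_prop)
    (PT.polyBdd (f := fun a => 2 * Q a) (by fun_prop)) fun a i hi => ?_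
  have : ∀ i, _root_.foldn i (fun i s => if Q a ≤ i ∧ primeTest (i + 1) then i else s) 0 ≤ i := by
    intro i
    induction i with
    | zero => exact le_rfl
    | succ i ih =>
      rw [_root_.foldn]
      split_ifs <;> omega
  exact (this i).trans hi

@[fun_prop] theorem inp_matH {f : α → Inp} (hf : PT f) : PT fun a => (f a).matH :=
  PT.comp (g := Inp.matH) ⟨Prog.fst, fun _ => 1, .const 1, PolyBdd.mu.mono fun i => by
    exact le_add_left (Nat.le_add_right _ _), fun _ => ⟨1, le_rfl, fun _ => Eval.fst _ _⟩⟩ hf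

@[fun_prop] theorem inp_matG {f : α → Inp} (hf : PT f) : PT fun a => (f a).matG :=
  PT.comp (g := Inp.matG) ⟨Prog.snd, fun _ => 1, .const 1, PolyBdd.mu.mono fun i => by
    exact le_add_left (Nat.le_add_left _ _), fun _ => ⟨1, le_rfl, fun _ => Eval.snd _ _⟩⟩ hf

@[fun_prop] theorem inp_sets {f : α → Inp} (hf : PT f) : PT fun a => (f a).sets := by
  refine PT.comp (g := Inp.sets) ?_ hf
  refine foldn (F := fun _ _ s => s + s) (by fun_prop) (by fun_prop) (by fun_prop)
    (PolyBdd.mu (α := Inp)) fun a i hi => ?_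
  rw [foldn_double]
  exact (Nat.pow_le_pow_right (by norm_num) hi).trans (Nat.le_add_right _ _)

theorem params : PT Inp.params := by
  unfold Inp.params Inp.degBound
  fun_prop

/-- A polynomial time computation, followed by tossing the number of coins it asks for and by a
second polynomial time computation. -/
theorem exists_randomized {f : α → β × ℕ} {B : β × List Bool → Bool} (hf : PT f) (hB : PT B) :
    ∃ (p : Prog) (T : α → ℕ), PolyBdd T ∧ (∀ a, (f a).2 ≤ T a) ∧
      ∀ a (r : List Bool), (f a).2 ≤ r.length → ∃ t ≤ T a, Eval p (enc a) r
        (Data.ofBool (B ((f a).1, (r.take (f a).2).reverse))) (r.drop (f a).2) t := by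
  obtain ⟨pf, Tf, hTf, hmf, kf⟩ := hf
  obtain ⟨pB, TB, hTB, hmB, kB⟩ := hB
  have hL : PolyBdd fun a => (f a).2 := hmf.mono fun a => Nat.le_add_left _ _
  obtain ⟨S, hS, hTS⟩ := hTB.exists_mono (hmf.add hL)
  -- The loop state is `(b, m, s)`: the parameters, the number of coins still to toss and the
  -- outcomes so far. New outcomes are put in front, so the final list is reversed.
  let body : Prog := Prog.pair Prog.fst (Prog.pair (Prog.seq Prog.snd (Prog.seq Prog.fst Prog.snd))
    (Prog.pair Prog.flip (Prog.seq Prog.snd Prog.snd)))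
  let test : Prog := Prog.seq Prog.snd Prog.fst
  have loop : ∀ (b : β) (m : ℕ) (s r : List Bool), m ≤ r.length →
      Eval (Prog.loop test body) (enc (b, m, s)) r (enc (b, 0, (r.take m).reverse ++ s))
        (r.drop m) (m * 17 + 4) := by
    intro b m
    induction m with
    | zero => intro s r _; exact Eval.loop_done (Eval.seq (Eval.snd _ _) (Eval.fst _ _))
    | succ m ih =>
      intro s r hr
      cases r with
      | nil => simp at hr
      | cons c r =>
        have h := ih (c :: s) r (by simpa using hr)
        have e : (m + 1) * 17 + 4 = (1 + 1 + 1) + (1 + ((1 + (1 + 1 + 1) + 1) +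
            (1 + (1 + 1 + 1) + 1) + 1) + 1) + (m * 17 + 4) + 1 := by omega
        have e' : ((c :: r).take (m + 1)).reverse ++ s = (r.take m).reverse ++ c :: s := by simp
        rw [e, e', List.drop_succ_cons]
        refine Eval.loop_step (v := enc (m + 1)) (r₁ := c :: r) (r₂ := r)
          (Eval.seq (Eval.snd _ _) (Eval.fst _ _)) (by simp) ?_ h
        refine Eval.pair (t₁ := 1) (t₂ := (1 + (1 + 1 + 1) + 1) + (1 + (1 + 1 + 1) + 1) + 1)
          (Eval.fst _ _) (Eval.pair (t₁ := 1 + (1 + 1 + 1) + 1) (t₂ := 1 + (1 + 1 + 1) + 1)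
          (Eval.seq (t₁ := 1) (t₂ := 1 + 1 + 1) (Eval.snd _ _)
            (Eval.seq (Eval.fst _ _) (Eval.snd _ _))) ?_)
        exact Eval.pair (t₁ := 1) (t₂ := 1 + 1 + 1) (Eval.flip _ _ _)
          (Eval.seq (Eval.snd _ _) (Eval.snd _ _))
  refine ⟨Prog.seq (Prog.seq (Prog.seq pf (Prog.pair Prog.fst (Prog.pair Prog.snd Prog.nil)))
      (Prog.seq (Prog.loop test body) (Prog.pair Prog.fst (Prog.seq Prog.snd Prog.snd)))) pB,
    fun a => Tf a + (f a).2 * 17 + S a + 30,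
    ((hTf.add (hL.mul (.const 17))).add hS).add (.const 30),
    fun a => by dsimp only; omega, fun a r hr => ?_⟩
  obtain ⟨t, ht, h⟩ := kf a
  obtain ⟨u, hu, k⟩ := kB ((f a).1, (r.take (f a).2).reverse)
  have hmu : ∀ l : List Bool, mu l = l.length := by
    intro l
    induction l with
    | nil => rfl
    | cons c l ih => simp [ih]; omega
  have hu' : u ≤ S a := hu.trans (hTS a _ (by
    rw [mu_prod, hmu]
    have : mu (f a) = mu (f a).1 + (f a).2 := rfl
    simp only [List.length_reverse, List.length_take]
    omega))
  refine ⟨((t + (1 + (1 + 1 + 1) + 1) + 1) + (((f a).2 * 17 + 4) + (1 + (1 + 1 + 1) + 1) + 1) + 1)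
    + u + 1, by dsimp only; omega, ?_⟩
  have hl := loop (f a).1 (f a).2 [] r hr
  rw [List.append_nil] at hl
  refine Eval.seq (Eval.seq (Eval.seq (h r) ?_) (Eval.seq (t₁ := (f a).2 * 17 + 4)
    (t₂ := 1 + (1 + 1 + 1) + 1) hl ?_)) (k _)
  · exact Eval.pair (t₁ := 1) (t₂ := 1 + 1 + 1) (Eval.fst _ _)
      (Eval.pair (Eval.snd _ _) (Eval.nil _ _))
  · exact Eval.pair (t₁ := 1) (t₂ := 1 + 1 + 1) (Eval.fst _ _)
      (Eval.seq (Eval.snd _ _) (Eval.snd _ _))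

end PT

/-! ### Branches of a graph -/

section Branch

open Relation

variable {V : Type*} {G : SimpleGraph V}

/-- The vertex `y` can be reached from `x` by a walk that does not step on `a`. -/
def Branch (G : SimpleGraph V) (a x y : V) : Prop :=
  ReflTransGen (fun u v => G.Adj u v ∧ v ≠ a) x y

/-- No neighbour of `x` can be reached from another one without passing through `x`. -/
def NoReturn (G : SimpleGraph V) (x : V) : Prop :=
  ∀ y z, G.Adj x y → G.Adj x z → y ≠ z → ¬ Branch G x y z

theorem Branch.refl (a x : V) : Branch G a x x := ReflTransGen.refl

theorem Branch.ne {a x y : V} (h : Branch G a x y) (hx : x ≠ a) : y ≠ a := by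
  cases h with
  | refl => exact hx
  | tail _ h => exact h.2

theorem Branch.step {a x y z : V} (h : Branch G a x y) (hyz : G.Adj y z) (hz : z ≠ a) :
    Branch G a x z := ReflTransGen.tail h ⟨hyz, hz⟩

theorem Branch.symm {a x y : V} (h : Branch G a x y) (hx : x ≠ a) : Branch G a y x := by
  induction h with
  | refl => exact Branch.refl _ _
  | tail h k ih => exact ReflTransGen.head ⟨k.1.symm, Branch.ne h hx⟩ ih

/-- Cut the walk at its last visit to `x`; the next vertex, if there is one, is `z`. -/
theorem Branch.eq_or {a x y : V} (h : Branch G a x y) :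
    y = x ∨ ∃ z, G.Adj x z ∧ z ≠ a ∧ Branch G x z y := by
  induction h with
  | refl => exact Or.inl rfl
  | @tail y z _ k ih =>
    rcases eq_or_ne z x with hz | hz
    · exact Or.inl hz
    rcases ih with rfl | ⟨u, h1, h2, h3⟩
    · exact Or.inr ⟨z, k.1, k.2, Branch.refl _ _⟩
    · exact Or.inr ⟨u, h1, h2, h3.step k.1 hz⟩

/-- A walk from `y` that avoids `x` cannot meet `a`, because `a` is `x` itself or a neighbour of `x`
other than `y`. -/
theorem Branch.of_succ {a x y z : V} (hx : NoReturn G x) (ha : a = x ∨ G.Adj x a)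
    (hy : G.Adj x y) (hya : y ≠ a) (h : Branch G x y z) : Branch G a x z := by
  induction h with
  | refl => exact (Branch.refl a x).step hy hya
  | @tail u z h k ih =>
    refine ih.step k.1 fun hz => ?_
    subst hz
    rcases ha with rfl | ha
    · exact k.2 rfl
    · exact hx y z hy ha hya (ReflTransGen.tail h k)

theorem NoReturn.unique {x y y' z : V} (hx : NoReturn G x) (hy : G.Adj x y) (hy' : G.Adj x y')
    (h : Branch G x y z) (h' : Branch G x y' z) : y = y' := by
  by_contra hne
  exact hx y y' hy hy' hne (ReflTransGen.trans h (h'.symm hy'.ne'))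

/-- The convention for roots: behind the degenerate arc from `x` to `x` lies the whole component,
since a walk from `x` may be cut at its last visit to `x`. -/
theorem branch_self_iff {x y : V} : Branch G x x y ↔ G.Reachable x y := by
  rw [SimpleGraph.reachable_iff_reflTransGen]
  constructor
  · intro h
    induction h with
    | refl => exact .refl
    | tail _ k ih => exact ih.tail k.1
  · intro h
    induction h with
    | refl => exact Branch.refl _ _
    | @tail y z _ k ih =>
      rcases eq_or_ne z x with rfl | hz
      · exact Branch.refl _ _
      · exact ih.step k hz

/-- Each edge of a forest is a bridge. A walk from `y` to `z` that avoids `x`, followed by the edge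
to `x`, would bypass the edge from `x` to `y`. -/
theorem SimpleGraph.IsAcyclic.noReturn (hG : G.IsAcyclic) (x : V) : NoReturn G x := by
  intro y z hy hz hne h
  have hb := (SimpleGraph.isAcyclic_iff_forall_adj_isBridge.1 hG) hy
  rw [SimpleGraph.isBridge_iff] at hb
  refine hb ?_
  have key : ∀ z, Branch G x y z → (G.deleteEdges {s(x, y)}).Reachable z y := by
    intro z h
    induction h with
    | refl => exact SimpleGraph.Reachable.refl _
    | @tail u w h k ih =>
      refine SimpleGraph.Reachable.trans (SimpleGraph.Adj.reachable ?_) ih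
      rw [SimpleGraph.deleteEdges_adj]
      refine ⟨k.1.symm, fun he => ?_⟩
      have hu : u ≠ x := Branch.ne h hy.ne'
      have hw := k.2
      rw [Set.mem_singleton_iff, Sym2.eq_iff] at he
      rcases he with ⟨h1, _⟩ | ⟨_, h2⟩
      · exact hw h1
      · exact hu h2
  refine SimpleGraph.Reachable.trans (SimpleGraph.Adj.reachable ?_) (key z h)
  rw [SimpleGraph.deleteEdges_adj]
  refine ⟨hz, fun he => ?_⟩
  rw [Set.mem_singleton_iff, Sym2.eq_iff] at he
  rcases he with ⟨_, h1⟩ | ⟨h1, h2⟩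
  · exact hne h1.symm
  · exact hz.ne' h2

/-! ### Finite unfoldings and the absence of cycles. -/

/-- The tree of all walks that continue the arc from `a` to `x` and do not turn back has height
less than `d`. -/
def FinUnfold (G : SimpleGraph V) : ℕ → V → V → Prop
  | 0, _, _ => False
  | d + 1, a, x => ∀ y, G.Adj x y → y ≠ a → FinUnfold G d x y

/-- Some walk with `n` steps that starts with the arc from `x` to `y`, does not turn back and does
not come back to `x` ends with the arc from `b` to `c`. -/
inductive NonBacktracking (G : SimpleGraph V) (x y : V) : ℕ → V → V → Prop
  | base : NonBacktracking G x y 0 x y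
  | step {n : ℕ} {b c z : V} : NonBacktracking G x y n b c → G.Adj c z → z ≠ b → z ≠ x →
      NonBacktracking G x y (n + 1) c z

/-- Every step of a walk that does not turn back uses up one unit of height. -/
theorem NonBacktracking.finUnfold {x y b c : V} {n d : ℕ} (h : NonBacktracking G x y n b c)
    (hd : FinUnfold G d x y) : ∃ d', d' + n = d ∧ FinUnfold G d' b c := by
  induction h with
  | base => exact ⟨d, rfl, hd⟩
  | step _ h1 h2 _ ih =>
    obtain ⟨d', hd', k⟩ := ih
    cases d' with
    | zero => exact k.elim
    | succ d' => exact ⟨d', by omega, k _ h1 h2⟩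

theorem NonBacktracking.snd_ne {x y b c : V} {n : ℕ} (h : NonBacktracking G x y n b c)
    (hy : y ≠ x) : c ≠ x := by
  cases h <;> assumption

/-- Instead of appending a step that turns back, remove the previous one. -/
theorem Branch.exists_nonBacktracking {x y z : V} (h : Branch G x y z) :
    ∃ n b, NonBacktracking G x y n b z := by
  induction h with
  | refl => exact ⟨0, x, .base⟩
  | @tail u z _ k ih =>
    obtain ⟨n, b, h⟩ := ih
    rcases eq_or_ne z b with rfl | hz
    · cases h with
      | base => exact absurd rfl k.2
      | step h _ _ _ => exact ⟨_, _, h⟩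
    · exact ⟨n + 1, u, h.step k.1 hz k.2⟩

/-- Such a walk closes up to a cycle through `x`: leave by `y`, come back by `z`, leave by `y`
again. Going round uses up height and never turns back, so no finite height suffices. This excludes
patterns with cycles. -/
theorem FinUnfold.not_branch {x y z : V} {d : ℕ} (hd : FinUnfold G d x y) (hy : G.Adj x y)
    (hz : G.Adj x z) (hne : y ≠ z) : ¬ Branch G x y z := by
  intro hb
  obtain ⟨n, b, h⟩ := hb.exists_nonBacktracking
  have hbx : b ≠ x := by
    cases h with
    | base => exact absurd rfl hne
    | step h _ _ _ => exact h.snd_ne hy.ne'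
  induction d using Nat.strong_induction_on with
  | _ d ih =>
    obtain ⟨d', hd', k⟩ := h.finUnfold hd
    cases d' with
    | zero => exact k
    | succ d' =>
      have k2 := k x hz.symm hbx.symm
      cases d' with
      | zero => exact k2
      | succ d' => exact ih d' (by omega) (k2 y hy hne)

end Branch

/-! ### The polynomial -/

section Values

open Matrix

variable {V W R : Type*} [Fintype V] [Fintype W] {G : SimpleGraph V} {H : SimpleGraph W}

open Classical in
/-- The matrix whose determinant is the value of the arc from `a` to `x` at the arc from `v` to
`w`.  A perfect matching of its rows and columns assigns to the further neighbours of `x` distinct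
further neighbours of `w`. -/
noncomputable def matchMatrix [Zero R] [One R] [Mul R] (G : SimpleGraph V) (H : SimpleGraph W)
    (z : W → V → R) (P : W → W → V → V → R) (Z : V → V → R) (a x : W) (v w : V) :
    Matrix (V ⊕ W) (V ⊕ W) R :=
  Matrix.of fun i j => match i, j with
    -- A nonzero term may leave row `i` on the diagonal, which earns the free value if `i` is a
    -- further neighbour of `w`. The column of a further neighbour `y` of `x` has diagonal entry
    -- zero and must take a row `i` of the host. The factors `z` permit a substitution that isolates
    -- one matching.
    | .inl i, .inl j => if i = j then (if G.Adj w i ∧ i ≠ v then Z w i else 1) else 0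
    | .inl i, .inr y =>
      if (G.Adj w i ∧ i ≠ v) ∧ (H.Adj x y ∧ y ≠ a) then z y i * P x y w i else 0
    | .inr y, .inl j => if (G.Adj w j ∧ j ≠ v) ∧ (H.Adj x y ∧ y ≠ a) then z y j else 0
    | .inr y, .inr y' => if y = y' then (if H.Adj x y ∧ y ≠ a then 0 else 1) else 0

open Classical in
/-- The value of the arc from `a` to `x` at the arc from `v` to `w`, up to depth `d`. -/
noncomputable def arcValue [CommRing R] (G : SimpleGraph V) (H : SimpleGraph W)
    (z y : W → V → R) : ℕ → W → W → V → V → R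
  -- The value zero at depth zero discards arcs of the pattern whose unfolding is infinite.
  | 0 => fun _ _ _ _ => 0
  | d + 1 => fun a x v w =>
    (matchMatrix G H z (arcValue G H z y d)
      (fun v w => ∑ x, y x w * arcValue G H z y d x x v w) a x v w).det

/-- The value of the arc from `v` to `w` without an obligation. -/
noncomputable def branchValue [CommRing R] (G : SimpleGraph V) (H : SimpleGraph W)
    (z y : W → V → R) (d : ℕ) (v w : V) : R :=
  ∑ x, y x w * arcValue G H z y d x x v w

open Classical in
theorem arcValue_succ [CommRing R] (z y : W → V → R) (d : ℕ) (a x : W) (v w : V) :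
    arcValue G H z y (d + 1) a x v w = (matchMatrix G H z (arcValue G H z y d)
      (branchValue G H z y d) a x v w).det := rfl

/-- Values are polynomial expressions in `z` and `y`. The lemma serves to evaluate polynomials at
points and functions on sets of components at a single set. -/
theorem map_arcValue {S : Type*} [CommRing R] [CommRing S] (φ : R →+* S) (z y : W → V → R)
    (d : ℕ) (a x : W) (v w : V) : φ (arcValue G H z y d a x v w)
      = arcValue G H (fun x w => φ (z x w)) (fun x w => φ (y x w)) d a x v w := by
  classical
  induction d generalizing a x v w with
  | zero => exact map_zero φ
  | succ d ih =>
    rw [arcValue_succ, arcValue_succ, RingHom.map_det]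
    congr 1
    ext i j
    rcases i with i | i <;> rcases j with j | j <;>
      simp only [RingHom.mapMatrix_apply, Matrix.map_apply, matchMatrix, Matrix.of_apply] <;>
      split_ifs <;> simp [ih, branchValue]

theorem map_branchValue {S : Type*} [CommRing R] [CommRing S] (φ : R →+* S) (z y : W → V → R)
    (d : ℕ) (v w : V) : φ (branchValue G H z y d v w)
      = branchValue G H (fun x w => φ (z x w)) (fun x w => φ (y x w)) d v w := by
  simp [branchValue, map_arcValue]

end Values

/-! ### The degree of the polynomial -/

section Degree

open MvPolynomial

variable {V W σ K : Type*} [Fintype V] [Fintype W] {G : SimpleGraph V} {H : SimpleGraph W}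
  [CommRing K]

/-- Each term of the determinant contains one entry of every row. -/
theorem totalDegree_det_le {n : Type*} [Fintype n] [DecidableEq n]
    (M : Matrix n n (MvPolynomial σ K)) (b : n → ℕ) (h : ∀ i j, (M i j).totalDegree ≤ b i) :
    M.det.totalDegree ≤ ∑ i, b i := by
  rw [Matrix.det_apply]
  refine totalDegree_finsetSum_le fun τ _ => ?_
  have h1 : (∏ i, M (τ i) i).totalDegree ≤ ∑ i, b i := by
    refine (totalDegree_finsetProd _ _).trans ?_
    rw [← Equiv.sum_comp τ b]
    exact Finset.sum_le_sum fun i _ => h _ _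
  rcases Int.units_eq_one_or (Equiv.Perm.sign τ) with hs | hs
  · rw [hs, one_smul]; exact h1
  · rw [hs, Units.neg_smul, one_smul, totalDegree_neg]; exact h1

open Classical in
/-- The number of vertices of a branch. -/
noncomputable def branchCard (G : SimpleGraph V) (v w : V) : ℕ :=
  (Finset.univ.filter (Branch G v w)).card

-- The branches behind the further neighbours of `w` are disjoint, lie in the branch behind `w`, and
-- all miss `w`.
open Classical in
theorem sum_branchCard_lt (hG : ∀ x, NoReturn G x) {v w : V} (hv : v = w ∨ G.Adj w v) :
    ∑ i, (if G.Adj w i ∧ i ≠ v then branchCard G w i else 0) < branchCard G v w := by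
  rw [← Finset.sum_filter]
  unfold branchCard
  rw [← Finset.card_biUnion]
  · refine Finset.card_lt_card ⟨?_, fun h => ?_⟩
    · intro y hy
      simp only [Finset.mem_biUnion, Finset.mem_filter, Finset.mem_univ, true_and] at hy ⊢
      obtain ⟨i, hi, hy⟩ := hy
      exact hy.of_succ (hG w) hv hi.1 hi.2
    · have := h (Finset.mem_filter.2 ⟨Finset.mem_univ w, Branch.refl v w⟩)
      simp only [Finset.mem_biUnion, Finset.mem_filter, Finset.mem_univ, true_and] at this
      obtain ⟨i, hi, hy⟩ := this
      exact hy.ne hi.1.ne' rfl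
  · intro i hi j hj hij
    simp only [Finset.coe_filter, Finset.mem_univ, true_and, Set.mem_ofPred_eq] at hi hj
    rw [Function.onFun, Finset.disjoint_left]
    intro y h1 h2
    simp only [Finset.mem_filter, Finset.mem_univ, true_and] at h1 h2
    exact hij ((hG w).unique hi.1 hj.1 h1 h2)

theorem branchCard_lt (hG : ∀ x, NoReturn G x) {v w i : V} (hv : v = w ∨ G.Adj w v)
    (hi : G.Adj w i) (hiv : i ≠ v) : branchCard G w i < branchCard G v w := by
  classical
  refine lt_of_le_of_lt ?_ (sum_branchCard_lt hG hv)
  have := Finset.single_le_sum (f := fun i => if G.Adj w i ∧ i ≠ v then branchCard G w i else 0)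
    (fun _ _ => Nat.zero_le _) (Finset.mem_univ i)
  simpa [hi, hiv] using this

theorem totalDegree_branchValue_le_of {z y : W → V → MvPolynomial σ K} {d : ℕ} {v w : V} {D : ℕ}
    (hy : ∀ x w, (y x w).totalDegree ≤ 1)
    (h : ∀ x, (arcValue G H z y d x x v w).totalDegree ≤ D) :
    (branchValue G H z y d v w).totalDegree ≤ D + 1 := by
  refine totalDegree_finsetSum_le fun x _ => (totalDegree_mul _ _).trans ?_
  have := h x
  have := hy x w
  omega

/-- Each of the `c = |V| + |W|` rows adds at most one to the degrees inherited from the smaller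
branches. Those branches together have at least one vertex less, and this vertex pays for the
additional `c`. -/
theorem totalDegree_arcValue_le (hG : ∀ x, NoReturn G x) (z y : W → V → MvPolynomial σ K)
    (hz : ∀ x w, (z x w).totalDegree ≤ 1) (hy : ∀ x w, (y x w).totalDegree ≤ 1) (d : ℕ) (a x : W)
    {v w : V} (hv : v = w ∨ G.Adj w v) : (arcValue G H z y d a x v w).totalDegree
      ≤ (Fintype.card V + Fintype.card W) * branchCard G v w := by
  classical
  induction d generalizing a x v w with
  | zero =>
    rw [arcValue, totalDegree_zero]
    exact Nat.zero_le _
  | succ d ih =>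
    set c := Fintype.card V + Fintype.card W with hc
    let b : V ⊕ W → ℕ := Sum.elim
      (fun i => c * (if G.Adj w i ∧ i ≠ v then branchCard G w i else 0) + 1) (fun _ => 1)
    rw [arcValue_succ]
    refine (totalDegree_det_le _ b ?_).trans ?_
    · rintro (i | i) (j | j) <;> simp only [matchMatrix, Matrix.of_apply, b, Sum.elim_inl,
        Sum.elim_inr]
      · split_ifs with h1 h2
        · exact totalDegree_branchValue_le_of hy fun x => ih x x (Or.inr h2.1.symm)
        · simp
        · simp
        · simp
      · by_cases h2 : G.Adj w i ∧ i ≠ v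
        · by_cases h3 : H.Adj x j ∧ j ≠ a
          · rw [if_pos ⟨h2, h3⟩, if_pos h2]
            refine (totalDegree_mul _ _).trans ?_
            have h4 := ih x j (v := w) (w := i) (Or.inr h2.1.symm)
            have h5 := hz j i
            omega
          · rw [if_neg fun h => h3 h.2]; simp
        · rw [if_neg fun h => h2 h.1]; simp
      · split_ifs
        · exact hz _ _
        · simp
      · split_ifs <;> simp
    · rw [Fintype.sum_sum_type]
      simp only [b, Sum.elim_inl, Sum.elim_inr, Finset.sum_add_distrib, ← Finset.mul_sum,
        Finset.sum_const, Finset.card_univ, smul_eq_mul, mul_one]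
      have := sum_branchCard_lt hG hv
      calc _ = c * (∑ i, (if G.Adj w i ∧ i ≠ v then branchCard G w i else 0) + 1) := by
            rw [mul_add, mul_one, add_assoc]
        _ ≤ _ := Nat.mul_le_mul_left _ this

theorem totalDegree_branchValue_le (hG : ∀ x, NoReturn G x) (z y : W → V → MvPolynomial σ K)
    (hz : ∀ x w, (z x w).totalDegree ≤ 1) (hy : ∀ x w, (y x w).totalDegree ≤ 1) (d : ℕ)
    {v w : V} (hv : v = w ∨ G.Adj w v) : (branchValue G H z y d v w).totalDegree
      ≤ (Fintype.card V + Fintype.card W) * branchCard G v w + 1 :=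
  totalDegree_branchValue_le_of hy fun x => totalDegree_arcValue_le hG z y hz hy d x x hv

end Degree

/-! ### The polynomial does not vanish if the pattern is contained in the host -/

section Certificate

variable {V W K : Type*} {G : SimpleGraph V} {H : SimpleGraph W} [CommRing K]

/-- The data of an embedding `η` of the pattern without its isolated vertex `o`; every vertex `w` of
the host is labelled by its preimage `f w`, or by `o` if there is none. -/
structure Placement (G : SimpleGraph V) (H : SimpleGraph W) (o : W) (η : W → V) (f : V → W) :
    Prop where
  isolated : ∀ x, ¬ H.Adj o x
  eq_iff : ∀ w x, x ≠ o → (f w = x ↔ η x = w)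
  adj : ∀ x y, H.Adj x y → G.Adj (η x) (η y)

namespace Placement

variable {o : W} {η : W → V} {f : V → W} (hp : Placement G H o η f)
include hp

theorem ne_left {x y : W} (h : H.Adj x y) : x ≠ o := fun e => hp.isolated y (e ▸ h)

theorem ne_right {x y : W} (h : H.Adj x y) : y ≠ o := hp.ne_left h.symm

theorem f_η {x : W} (h : x ≠ o) : f (η x) = x := (hp.eq_iff _ _ h).2 rfl

theorem η_f {w : V} (h : f w ≠ o) : η (f w) = w := (hp.eq_iff _ _ h).1 rfl

end Placement

/-! ### Arcs of the pattern placed on arcs of the host. -/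

/-- The arc from `a` to `x` is placed on the arc from `v` to `w`. -/
def Fits (H : SimpleGraph W) (η : W → V) (f : V → W) (a x : W) (v w : V) : Prop :=
  f w = x ∧ ∀ y, H.Adj x y → (η y = v ↔ y = a)

theorem Fits.succ {o : W} {η : W → V} {f : V → W} (hp : Placement G H o η f) {a x y : W} {v w : V}
    (h : Fits H η f a x v w) (hy : H.Adj x y) : Fits H η f x y w (η y) := by
  refine ⟨hp.f_η (hp.ne_right hy), fun y' hy' => ?_⟩
  have hx : η x = w := (hp.eq_iff w x (hp.ne_left hy)).1 h.1
  refine ⟨fun e => ?_, fun e => e ▸ hx⟩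
  rw [← hp.f_η (hp.ne_right hy'), e, h.1]

theorem Fits.adj_η {o : W} {η : W → V} {f : V → W} (hp : Placement G H o η f) {a x y : W} {v w : V}
    (h : Fits H η f a x v w) (hy : H.Adj x y ∧ y ≠ a) : G.Adj w (η y) ∧ η y ≠ v := by
  have hx : η x = w := (hp.eq_iff w x (hp.ne_left hy.1)).1 h.1
  exact ⟨hx ▸ hp.adj _ _ hy.1, fun e => hy.2 ((h.2 y hy.1).1 e)⟩

/-- A neighbour of `f j` placed at `w` could only be `x`. Then `f j`, not being a further neighbour
of `x`, would equal `a`, which is placed at `v` and not at `j`. -/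
theorem Fits.root {o : W} {η : W → V} {f : V → W} (hp : Placement G H o η f) {a x : W} {v w j : V}
    (h : Fits H η f a x v w) (hj : j ≠ v) (hx : ¬ (H.Adj x (f j) ∧ f j ≠ a)) :
    Fits H η f (f j) (f j) w j := by
  refine ⟨rfl, fun y hy => ⟨fun e => ?_, fun e => absurd (e ▸ hy) H.irrefl⟩⟩
  have hxy : x = y := by rw [← h.1, ← e, hp.f_η (hp.ne_right hy)]
  subst hxy
  have ha : f j = a := by
    by_contra hne
    exact hx ⟨hy.symm, hne⟩
  have := (h.2 a (ha ▸ hy.symm)).2 rfl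
  rw [← ha, hp.η_f (hp.ne_left hy)] at this
  exact absurd this hj

theorem Placement.fits_root {o : W} {η : W → V} {f : V → W} (hp : Placement G H o η f) (w : V) :
    Fits H η f (f w) (f w) w w := by
  refine ⟨rfl, fun y hy => ⟨fun e => ?_, fun e => absurd (e ▸ hy) H.irrefl⟩⟩
  rw [← e, hp.f_η (hp.ne_right hy)] at hy
  exact absurd hy H.irrefl

open Classical in
/-- The point at which the polynomial is evaluated. -/
noncomputable def placePoint (f : V → W) (u : W → K) (x : W) (w : V) : K :=
  if f w = x then u x else 0

variable [Fintype V] [Fintype W]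

theorem branchValue_place (f : V → W) (u : W → K) (z : W → V → K) (d : ℕ) (v w : V) :
    branchValue G H z (placePoint f u) d v w
      = u (f w) * arcValue G H z (placePoint f u) d (f w) (f w) v w := by
  classical
  rw [branchValue, Finset.sum_eq_single (f w)]
  · rw [placePoint, if_pos rfl]
  · intro x _ hx
    rw [placePoint, if_neg hx.symm, zero_mul]
  · intro h
    exact absurd (Finset.mem_univ _) h

-- At this point `z y i` vanishes unless `y` is the label of `i`. So the column of a further
-- neighbour `y` of `x` has its only possible nonzero entry in the row `η y`, and all other columns
-- are then forced to the diagonal or to the row of their label. Only the involution exchanging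
-- these `y` with their images survives.
open Classical in
theorem det_matchMatrix_place {o : W} {η : W → V} {f : V → W} (hp : Placement G H o η f)
    (P : W → W → V → V → K) (Z : V → V → K) {a x : W} {v w : V} (h : Fits H η f a x v w) :
    ∃ ε : ℤˣ, (matchMatrix G H (placePoint f fun _ => 1) P Z a x v w).det = (ε : ℤ) *
      ((∏ j, if H.Adj x (f j) ∧ f j ≠ a then 1 else
          if G.Adj w j ∧ j ≠ v then Z w j else 1) *
        ∏ y, if H.Adj x y ∧ y ≠ a then P x y w (η y) else 1) := by
  set hc : W → Prop := fun y => H.Adj x y ∧ y ≠ a with hhc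
  let s : V ⊕ W → V ⊕ W := Sum.elim (fun i => if hc (f i) then .inr (f i) else .inl i)
    (fun y => if hc y then .inl (η y) else .inr y)
  have hfη : ∀ {y}, hc y → f (η y) = y := fun hy => hp.f_η (hp.ne_right hy.1)
  have hηf : ∀ {i}, hc (f i) → η (f i) = i := fun hi => hp.η_f (hp.ne_right hi.1)
  have hs : Function.Involutive s := by
    rintro (i | y)
    · by_cases hi : hc (f i)
      · simp [s, hi, hηf hi]
      · simp [s, hi]
    · by_cases hy : hc y
      · simp [s, hy, hfη hy]
      · simp [s, hy]
  refine ⟨Equiv.Perm.sign (hs.toPerm s), ?_⟩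
  set M := matchMatrix G H (placePoint f fun _ => (1 : K)) P Z a x v w with hM
  rw [Matrix.det_apply', Finset.sum_eq_single (hs.toPerm s)]
  · congr 1
    rw [Fintype.prod_sum_type]
    congr 1
    · refine Finset.prod_congr rfl fun j _ => ?_
      by_cases hj : hc (f j)
      · have h1 := h.adj_η hp hj
        rw [hηf hj] at h1
        have e : (hs.toPerm s) (Sum.inl j) = Sum.inr (f j) := by simp [s, hj]
        rw [e, if_pos hj, hM]
        simp only [matchMatrix, Matrix.of_apply]
        rw [if_pos ⟨h1, hj⟩, placePoint, if_pos rfl]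
      · have e : (hs.toPerm s) (Sum.inl j) = Sum.inl j := by simp [s, hj]
        rw [e, if_neg hj, hM]
        simp [matchMatrix]
    · refine Finset.prod_congr rfl fun y _ => ?_
      by_cases hy : hc y
      · have h1 := h.adj_η hp hy
        have e : (hs.toPerm s) (Sum.inr y) = Sum.inl (η y) := by simp [s, hy]
        rw [e, if_pos hy, hM]
        simp only [matchMatrix, Matrix.of_apply]
        rw [if_pos ⟨h1, hy⟩, placePoint, if_pos (hfη hy), one_mul]
      · have e : (hs.toPerm s) (Sum.inr y) = Sum.inr y := by simp [s, hy]
        rw [e, if_neg hy, hM]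
        simp only [matchMatrix, Matrix.of_apply]
        rw [if_pos trivial, if_neg hy]
  · intro τ _ hτ
    suffices hz : ∏ i, M (τ i) i = 0 by rw [hz, mul_zero]
    by_contra hne
    have hall : ∀ c, M (τ c) c ≠ 0 := fun c hc => hne (Finset.prod_eq_zero (Finset.mem_univ c) hc)
    apply hτ
    have hr : ∀ y, τ (Sum.inr y) = s (Sum.inr y) := by
      intro y
      have h1 := hall (Sum.inr y)
      rcases hτy : τ (Sum.inr y) with i | y'
      · rw [hτy, hM] at h1
        simp only [matchMatrix, Matrix.of_apply] at h1
        have h2 : hc y := by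
          by_contra hh
          exact h1 (if_neg fun k => hh k.2)
        have h3 : f i = y := by
          by_contra hh
          rw [placePoint, if_neg hh, zero_mul, ite_self] at h1
          exact h1 rfl
        have h4 : η y = i := by rw [← h3]; exact hηf (h3 ▸ h2)
        simp [s, h2, h4]
      · rw [hτy, hM] at h1
        simp only [matchMatrix, Matrix.of_apply] at h1
        have h2 : y' = y := by
          by_contra hh
          exact h1 (if_neg hh)
        subst h2
        have h3 : ¬ hc y' := by
          intro hh
          rw [if_pos rfl, if_pos hh] at h1
          exact h1 rfl
        simp [s, h3]
    ext c : 1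
    rcases c with j | y
    · have h1 := hall (Sum.inl j)
      show τ (Sum.inl j) = s (Sum.inl j)
      rcases hτj : τ (Sum.inl j) with i | y
      · rw [hτj, hM] at h1
        simp only [matchMatrix, Matrix.of_apply] at h1
        have h2 : i = j := by
          by_contra hh
          exact h1 (if_neg hh)
        subst h2
        by_cases h3 : hc (f i)
        · have h4 := hr (f i)
          have h5 : s (Sum.inr (f i)) = Sum.inl i := by simp [s, h3, hηf h3]
          rw [h5, ← hτj] at h4
          exact absurd (τ.injective h4) (by simp)
        · simp [s, h3]
      · rw [hτj, hM] at h1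
        simp only [matchMatrix, Matrix.of_apply] at h1
        have h2 : hc y := by
          by_contra hh
          exact h1 (if_neg fun k => hh k.2)
        have h3 : f j = y := by
          by_contra hh
          rw [placePoint, if_neg hh, ite_self] at h1
          exact h1 rfl
        subst h3
        simp [s, h2]
    · exact hr y
  · intro hh
    exact absurd (Finset.mem_univ _) hh

/-- All factors of the surviving term belong to strictly smaller branches, so a depth equal to the
number of vertices of the branch is enough. -/
theorem isUnit_arcValue_place (hG : ∀ x, NoReturn G x) {o : W} {η : W → V} {f : V → W}
    (hp : Placement G H o η f) {u : W → K} (hu : ∀ x, IsUnit (u x)) (d : ℕ) {a x : W} {v w : V}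
    (h : Fits H η f a x v w) (hv : v = w ∨ G.Adj w v) (hd : branchCard G v w ≤ d) :
    IsUnit (arcValue G H (placePoint f fun _ => 1) (placePoint f u) d a x v w) := by
  classical
  induction d generalizing a x v w with
  | zero =>
    have : 0 < branchCard G v w := Finset.card_pos.2
      ⟨w, Finset.mem_filter.2 ⟨Finset.mem_univ w, Branch.refl v w⟩⟩
    omega
  | succ d ih =>
    rw [arcValue_succ]
    obtain ⟨ε, hε⟩ := det_matchMatrix_place hp (arcValue G H (placePoint f fun _ => 1)
      (placePoint f u) d) (branchValue G H (placePoint f fun _ => 1) (placePoint f u) d) h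
    rw [hε]
    refine IsUnit.mul ?_ (IsUnit.mul ?_ ?_)
    · exact ε.isUnit.map (Int.castRingHom K)
    · rw [IsUnit.prod_univ_iff]
      intro j
      split_ifs with h1 h2
      · exact isUnit_one
      · rw [branchValue_place]
        refine (hu _).mul (ih (h.root hp h2.2 h1) (Or.inr h2.1.symm) ?_)
        have := branchCard_lt hG hv h2.1 h2.2
        omega
      · exact isUnit_one
    · rw [IsUnit.prod_univ_iff]
      intro y
      split_ifs with h1
      · have h2 := h.adj_η hp h1
        refine ih (h.succ hp h1.1) (Or.inr h2.1.symm) ?_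
        have := branchCard_lt hG hv h2.1 h2.2
        omega
      · exact isUnit_one

/-- Follow the host from `w` towards `η y₀`. Arcs of the pattern preserve `u ≠ 0`, so the component
of `y₀` is entered at a new root, where the factor `u` is zero. -/
theorem arcValue_place_eq_zero {o : W} {η : W → V} {f : V → W} (hp : Placement G H o η f)
    {u : W → K} (hu : ∀ x y, H.Adj x y → u x = 0 → u y = 0) {y₀ : W} (hy₀ : u y₀ = 0)
    (hy₀o : y₀ ≠ o) (d : ℕ) {a x : W} {v w : V} (h : Fits H η f a x v w) (hx : u x ≠ 0)
    (hb : Branch G v w (η y₀)) :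
    arcValue G H (placePoint f fun _ => 1) (placePoint f u) d a x v w = 0 := by
  classical
  induction d generalizing a x v w with
  | zero => rfl
  | succ d ih =>
    rw [arcValue_succ]
    obtain ⟨ε, hε⟩ := det_matchMatrix_place hp (arcValue G H (placePoint f fun _ => 1)
      (placePoint f u) d) (branchValue G H (placePoint f fun _ => 1) (placePoint f u) d) h
    rw [hε]
    rcases hb.eq_or with e | ⟨i, hi, hiv, hbi⟩
    · rw [← h.1, ← e, hp.f_η hy₀o] at hx
      exact absurd hy₀ hx
    by_cases h1 : H.Adj x (f i) ∧ f i ≠ a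
    · have e : η (f i) = i := hp.η_f (hp.ne_right h1.1)
      rw [Finset.prod_eq_zero (i := f i) (Finset.mem_univ _), mul_zero, mul_zero]
      rw [if_pos h1, e]
      have h2 := h.succ hp h1.1
      rw [e] at h2
      exact ih h2 (fun k => hx (hu _ _ h1.1.symm k)) hbi
    · rw [Finset.prod_eq_zero (i := i) (Finset.mem_univ _), zero_mul, mul_zero]
      rw [if_neg h1, if_pos ⟨hi, hiv⟩, branchValue_place]
      by_cases h2 : u (f i) = 0
      · rw [h2, zero_mul]
      · rw [ih (h.root hp hiv h1) h2 hbi, mul_zero]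

theorem isUnit_branchValue_place (hG : ∀ x, NoReturn G x) {o : W} {η : W → V} {f : V → W}
    (hp : Placement G H o η f) {u : W → K} (hu : ∀ x, IsUnit (u x)) (w : V) :
    IsUnit (branchValue G H (placePoint f fun _ => 1) (placePoint f u) (Fintype.card V) w w) := by
  rw [branchValue_place]
  exact (hu _).mul (isUnit_arcValue_place hG hp hu _ (hp.fits_root w) (Or.inl rfl)
    (Finset.card_le_univ _))

theorem branchValue_place_eq_zero {o : W} {η : W → V} {f : V → W} (hp : Placement G H o η f)
    {u : W → K} (hu : ∀ x y, H.Adj x y → u x = 0 → u y = 0) {y₀ : W} (hy₀ : u y₀ = 0)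
    (hy₀o : y₀ ≠ o) (d : ℕ) {w : V} (hb : G.Reachable w (η y₀)) :
    branchValue G H (placePoint f fun _ => 1) (placePoint f u) d w w = 0 := by
  rw [branchValue_place]
  by_cases h : u (f w) = 0
  · rw [h, zero_mul]
  · rw [arcValue_place_eq_zero hp hu hy₀ hy₀o d (hp.fits_root w) h (branch_self_iff.2 hb),
      mul_zero]

end Certificate

/-! ### If the polynomial does not vanish, the pattern is contained in the host -/

section Zeta

variable {K : Type*} [CommRing K]

/-- The indicator function of the supersets of `S`, where sets are given by binary numbers. -/
def zeta (K : Type*) [CommRing K] (S : Finset ℕ) : ℕ → K :=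
  fun t => if ∀ j ∈ S, t.testBit j = true then 1 else 0

theorem zeta_empty : zeta K ∅ = 1 := by
  funext t
  simp [zeta]

theorem zeta_mul (S T : Finset ℕ) : zeta K S * zeta K T = zeta K (S ∪ T) := by
  funext t
  have h : (∀ j ∈ S ∪ T, t.testBit j = true)
      ↔ (∀ j ∈ S, t.testBit j = true) ∧ ∀ j ∈ T, t.testBit j = true := by
    simp only [Finset.mem_union, or_imp, forall_and]
  simp only [zeta, Pi.mul_apply, h]
  split_ifs <;> simp_all

/-- The linear combinations of the functions `zeta K S` with `S` in a given family. -/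
def zetaSpan (K : Type*) [CommRing K] (F : Set (Finset ℕ)) : Submodule K (ℕ → K) :=
  Submodule.span K (zeta K '' F)

theorem zetaSpan_mono {F F' : Set (Finset ℕ)} (h : F ⊆ F') : zetaSpan K F ≤ zetaSpan K F' :=
  Submodule.span_mono (Set.image_mono h)

theorem zeta_mem_zetaSpan {F : Set (Finset ℕ)} {S : Finset ℕ} (h : S ∈ F) :
    zeta K S ∈ zetaSpan K F := Submodule.subset_span ⟨S, h, rfl⟩

theorem one_mem_zetaSpan {F : Set (Finset ℕ)} (h : ∅ ∈ F) : (1 : ℕ → K) ∈ zetaSpan K F :=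
  zeta_empty (K := K) ▸ zeta_mem_zetaSpan h

theorem mul_mem_zetaSpan {F F' F'' : Set (Finset ℕ)} {a b : ℕ → K} (ha : a ∈ zetaSpan K F)
    (hb : b ∈ zetaSpan K F') (h : ∀ S ∈ F, ∀ S' ∈ F', S ∪ S' ∈ F'') :
    a * b ∈ zetaSpan K F'' := by
  have h1 := Submodule.mul_mem_mul ha hb
  rw [zetaSpan, zetaSpan, Submodule.span_mul_span] at h1
  refine Submodule.span_mono ?_ h1
  rintro _ ⟨_, ⟨S, hS, rfl⟩, _, ⟨S', hS', rfl⟩, rfl⟩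
  exact ⟨S ∪ S', h S hS S' hS', (zeta_mul S S').symm⟩

theorem prod_mem_zetaSpan {ι : Type*} (s : Finset ι) (f : ι → ℕ → K) (F : ι → Set (Finset ℕ))
    (h : ∀ i ∈ s, f i ∈ zetaSpan K (F i)) : ∏ i ∈ s, f i ∈ zetaSpan K
      {S | ∃ c : ι → Finset ℕ, (∀ i ∈ s, c i ∈ F i) ∧ S = s.biUnion c} := by
  classical
  induction s using Finset.induction_on with
  | empty =>
    rw [Finset.prod_empty]
    exact one_mem_zetaSpan ⟨fun _ => ∅, by simp, by simp⟩
  | insert i s hi ih =>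
    rw [Finset.prod_insert hi]
    refine mul_mem_zetaSpan (h i (by simp)) (ih fun j hj => h j (by simp [hj])) ?_
    rintro S hS _ ⟨c, hc, rfl⟩
    refine ⟨Function.update c i S, fun j hj => ?_, ?_⟩
    · rcases Finset.mem_insert.1 hj with rfl | hj'
      · simpa using hS
      · rw [Function.update_of_ne (ne_of_mem_of_not_mem hj' hi)]
        exact hc j hj'
    · rw [Finset.biUnion_insert, Function.update_self]
      congr 1
      refine Finset.biUnion_congr rfl fun j hj => ?_
      rw [Function.update_of_ne (ne_of_mem_of_not_mem hj hi)]

/-- The sign of the set given by the binary number `t`. -/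
def setSign (K : Type*) [CommRing K] (k t : ℕ) : K :=
  ∏ j ∈ Finset.range k, if t.testBit j then 1 else -1

/-- Flipping bit `j` reverses the sign and leaves the indicator unchanged, so the terms cancel in
pairs. -/
theorem sum_setSign_zeta {k j : ℕ} (hj : j < k) {S : Finset ℕ} (hS : j ∉ S) :
    ∑ t ∈ Finset.range (2 ^ k), setSign K k t * zeta K S t = 0 := by
  have htb : ∀ t i, (t ^^^ 2 ^ j).testBit i = if i = j then !t.testBit i else t.testBit i := by
    intro t i
    rw [Nat.testBit_xor, Nat.testBit_two_pow]
    by_cases h : i = j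
    · subst h; simp
    · simp [h, Ne.symm h]
  refine Finset.sum_involution (fun t _ => t ^^^ 2 ^ j) ?_ ?_ ?_ ?_
  · intro t _
    have h1 : zeta K S (t ^^^ 2 ^ j) = zeta K S t := by
      have : (∀ i ∈ S, (t ^^^ 2 ^ j).testBit i = true) ↔ ∀ i ∈ S, t.testBit i = true := by
        refine forall₂_congr fun i hi => ?_
        rw [htb, if_neg (by rintro rfl; exact hS hi)]
      simp only [zeta, this]
    have h2 : setSign K k (t ^^^ 2 ^ j) = -setSign K k t := by
      have hm : j ∈ Finset.range k := Finset.mem_range.2 hj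
      rw [setSign, setSign, ← Finset.mul_prod_erase _ _ hm, ← Finset.mul_prod_erase _ _ hm,
        ← neg_mul]
      congr 1
      · rw [htb, if_pos rfl]
        cases t.testBit j <;> simp
      · refine Finset.prod_congr rfl fun i hi => ?_
        rw [htb, if_neg (Finset.ne_of_mem_erase hi)]
    rw [h1, h2]
    ring
  · intro t _ _ h
    have := htb t j
    rw [h] at this
    simp at this
  · intro t ht
    exact Finset.mem_range.2 (Nat.xor_lt_two_pow (Finset.mem_range.1 ht)
      (Nat.pow_lt_pow_right (by norm_num) hj))
  · intro t _
    rw [Nat.xor_assoc, Nat.xor_self, Nat.xor_zero]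

end Zeta

/-! ### Embeddings behind the terms of the values. -/

section Soundness

variable {V W K : Type*} {G : SimpleGraph V} {H : SimpleGraph W}

/-- The map `η` embeds the part of `H` induced by `A` into the part of `G` induced by `U`. -/
def EmbedsOn (G : SimpleGraph V) (H : SimpleGraph W) (η : W → V) (A : Set W) (U : Set V) : Prop :=
  Set.MapsTo η A U ∧ Set.InjOn η A ∧ ∀ x ∈ A, ∀ y ∈ A, H.Adj x y → G.Adj (η x) (η y)

/-- The vertices other than `o` of the components with number in `S`. -/
def compVerts (o : W) (c : W → ℕ) (S : Finset ℕ) : Set W := {x | x ≠ o ∧ c x ∈ S}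

/-- The sets of components that can be embedded into a branch. -/
def freeSets (G : SimpleGraph V) (H : SimpleGraph W) (o : W) (c : W → ℕ) (v w : V) :
    Set (Finset ℕ) :=
  {S | ∃ η, EmbedsOn G H η (compVerts o c S) {u | Branch G v w u}}

/-- The sets of components that can be embedded into the branch of `G` behind the arc from `v` to
`w` together with the branch of `H` behind the arc from `a` to `x`. -/
def arcSets (G : SimpleGraph V) (H : SimpleGraph W) (o : W) (c : W → ℕ) (d : ℕ) (a x : W)
    (v w : V) : Set (Finset ℕ) :=
  {S | FinUnfold H d a x ∧ ∃ η₀ η, EmbedsOn G H η₀ {y | Branch H a x y} {u | Branch G v w u} ∧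
    η₀ x = w ∧ EmbedsOn G H η (compVerts o c S) {u | Branch G v w u} ∧
    ∀ y y', Branch H a x y → y' ∈ compVerts o c S → η₀ y ≠ η y'}

/-- Rooted at `x`, the embedding `η₀` covers the whole component of `x`. Use it there and `η`
elsewhere; if `S` already contains that component, its copy in `η` is ignored. -/
theorem insert_mem_freeSets {o : W} {c : W → ℕ} (hc : ∀ x y, H.Adj x y → c x = c y)
    (hc' : ∀ x y, x ≠ o → y ≠ o → c x = c y → H.Reachable x y) {d : ℕ} {x : W} {v w : V}
    (hx : x ≠ o) {S : Finset ℕ} (hS : S ∈ arcSets G H o c d x x v w) :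
    {c x} ∪ S ∈ freeSets G H o c v w := by
  classical
  obtain ⟨-, η₀, η, ⟨h1, h2, h3⟩, -, ⟨k1, k2, k3⟩, hd⟩ := hS
  have hb : ∀ {y}, y ≠ o → c y = c x → Branch H x x y := fun hy e =>
    branch_self_iff.2 (hc' _ _ hx hy e.symm)
  have hm : ∀ {y}, y ∈ compVerts o c ({c x} ∪ S) → c y ≠ c x → y ∈ compVerts o c S := by
    intro y hy hne
    refine ⟨hy.1, ?_⟩
    simpa [hne] using hy.2
  refine ⟨fun y => if c y = c x then η₀ y else η y, fun y hy => ?_, fun y hy y' hy' e => ?_,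
    fun y hy y' hy' hadj => ?_⟩
  · dsimp only
    split_ifs with h
    · exact h1 (hb hy.1 h)
    · exact k1 (hm hy h)
  · dsimp only at e
    split_ifs at e with h h' h'
    · exact h2 (hb hy.1 h) (hb hy'.1 h') e
    · exact absurd e (hd _ _ (hb hy.1 h) (hm hy' h'))
    · exact absurd e.symm (hd _ _ (hb hy'.1 h') (hm hy h))
    · exact k2 (hm hy h) (hm hy' h') e
  · have e := hc _ _ hadj
    dsimp only
    by_cases h : c y = c x
    · rw [if_pos h, if_pos (e ▸ h)]
      exact h3 _ (hb hy.1 h) _ (hb hy'.1 (e ▸ h)) hadj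
    · rw [if_neg h, if_neg (e ▸ h)]
      exact k3 _ (hm hy h) _ (hm hy' (e ▸ h)) hadj

/-- The condition on the set of components that the column `q` of the matrix contributes, if the
permutation matches it with the row `r`. -/
def columnSets (G : SimpleGraph V) (H : SimpleGraph W) (o : W) (c : W → ℕ) (d : ℕ) (a x : W)
    (v w : V) (q r : V ⊕ W) : Set (Finset ℕ) :=
  {S | ∃ η₀ η : W → V,
    (∀ y, q = .inr y → (H.Adj x y ∧ y ≠ a) → ∃ i, r = .inl i ∧ (G.Adj w i ∧ i ≠ v) ∧
      FinUnfold H d x y ∧ EmbedsOn G H η₀ {u | Branch H x y u} {u | Branch G w i u} ∧ η₀ y = i ∧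
      ∀ u u', Branch H x y u → u' ∈ compVerts o c S → η₀ u ≠ η u') ∧
    ∀ s ∈ S, ∃ i, r = .inl i ∧ (G.Adj w i ∧ i ≠ v) ∧
      EmbedsOn G H η (compVerts o c S) {u | Branch G w i u}}

/-- Glue the embeddings given by the columns. Different columns have different rows, hence images in
disjoint branches of the host. The finite unfolding makes the branches of the pattern disjoint too,
so that the glued map is well defined and respects adjacency. -/
theorem biUnion_mem_arcSets [Fintype V] [Fintype W] (hG : ∀ x, NoReturn G x) {o : W} {c : W → ℕ}
    (hc : ∀ x y, H.Adj x y → c x = c y) {d : ℕ} {a x : W} {v w : V} (hv : v = w ∨ G.Adj w v)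
    (τ : Equiv.Perm (V ⊕ W)) (S : V ⊕ W → Finset ℕ)
    (hS : ∀ q, S q ∈ columnSets G H o c d a x v w q (τ q)) :
    Finset.univ.biUnion S ∈ arcSets G H o c (d + 1) a x v w := by
  classical
  choose η₀ η h₀ h₁ using hS
  have huniq : ∀ {y y' u}, (H.Adj x y ∧ y ≠ a) → (H.Adj x y' ∧ y' ≠ a) → Branch H x y u →
      Branch H x y' u → y = y' := by
    intro y y' u hy hy' hu hu'
    by_contra hne
    obtain ⟨i, -, -, hf, -⟩ := h₀ (.inr y) y rfl hy
    exact hf.not_branch hy.1 hy'.1 hne (Relation.ReflTransGen.trans hu (hu'.symm hy'.1.ne'))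
  have hrow : ∀ {q q' : V ⊕ W} {i i' u : V}, τ q = .inl i → τ q' = .inl i' →
      (G.Adj w i ∧ i ≠ v) → (G.Adj w i' ∧ i' ≠ v) → Branch G w i u → Branch G w i' u →
      q = q' := by
    intro q q' i i' u hq hq' hi hi' hu hu'
    have := (hG w).unique hi.1 hi'.1 hu hu'
    subst this
    exact τ.injective (hq.trans hq'.symm)
  let ch : W → W := fun u =>
    if h : ∃ y, (H.Adj x y ∧ y ≠ a) ∧ Branch H x y u then h.choose else x
  have hch : ∀ {y u}, (H.Adj x y ∧ y ≠ a) → Branch H x y u → ch u = y := by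
    intro y u hy hu
    have h : ∃ y, (H.Adj x y ∧ y ≠ a) ∧ Branch H x y u := ⟨y, hy, hu⟩
    have := h.choose_spec
    simp only [ch, dif_pos h]
    exact huniq this.1 hy this.2 hu
  -- A component may be contributed by several columns; one is chosen, and the default is
  -- irrelevant.
  let col : ℕ → V ⊕ W := fun s => if h : ∃ q, s ∈ S q then h.choose else .inl w
  have hcol : ∀ {u}, u ∈ compVerts o c (Finset.univ.biUnion S) →
      u ∈ compVerts o c (S (col (c u))) := by
    intro u hu
    have h : ∃ q, c u ∈ S q := by simpa using hu.2
    refine ⟨hu.1, ?_⟩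
    simp only [col, dif_pos h]
    exact h.choose_spec
  let N₀ : W → V := fun u => if u = x then w else η₀ (.inr (ch u)) u
  let N : W → V := fun u => η (col (c u)) u
  have hN₀ : ∀ {u}, Branch H a x u → u ≠ x → ∃ y i, (H.Adj x y ∧ y ≠ a) ∧ Branch H x y u ∧
      τ (.inr y) = .inl i ∧ (G.Adj w i ∧ i ≠ v) ∧ N₀ u = η₀ (.inr y) u ∧
      Branch G w i (N₀ u) := by
    intro u hu hux
    obtain ⟨y, h1, h2, h3⟩ := hu.eq_or.resolve_left hux
    obtain ⟨i, hi, hgi, -, he, -⟩ := h₀ (.inr y) y rfl ⟨h1, h2⟩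
    have e : N₀ u = η₀ (.inr y) u := by simp only [N₀, if_neg hux, hch ⟨h1, h2⟩ h3]
    exact ⟨y, i, ⟨h1, h2⟩, h3, hi, hgi, e, e ▸ he.1 h3⟩
  have hN : ∀ {u}, u ∈ compVerts o c (Finset.univ.biUnion S) → ∃ i,
      τ (col (c u)) = .inl i ∧ (G.Adj w i ∧ i ≠ v) ∧
      EmbedsOn G H (η (col (c u))) (compVerts o c (S (col (c u)))) {u | Branch G w i u} ∧
      Branch G w i (N u) := by
    intro u hu
    obtain ⟨i, hi, hgi, he⟩ := h₁ _ _ (hcol hu).2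
    exact ⟨i, hi, hgi, he, he.1 (hcol hu)⟩
  have hNx : N₀ x = w := if_pos rfl
  refine ⟨fun y h1 h2 => ?_, N₀, N, ⟨fun u hu => ?_, fun u hu u' hu' e => ?_,
    fun u hu u' hu' hadj => ?_⟩, hNx, ⟨fun u hu => ?_, fun u hu u' hu' e => ?_,
    fun u hu u' hu' hadj => ?_⟩, fun u u' hu hu' e => ?_⟩
  · obtain ⟨i, -, -, hf, -⟩ := h₀ (.inr y) y rfl ⟨h1, h2⟩
    exact hf
  · rcases eq_or_ne u x with rfl | hux
    · rw [hNx]; exact Branch.refl _ _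
    · obtain ⟨y, i, -, -, -, hi, -, hb⟩ := hN₀ hu hux
      exact hb.of_succ (hG w) hv hi.1 hi.2
  · rcases eq_or_ne u x with hux | hux <;> rcases eq_or_ne u' x with hux' | hux'
    · rw [hux, hux']
    · obtain ⟨y, i, -, -, -, hi, -, hb⟩ := hN₀ hu' hux'
      rw [hux, hNx] at e
      exact absurd e.symm (hb.ne hi.1.ne')
    · obtain ⟨y, i, -, -, -, hi, -, hb⟩ := hN₀ hu hux
      rw [hux', hNx] at e
      exact absurd e (hb.ne hi.1.ne')
    · obtain ⟨y, i, hy, hyu, hτ, hi, hN, hb⟩ := hN₀ hu hux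
      obtain ⟨y', i', hy', hyu', hτ', hi', hN', hb'⟩ := hN₀ hu' hux'
      have := hrow hτ hτ' hi hi' hb (e ▸ hb')
      rw [Sum.inr.injEq] at this
      subst this
      obtain ⟨_, _, _, _, he, _⟩ := h₀ (.inr y) y rfl hy
      exact he.2.1 hyu hyu' (by rw [← hN, ← hN', e])
  · have hroot : ∀ {u}, Branch H a x u → H.Adj x u → G.Adj w (N₀ u) := by
      intro u hu hxu
      have hua : u ≠ a := by
        rintro rfl
        exact hu.ne hxu.ne rfl
      obtain ⟨i, -, hi, -, -, he, -⟩ := h₀ (.inr u) u rfl ⟨hxu, hua⟩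
      have e : N₀ u = η₀ (.inr u) u := by
        simp only [N₀, if_neg hxu.ne', hch ⟨hxu, hua⟩ (Branch.refl _ _)]
      rw [e, he]
      exact hi.1
    rcases eq_or_ne u x with hux | hux
    · subst hux
      rw [hNx]
      exact hroot hu' hadj
    rcases eq_or_ne u' x with hux' | hux'
    · subst hux'
      rw [hNx]
      exact (hroot hu hadj.symm).symm
    obtain ⟨y, i, hy, hyu, hτ, hi, hN, hb⟩ := hN₀ hu hux
    have hyu' := hyu.step hadj hux'
    have e : N₀ u' = η₀ (.inr y) u' := by simp only [N₀, if_neg hux', hch hy hyu']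
    obtain ⟨_, _, _, _, he, _⟩ := h₀ (.inr y) y rfl hy
    rw [hN, e]
    exact he.2.2 _ hyu _ hyu' hadj
  · obtain ⟨i, -, hi, -, hb⟩ := hN hu
    exact hb.of_succ (hG w) hv hi.1 hi.2
  · obtain ⟨i, hτ, hi, he, hb⟩ := hN hu
    obtain ⟨i', hτ', hi', he', hb'⟩ := hN hu'
    have h := hrow hτ hτ' hi hi' hb (e ▸ hb')
    have hu2 := hcol hu'
    rw [← h] at hu2
    refine he.2.1 (hcol hu) hu2 ?_
    have : N u' = η (col (c u)) u' := by simp only [N, h]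
    rw [← this, ← e]
  · obtain ⟨i, hτ, hi, he, hb⟩ := hN hu
    have hcu := hc _ _ hadj
    have hu2 := hcol hu'
    rw [← hcu] at hu2
    have e : N u' = η (col (c u)) u' := by simp only [N, hcu]
    rw [e]
    exact he.2.2 _ (hcol hu) _ hu2 hadj
  · obtain ⟨i', hτ', hi', he', hb'⟩ := hN hu'
    rcases eq_or_ne u x with hux | hux
    · rw [hux, hNx] at e
      exact hb'.ne hi'.1.ne' e.symm
    · obtain ⟨y, i, hy, hyu, hτ, hi, hN, hb⟩ := hN₀ hu hux
      have h := hrow hτ hτ' hi hi' hb (e ▸ hb')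
      obtain ⟨_, _, _, _, _, _, hd⟩ := h₀ (.inr y) y rfl hy
      have hu2 := hcol hu'
      rw [← h] at hu2
      refine hd u u' hyu hu2 ?_
      have : N u' = η (.inr y) u' := by simp only [N, h]
      rw [← hN, ← this, e]

variable [Fintype V] [Fintype W] [CommRing K]

open Classical in
/-- The values at the roots of the embedded components as functions of the set of components. -/
noncomputable def rootFun (o : W) (c : W → ℕ) (ξ : W → V → K) (x : W) (w : V) : ℕ → K :=
  fun t => if x = o ∨ t.testBit (c x) = true then ξ x w else 0

/-- The values are computed in the ring of functions of the set of components. There `rootFun` is a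
multiple of the indicator of `{c x}`, or of `1` for `o`, products of indicators correspond to
unions, and the determinant is expanded permutation by permutation. -/
theorem arcValue_mem_zetaSpan (hG : ∀ x, NoReturn G x) {o : W} {c : W → ℕ}
    (hc : ∀ x y, H.Adj x y → c x = c y)
    (hc' : ∀ x y, x ≠ o → y ≠ o → c x = c y → H.Reachable x y) (ξ : W → V → K) (d : ℕ) :
    (∀ a x v w, (v = w ∨ G.Adj w v) →
      arcValue G H (fun x w _ => ξ x w) (rootFun o c ξ) d a x v w
        ∈ zetaSpan K (arcSets G H o c d a x v w)) ∧
    ∀ v w, (v = w ∨ G.Adj w v) → branchValue G H (fun x w _ => ξ x w) (rootFun o c ξ) d v w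
        ∈ zetaSpan K (freeSets G H o c v w) := by
  classical
  have hfree : ∀ d, (∀ a x v w, (v = w ∨ G.Adj w v) →
      arcValue G H (fun x w _ => ξ x w) (rootFun o c ξ) d a x v w
        ∈ zetaSpan K (arcSets G H o c d a x v w)) →
      ∀ v w, (v = w ∨ G.Adj w v) → branchValue G H (fun x w _ => ξ x w) (rootFun o c ξ) d v w
        ∈ zetaSpan K (freeSets G H o c v w) := by
    intro d h v w hv
    refine Submodule.sum_mem _ fun x _ => ?_
    rcases eq_or_ne x o with hx | hx
    · have e : rootFun o c ξ x w = ξ x w • (1 : ℕ → K) := by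
        funext t
        simp [rootFun, hx]
      rw [e, smul_mul_assoc, one_mul]
      refine Submodule.smul_mem _ _ (zetaSpan_mono ?_ (h x x v w hv))
      rintro S ⟨-, η₀, η, -, -, hη, -⟩
      exact ⟨η, hη⟩
    · have e : rootFun o c ξ x w = ξ x w • zeta K {c x} := by
        funext t
        simp [rootFun, zeta, hx]
      rw [e, smul_mul_assoc]
      refine Submodule.smul_mem _ _ (mul_mem_zetaSpan (F := {{c x}})
        (zeta_mem_zetaSpan rfl) (h x x v w hv) ?_)
      rintro _ rfl S hS
      exact insert_mem_freeSets hc hc' hx hS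
  suffices h : ∀ a x v w, (v = w ∨ G.Adj w v) →
      arcValue G H (fun x w _ => ξ x w) (rootFun o c ξ) d a x v w
        ∈ zetaSpan K (arcSets G H o c d a x v w) from ⟨h, hfree d h⟩
  induction d with
  | zero =>
    intro a x v w _
    exact Submodule.zero_mem _
  | succ d ih =>
    intro a x v w hv
    rw [arcValue_succ, Matrix.det_apply]
    refine Submodule.sum_mem _ fun τ _ => ?_
    have key : ∏ q, matchMatrix G H (fun x w _ => ξ x w)
        (arcValue G H (fun x w _ => ξ x w) (rootFun o c ξ) d)
        (branchValue G H (fun x w _ => ξ x w) (rootFun o c ξ) d) a x v w (τ q) q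
        ∈ zetaSpan K (arcSets G H o c (d + 1) a x v w) := by
      refine zetaSpan_mono ?_ (prod_mem_zetaSpan _ _
        (fun q => columnSets G H o c d a x v w q (τ q)) fun q _ => ?_)
      · rintro _ ⟨S, hS, rfl⟩
        exact biUnion_mem_arcSets hG hc hv τ S fun q => hS q (Finset.mem_univ q)
      have hconst : ∀ y i, (fun _ => ξ y i : ℕ → K) = ξ y i • 1 := by
        intro y i
        funext t
        simp
      rcases q with j | y <;> rcases hτ : τ _ with i | y' <;>
        simp only [matchMatrix, Matrix.of_apply]
      · split_ifs with h1 h2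
        · subst h1
          refine zetaSpan_mono ?_ (hfree d ih w i (Or.inr h2.1.symm))
          rintro S ⟨η, hη⟩
          exact ⟨η, η, by simp, fun s _ => ⟨i, rfl, h2, hη⟩⟩
        · exact one_mem_zetaSpan ⟨fun _ => w, fun _ => w, by simp, by simp⟩
        · exact Submodule.zero_mem _
      · split_ifs with h1
        · rw [hconst]
          exact Submodule.smul_mem _ _
            (one_mem_zetaSpan ⟨fun _ => w, fun _ => w, by simp, by simp⟩)
        · exact Submodule.zero_mem _
      · split_ifs with h1
        · rw [hconst, smul_mul_assoc, one_mul]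
          refine Submodule.smul_mem _ _ (zetaSpan_mono ?_ (ih x y w i (Or.inr h1.1.1.symm)))
          rintro S ⟨hf, η₀, η, h3, h4, h5, h6⟩
          refine ⟨η₀, η, ?_, fun s _ => ⟨i, rfl, h1.1, h5⟩⟩
          intro y₁ e _
          rw [Sum.inr.injEq] at e
          subst e
          exact ⟨i, rfl, h1.1, hf, h3, h4, h6⟩
        · exact Submodule.zero_mem _
      · split_ifs with h1 h2
        · exact Submodule.zero_mem _
        · subst h1
          refine one_mem_zetaSpan ⟨fun _ => w, fun _ => w, ?_, by simp⟩
          intro y₁ e h3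
          rw [Sum.inr.injEq] at e
          exact absurd (e ▸ h3) h2
        · exact Submodule.zero_mem _
    rcases Int.units_eq_one_or (Equiv.Perm.sign τ) with hs | hs
    · rw [hs, one_smul]; exact key
    · rw [hs, Units.neg_smul, one_smul]; exact Submodule.neg_mem _ key

/-- If the alternating sum does not vanish, then the pattern without its isolated vertex `o` can be
embedded into the host. -/
theorem exists_embedsOn (hG : ∀ x, NoReturn G x) {o : W} {c : W → ℕ}
    (hc : ∀ x y, H.Adj x y → c x = c y)
    (hc' : ∀ x y, x ≠ o → y ≠ o → c x = c y → H.Reachable x y) {k : ℕ}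
    (hk : ∀ x, x ≠ o → c x < k) (ξ : W → V → K) (d : ℕ) (s : Finset V)
    (hs : ∀ w ∈ s, ∀ w' ∈ s, G.Reachable w w' → w = w')
    (hne : ∑ t ∈ Finset.range (2 ^ k), setSign K k t *
      ∏ w ∈ s, branchValue G H ξ (fun x w => rootFun o c ξ x w t) d w w ≠ 0) :
    (∀ x, x = o) ∨ ∃ η, EmbedsOn G H η {x | x ≠ o} Set.univ := by
  classical
  -- `EmbedsOn` needs a map defined also at `o`, so an empty host is treated apart: its product is
  -- empty, and the signs alone sum to zero as soon as the pattern has a component.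
  rcases isEmpty_or_nonempty V with hV | hV
  · left
    by_contra! h
    obtain ⟨x, hx⟩ := h
    have h0 := sum_setSign_zeta (K := K) (S := ∅) (lt_of_le_of_lt (Nat.zero_le _) (hk x hx))
      (Finset.notMem_empty _)
    simp only [zeta_empty, Pi.one_apply, mul_one] at h0
    simp only [Finset.eq_empty_of_isEmpty s, Finset.prod_empty, mul_one] at hne
    exact hne h0
  right
  have hmem : ∏ w ∈ s, branchValue G H (fun x w _ => ξ x w) (rootFun o c ξ) d w w ∈
      zetaSpan K {S | ∃ η, EmbedsOn G H η (compVerts o c S) Set.univ} := by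
    refine zetaSpan_mono ?_ (prod_mem_zetaSpan s _ (fun w => freeSets G H o c w w) fun w _ =>
      (arcValue_mem_zetaSpan hG hc hc' ξ d).2 w w (Or.inl rfl))
    rintro _ ⟨S, hS, rfl⟩
    choose! η hη using hS
    -- Each component is embedded into one host component that contributes it.
    let ch : ℕ → V → Prop := fun j w => w ∈ s ∧ j ∈ S w
    have hch : ∀ u ∈ compVerts o c (s.biUnion S), ∃ w, ch (c u) w := by
      intro u hu
      simpa [ch] using hu.2
    choose! w hw using fun j (h : ∃ w, ch j w) => h
    have hm : ∀ u ∈ compVerts o c (s.biUnion S), w (c u) ∈ s ∧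
        u ∈ compVerts o c (S (w (c u))) := fun u hu =>
      ⟨(hw _ (hch u hu)).1, hu.1, (hw _ (hch u hu)).2⟩
    refine ⟨fun u => η (w (c u)) u, fun _ _ => Set.mem_univ _, fun u hu u' hu' e => ?_,
      fun u hu u' hu' hadj => ?_⟩
    · dsimp only at e
      have h1 := (hη _ (hm u hu).1).1 (hm u hu).2
      have h2 := (hη _ (hm u' hu').1).1 (hm u' hu').2
      have h3 : w (c u) = w (c u') := hs _ (hm u hu).1 _ (hm u' hu').1
        ((branch_self_iff.1 h1).trans (e ▸ branch_self_iff.1 h2).symm)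
      have h4 := (hm u' hu').2
      rw [← h3] at h4 e
      exact (hη _ (hm u hu).1).2.1 (hm u hu).2 h4 e
    · dsimp only
      have h3 := hc _ _ hadj
      have h4 := (hm u' hu').2
      rw [← h3] at h4 ⊢
      exact (hη _ (hm u hu).1).2.2 _ (hm u hu).2 _ h4 hadj
  by_contra hno
  apply hne
  -- The alternating sum as a linear functional; without an embedding every generator of the span
  -- misses an index below `k` and is killed.
  let L : (ℕ → K) →ₗ[K] K := ∑ t ∈ Finset.range (2 ^ k), setSign K k t • LinearMap.proj t
  have hL : ∀ b, L b = ∑ t ∈ Finset.range (2 ^ k), setSign K k t * b t := by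
    intro b
    simp [L]
  have hle : zetaSpan K {S | ∃ η, EmbedsOn G H η (compVerts o c S) Set.univ}
      ≤ LinearMap.ker L := by
    refine Submodule.span_le.2 ?_
    rintro _ ⟨S, ⟨η, hη⟩, rfl⟩
    rw [SetLike.mem_coe, LinearMap.mem_ker, hL]
    obtain ⟨j, hj, hjS⟩ : ∃ j < k, j ∉ S := by
      by_contra! h
      refine hno ⟨η, ?_⟩
      have e : compVerts o c S = {x | x ≠ o} := by
        ext x
        exact ⟨fun h => h.1, fun hx => ⟨hx, h _ (hk x hx)⟩⟩
      rwa [e] at hη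
    exact sum_setSign_zeta hj hjS
  have := hle hmem
  rw [LinearMap.mem_ker, hL] at this
  rw [← this]
  refine Finset.sum_congr rfl fun t _ => ?_
  rw [Finset.prod_apply]
  congr 1
  refine Finset.prod_congr rfl fun w _ => ?_
  exact (map_branchValue (G := G) (H := H) (Pi.evalRingHom (fun _ => K) t) (fun x w _ => ξ x w)
    (rootFun o c ξ) d w w).symm

end Soundness

/-! ### The alternating sum -/

section AltSum

open MvPolynomial

variable {V W K : Type*} [Fintype V] [Fintype W] {G : SimpleGraph V} {H : SimpleGraph W}

/-- The alternating sum over all sets of components of the pattern of the product of the values of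
the components of the host, which are represented by the vertices in `s`. -/
noncomputable def altSum [CommRing K] (G : SimpleGraph V) (H : SimpleGraph W) (o : W) (c : W → ℕ)
    (k : ℕ) (s : Finset V) (ξ : W → V → K) : K :=
  ∑ t ∈ Finset.range (2 ^ k), setSign K k t *
    ∏ w ∈ s, branchValue G H ξ (fun x w => rootFun o c ξ x w t) (Fintype.card V) w w

theorem map_altSum {L : Type*} [CommRing K] [CommRing L] (φ : K →+* L) (o : W) (c : W → ℕ) (k : ℕ)
    (s : Finset V) (ξ : W → V → K) :
    φ (altSum G H o c k s ξ) = altSum G H o c k s fun x w => φ (ξ x w) := by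
  simp only [altSum, map_sum, map_mul, map_prod, map_branchValue, setSign, rootFun, apply_ite φ,
    map_zero, map_one, map_neg]

theorem totalDegree_setSign {σ : Type*} [CommRing K] (k t : ℕ) :
    (setSign (MvPolynomial σ K) k t).totalDegree = 0 := by
  refine Nat.le_zero.1 ((totalDegree_finsetProd _ _).trans ?_)
  rw [Nat.le_zero, Finset.sum_eq_zero]
  intro j _
  split_ifs <;> simp

theorem sum_branchCard_le {s : Finset V} (hs : ∀ w ∈ s, ∀ w' ∈ s, G.Reachable w w' → w = w') :
    ∑ w ∈ s, branchCard G w w ≤ Fintype.card V := by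
  classical
  unfold branchCard
  rw [← Finset.card_biUnion]
  · exact Finset.card_le_univ _
  · intro w hw w' hw' hne
    rw [Function.onFun, Finset.disjoint_left]
    intro y h1 h2
    simp only [Finset.mem_filter, Finset.mem_univ, true_and, branch_self_iff] at h1 h2
    exact hne (hs w hw w' hw' (h1.trans h2.symm))

theorem totalDegree_altSum_le {σ : Type*} [CommRing K] (hG : ∀ x, NoReturn G x) (o : W)
    (c : W → ℕ) (k : ℕ) {s : Finset V} (hs : ∀ w ∈ s, ∀ w' ∈ s, G.Reachable w w' → w = w')
    (ξ : W → V → MvPolynomial σ K) (hξ : ∀ x w, (ξ x w).totalDegree ≤ 1) :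
    (altSum G H o c k s ξ).totalDegree
      ≤ (Fintype.card V + Fintype.card W + 1) * Fintype.card V := by
  refine totalDegree_finsetSum_le fun t _ => (totalDegree_mul _ _).trans ?_
  rw [totalDegree_setSign, zero_add]
  refine (totalDegree_finsetProd _ _).trans ?_
  have hy : ∀ x w, (rootFun o c ξ x w t).totalDegree ≤ 1 := by
    intro x w
    unfold rootFun
    split_ifs
    · exact hξ x w
    · simp
  calc ∑ w ∈ s, (branchValue G H ξ (fun x w => rootFun o c ξ x w t) _ w w).totalDegree
      ≤ ∑ w ∈ s, ((Fintype.card V + Fintype.card W) * branchCard G w w + 1) :=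
        Finset.sum_le_sum fun w _ => totalDegree_branchValue_le hG _ _ hξ hy _ (Or.inl rfl)
    _ = (Fintype.card V + Fintype.card W) * ∑ w ∈ s, branchCard G w w + s.card := by
        rw [Finset.sum_add_distrib, Finset.mul_sum, Finset.card_eq_sum_ones]
    _ ≤ (Fintype.card V + Fintype.card W) * Fintype.card V + Fintype.card V :=
        Nat.add_le_add (Nat.mul_le_mul_left _ (sum_branchCard_le hs)) (Finset.card_le_univ _)
    _ = _ := by ring

/-- Only the full set `2 ^ k - 1` survives, and its summand is a unit. Any other set lacks a
component with some vertex `y`, and the factor of the host component of `η y` vanishes. -/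
theorem altSum_place_ne_zero [CommRing K] [Nontrivial K] (hG : ∀ x, NoReturn G x) {o : W}
    {c : W → ℕ} {η : W → V} {f : V → W} (hp : Placement G H o η f)
    (hc : ∀ x y, H.Adj x y → c x = c y) {k : ℕ} (hk : ∀ j < k, ∃ x, x ≠ o ∧ c x = j)
    {s : Finset V} (hs : ∀ v, ∃ w ∈ s, G.Reachable w v) (hck : ∀ x, x ≠ o → c x < k) :
    altSum G H o c k s (placePoint f fun _ => (1 : K)) ≠ 0 := by
  classical
  let u : ℕ → W → K := fun t x => if x = o ∨ t.testBit (c x) = true then 1 else 0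
  have hroot : ∀ t, (fun x w => rootFun o c (placePoint f fun _ => (1 : K)) x w t)
      = placePoint f (u t) := by
    intro t
    funext x w
    simp only [rootFun, placePoint, u]
    split_ifs <;> rfl
  have hlast : 2 ^ k - 1 ∈ Finset.range (2 ^ k) :=
    Finset.mem_range.2 (Nat.sub_lt (by positivity) one_pos)
  rw [altSum, Finset.sum_eq_single_of_mem _ hlast]
  · refine IsUnit.ne_zero (IsUnit.mul ?_ ?_)
    · rw [setSign, IsUnit.prod_iff]
      intro j _
      split_ifs
      · exact isUnit_one
      · exact isUnit_one.neg
    · rw [hroot, IsUnit.prod_iff]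
      intro w _
      refine isUnit_branchValue_place hG hp (fun x => ?_) w
      have : x = o ∨ (2 ^ k - 1).testBit (c x) = true := by
        rcases eq_or_ne x o with hx | hx
        · exact Or.inl hx
        · right
          rw [Nat.testBit_two_pow_sub_one]
          exact decide_eq_true (hck x hx)
      simp only [u, if_pos this]
      exact isUnit_one
  · intro t ht hne
    obtain ⟨j, hj, hbit⟩ : ∃ j < k, t.testBit j = false := by
      by_contra! h
      apply hne
      refine Nat.eq_of_testBit_eq fun j => ?_
      rw [Nat.testBit_two_pow_sub_one]
      by_cases hj : j < k
      · rw [decide_eq_true hj]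
        simpa using h j hj
      · rw [decide_eq_false hj]
        exact Nat.testBit_lt_two_pow ((Finset.mem_range.1 ht).trans_le
          (Nat.pow_le_pow_right (by norm_num) (not_lt.1 hj)))
    obtain ⟨y, hyo, rfl⟩ := hk j hj
    obtain ⟨w, hw, hwy⟩ := hs (η y)
    rw [hroot, Finset.prod_eq_zero hw, mul_zero]
    refine branchValue_place_eq_zero hp (fun x x' hxx' hx => ?_) (y₀ := y) ?_ hyo _ hwy
    · simp only [u, hp.ne_left hxx', hp.ne_right hxx', false_or, hc _ _ hxx'] at hx ⊢
      exact hx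
    · simp [u, hyo, hbit]

end AltSum

/-! ### The probability of an error -/

section Probability

open MvPolynomial

/-- The number with the given binary digits. -/
def ofBitFun (b : ℕ) (f : ℕ → Bool) : ℕ := foldn b (fun i s => s + s + if f i then 1 else 0) 0

theorem ofBitFun_lt (b : ℕ) (f : ℕ → Bool) : ofBitFun b f < 2 ^ b := by
  induction b with
  | zero => simp [ofBitFun, foldn]
  | succ b ih =>
    rw [ofBitFun, foldn, ← ofBitFun, pow_succ]
    split_ifs <;> omega

theorem ofBitFun_inj {b : ℕ} {f g : ℕ → Bool} (h : ofBitFun b f = ofBitFun b g) :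
    ∀ i < b, f i = g i := by
  induction b with
  | zero => intro i hi; omega
  | succ b ih =>
    simp only [ofBitFun, foldn] at h ih
    have h1 : f b = g b := by
      cases hf : f b <;> cases hg : g b <;> simp only [hf, hg] at h ⊢ <;> simp at h <;> omega
    rw [h1] at h
    have h2 := ih (by omega)
    intro i hi
    rcases Nat.lt_succ_iff_lt_or_eq.1 hi with hi | rfl
    · exact h2 i hi
    · exact h1

/-- A nonzero polynomial of degree at most half the number of random values vanishes with
probability at most one half. -/
theorem card_eval_eq_zero_le {K : Type*} [Field K] [DecidableEq K] {n b D T : ℕ} (hT : n * b ≤ T)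
    {P : MvPolynomial (Fin n) K} (hP : P ≠ 0) (hD : P.totalDegree ≤ D) (hb : 2 * D ≤ 2 ^ b)
    (hK : ∀ i : ℕ, i < 2 ^ b → ∀ j : ℕ, j < 2 ^ b → (i : K) = (j : K) → i = j)
    (val : (Fin T → Bool) → ℕ → Bool)
    (hval : ∀ r r' : Fin T → Bool, (∀ i < n * b, val r i = val r' i) →
      ∀ i : Fin T, i.1 < n * b → r i = r' i) :
    2 * Nat.card {r : Fin T → Bool //
      eval (fun i : Fin n => (ofBitFun b (fun j => val r (i.1 * b + j)) : K)) P = 0} ≤ 2 ^ T := by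
  classical
  let S : Finset K := (Finset.range (2 ^ b)).image fun i : ℕ => (i : K)
  have hS : S.card = 2 ^ b := by
    rw [Finset.card_image_of_injOn, Finset.card_range]
    intro i hi j hj e
    exact hK i (by simpa using hi) j (by simpa using hj) e
  let Z : Finset (Fin n → K) := (Fintype.piFinset fun _ => S).filter fun f => eval f P = 0
  have hZ : 2 * Z.card ≤ 2 ^ (n * b) := by
    have h := schwartz_zippel_totalDegree hP S
    have hpos : (0 : ℚ≥0) < (2 : ℚ≥0) ^ b := by positivity
    have hnum : (Z.card : ℚ≥0) / ((2 ^ b) ^ n) ≤ D / 2 ^ b := by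
      refine le_trans ?_ (h.trans ?_)
      · rw [hS]; push_cast; exact le_rfl
      · rw [hS]; push_cast; gcongr
    have hhalf : (D : ℚ≥0) / 2 ^ b ≤ 1 / 2 := by
      rw [div_le_div_iff₀ hpos (by norm_num)]
      have : ((2 * D : ℕ) : ℚ≥0) ≤ ((2 ^ b : ℕ) : ℚ≥0) := by exact_mod_cast hb
      push_cast at this
      rw [one_mul, mul_comm]
      exact this
    have h3 := hnum.trans hhalf
    rw [div_le_div_iff₀ (by positivity) (by norm_num), one_mul, ← pow_mul] at h3
    have h4 : ((Z.card * 2 : ℕ) : ℚ≥0) ≤ ((2 ^ (b * n) : ℕ) : ℚ≥0) := by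
      push_cast; exact h3
    have h5 : Z.card * 2 ≤ 2 ^ (b * n) := by exact_mod_cast h4
    rw [mul_comm n b]
    omega
  -- A bad coin sequence is determined by the point it produces, which is a zero of `P` in the grid,
  -- and by the `T - n * b` coins that are not used.
  let φ : {r : Fin T → Bool //
      eval (fun i : Fin n => (ofBitFun b (fun j => val r (i.1 * b + j)) : K)) P = 0} →
      Z × (Fin (T - n * b) → Bool) := fun r =>
    (⟨fun i => (ofBitFun b (fun j => val r.1 (i.1 * b + j)) : K), by
      refine Finset.mem_filter.2 ⟨Fintype.mem_piFinset.2 fun i => ?_, r.2⟩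
      exact Finset.mem_image.2 ⟨_, Finset.mem_range.2 (ofBitFun_lt _ _), rfl⟩⟩,
    fun i => r.1 ⟨n * b + i.1, by have := i.2; omega⟩)
  have hφ : Function.Injective φ := by
    intro r r' e
    have e1 := congrArg Subtype.val (congrArg Prod.fst e)
    have e2 := congrArg Prod.snd e
    have h1 : ∀ i < n * b, val r.1 i = val r'.1 i := by
      intro i hi
      have hb0 : 0 < b := Nat.pos_of_ne_zero (by rintro rfl; simp at hi)
      have hq : i / b < n := (Nat.div_lt_iff_lt_mul hb0).2 hi
      have h2 := congrFun e1 ⟨i / b, hq⟩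
      have h3 := hK _ (ofBitFun_lt _ _) _ (ofBitFun_lt _ _) h2
      have h4 := ofBitFun_inj h3 (i % b) (Nat.mod_lt _ hb0)
      simpa [Nat.div_add_mod'] using h4
    have h2 := hval r.1 r'.1 h1
    refine Subtype.ext (funext fun i => ?_)
    by_cases hi : i.1 < n * b
    · exact h2 i hi
    · have h3 := congrFun e2 ⟨i.1 - n * b, by have := i.2; omega⟩
      have h4 : (⟨n * b + (i.1 - n * b), by have := i.2; omega⟩ : Fin T) = i :=
        Fin.ext (by simp only; omega)
      simpa only [φ, h4] using h3
  have hcard := Nat.card_le_card_of_injective φ hφ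
  rw [Nat.card_prod, Nat.card_eq_fintype_card (α := Z), Fintype.card_coe] at hcard
  have hbits : Nat.card (Fin (T - n * b) → Bool) = 2 ^ (T - n * b) := by simp
  rw [hbits] at hcard
  calc _ ≤ 2 * (Z.card * 2 ^ (T - n * b)) := Nat.mul_le_mul_left 2 hcard
    _ = 2 * Z.card * 2 ^ (T - n * b) := by ring
    _ ≤ 2 ^ (n * b) * 2 ^ (T - n * b) := Nat.mul_le_mul_right _ hZ
    _ = 2 ^ T := by rw [← pow_add]; congr 1; omega

end Probability

/-! ### Components -/

section Components

variable {n : ℕ} {G : SimpleGraph (Fin n)} {A : BoolMat}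

/-- The list `A` is the adjacency matrix of the graph `G`. -/
structure Represents (A : BoolMat) (G : SimpleGraph (Fin n)) : Prop where
  length : A.length = n
  adj_iff : ∀ i j : Fin n, adjAt A i j = true ↔ G.Adj i j
  lt_of_adj : ∀ i j, adjAt A i j = true → i < n ∧ j < n

theorem getD_map_range {α : Type} (f : ℕ → α) (d : α) {n i : ℕ} (h : i < n) :
    ((List.range n).map f).getD i d = f i := by
  simp [List.getD_eq_getElem?_getD, h]

open Classical in
/-- The adjacency matrix of a graph. -/
noncomputable def adjMat (G : SimpleGraph (Fin n)) : BoolMat :=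
  List.ofFn fun i : Fin n => List.ofFn fun j : Fin n => decide (G.Adj i j)

theorem enc_adjMat (G : SimpleGraph (Fin n)) : Enc.enc (adjMat G) = encodeGraph G := by
  have h : ∀ {m : ℕ} {α : Type} [Enc α] (f : Fin m → α),
      Enc.enc (List.ofFn f) = Data.ofList (List.ofFn fun i => Enc.enc (f i)) := by
    intro m α _ f
    show Data.ofList ((List.ofFn f).map Enc.enc) = _
    rw [List.map_ofFn]
    rfl
  rw [adjMat, encodeGraph, h]
  simp only [h]
  rfl

theorem represents_adjMat (G : SimpleGraph (Fin n)) : Represents (adjMat G) G := by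
  classical
  have key : ∀ i j, adjAt (adjMat G) i j = true ↔ ∃ (hi : i < n) (hj : j < n),
      G.Adj ⟨i, hi⟩ ⟨j, hj⟩ := by
    intro i j
    by_cases hi : i < n
    · by_cases hj : j < n
      · simp [adjAt, adjMat, List.getD_eq_getElem?_getD, hi, hj]
      · simp [adjAt, adjMat, List.getD_eq_getElem?_getD, hi, hj]
    · simp [adjAt, adjMat, List.getD_eq_getElem?_getD, hi]
  refine ⟨by simp [adjMat], fun i j => ?_, fun i j h => ?_⟩
  · rw [key]
    exact ⟨fun ⟨_, _, h⟩ => h, fun h => ⟨i.2, j.2, h⟩⟩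
  · obtain ⟨hi, hj, -⟩ := (key i j).1 h
    exact ⟨hi, hj⟩

theorem foldn_min_spec (n : ℕ) (P : ℕ → Bool) (l : ℕ → ℕ) (s : ℕ) :
    let r := foldn n (fun u s => if P u then min s (l u) else s) s
    r ≤ s ∧ (∀ u < n, P u = true → r ≤ l u) ∧ (r = s ∨ ∃ u < n, P u = true ∧ r = l u) := by
  induction n with
  | zero => simp [foldn]
  | succ n ih =>
    simp only [foldn] at ih ⊢
    generalize foldn n (fun u s => if P u then min s (l u) else s) s = r at ih ⊢
    obtain ⟨h1, h2, h3⟩ := ih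
    split_ifs with h
    · refine ⟨(min_le_left _ _).trans h1, fun u hu hP => ?_, ?_⟩
      · rcases Nat.lt_succ_iff_lt_or_eq.1 hu with hu | rfl
        · exact (min_le_left _ _).trans (h2 u hu hP)
        · exact min_le_right _ _
      · rcases min_choice r (l n) with e | e
        · rw [e]
          rcases h3 with h3 | ⟨u, hu, hP, h3⟩
          · exact Or.inl h3
          · exact Or.inr ⟨u, by omega, hP, h3⟩
        · exact Or.inr ⟨n, by omega, h, e⟩
    · refine ⟨h1, fun u hu hP => ?_, ?_⟩
      · rcases Nat.lt_succ_iff_lt_or_eq.1 hu with hu | rfl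
        · exact h2 u hu hP
        · exact absurd hP h
      · rcases h3 with h3 | ⟨u, hu, hP, h3⟩
        · exact Or.inl h3
        · exact Or.inr ⟨u, by omega, hP, h3⟩

namespace Represents

variable (hA : Represents A G)
include hA

/-- After `i` rounds the label has taken account of all walks of length at most `i`, and it never
leaves the component. -/
theorem iterate_labelStep (i : ℕ) (v : Fin n) :
    let l := ((labelStep A)^[i] ((List.range A.length).map fun i => i)).getD v.1 0
    l ≤ v.1 ∧ (∃ u : Fin n, l = u.1 ∧ G.Reachable v u) ∧
      ∀ (u : Fin n) (p : G.Walk v u), p.length ≤ i → l ≤ u.1 := by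
  induction i generalizing v with
  | zero =>
    have e : ((List.range A.length).map fun i => i).getD v.1 0 = v.1 :=
      getD_map_range _ _ (by rw [hA.length]; exact v.2)
    simp only [Function.iterate_zero, id_eq, e]
    refine ⟨le_rfl, ⟨v, rfl, SimpleGraph.Reachable.refl _⟩, fun u p hp => ?_⟩
    have := SimpleGraph.Walk.eq_of_length_eq_zero (Nat.le_zero.1 hp)
    rw [this]
  | succ i ih =>
    rw [Function.iterate_succ_apply']
    generalize (labelStep A)^[i] ((List.range A.length).map fun i => i) = l at ih
    have e : (labelStep A l).getD v.1 0 = foldn n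
        (fun u s => if adjAt A v u then min s (l.getD u 0) else s) (l.getD v.1 0) := by
      rw [labelStep, getD_map_range _ _ (by rw [hA.length]; exact v.2), hA.length,
        min_eq_left (ih v).1]
    obtain ⟨h1, h2, h3⟩ := foldn_min_spec n (fun u => adjAt A v u) (fun u => l.getD u 0)
      (l.getD v.1 0)
    simp only [e]
    refine ⟨h1.trans (ih v).1, ?_, fun u p hp => ?_⟩
    · rcases h3 with h3 | ⟨u, hu, hP, h3⟩
      · rw [h3]
        exact (ih v).2.1
      · obtain ⟨u', hu', hr⟩ := (ih ⟨u, hu⟩).2.1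
        refine ⟨u', by rw [h3]; exact hu', ?_⟩
        exact (SimpleGraph.Adj.reachable ((hA.adj_iff v ⟨u, hu⟩).1 hP)).trans hr
    · cases p with
      | nil => exact h1.trans (ih _).1
      | @cons _ x _ hadj p =>
        refine (h2 x.1 x.2 ((hA.adj_iff _ _).2 hadj)).trans ((ih x).2.2 u p ?_)
        rw [SimpleGraph.Walk.length_cons] at hp
        omega

/-- The label of a vertex is the least vertex of its component. -/
theorem exists_label (v : Fin n) : ∃ l : Fin n, (labels A).getD v.1 0 = l.1 ∧ G.Reachable v l ∧
    ∀ u, G.Reachable v u → l ≤ u := by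
  classical
  obtain ⟨-, ⟨l, hl, hr⟩, h⟩ := hA.iterate_labelStep A.length v
  refine ⟨l, hl, hr, fun u hu => ?_⟩
  obtain ⟨p⟩ := hu
  -- A path has fewer than `n` edges, so `n` rounds reach the whole component.
  have h1 := h u p.bypass (by
    have := (p.bypass_isPath).length_lt
    rw [Fintype.card_fin] at this
    rw [hA.length]
    omega)
  rw [hl] at h1
  exact h1

theorem label_eq_of_reachable {v w : Fin n} (h : G.Reachable v w) :
    (labels A).getD v.1 0 = (labels A).getD w.1 0 := by
  obtain ⟨l, hl, hr, hmin⟩ := hA.exists_label v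
  obtain ⟨l', hl', hr', hmin'⟩ := hA.exists_label w
  rw [hl, hl', le_antisymm (hmin l' (h.trans hr')) (hmin' l (h.symm.trans hr))]

theorem isRep_label (v : Fin n) : IsRep A ((labels A).getD v.1 0) := by
  obtain ⟨l, hl, hr, -⟩ := hA.exists_label v
  rw [hl, IsRep, ← hA.label_eq_of_reachable hr, hl]

theorem label_lt (v : Fin n) : (labels A).getD v.1 0 < n := by
  obtain ⟨l, hl, -⟩ := hA.exists_label v
  rw [hl]
  exact l.2

theorem eq_of_isRep {v w : Fin n} (hv : IsRep A v.1) (hw : IsRep A w.1) (h : G.Reachable v w) :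
    v = w := by
  have := hA.label_eq_of_reachable h
  rw [IsRep] at hv hw
  rw [hv, hw] at this
  exact Fin.ext this

theorem exists_isRep (v : Fin n) : ∃ w : Fin n, IsRep A w.1 ∧ G.Reachable w v := by
  obtain ⟨l, hl, hr, -⟩ := hA.exists_label v
  exact ⟨l, hl ▸ hA.isRep_label v, hr.symm⟩

end Represents

theorem countReps_eq_count (A : BoolMat) (n : ℕ) : countReps A n = Nat.count (IsRep A) n := by
  induction n with
  | zero => simp [countReps]
  | succ n ih => rw [Nat.count_succ, ← ih, countReps, Finset.sum_range_succ, ← countReps]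

theorem exists_of_lt_count {p : ℕ → Prop} [DecidablePred p] {n j : ℕ} (h : j < Nat.count p n) :
    ∃ m < n, p m ∧ Nat.count p m = j := by
  induction n with
  | zero => simp at h
  | succ n ih =>
    rw [Nat.count_succ] at h
    by_cases hj : j < Nat.count p n
    · obtain ⟨m, hm, hp⟩ := ih hj
      exact ⟨m, by omega, hp⟩
    · split_ifs at h with hp
      · exact ⟨n, by omega, hp, by omega⟩
      · omega

namespace Represents

variable (hA : Represents A G)
include hA

/-- Every component contains exactly one representative. This identifies the exponent in `mu` with
the parameter `cc H`. -/
theorem cc_eq : cc G = countReps A n := by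
  classical
  have e : countReps A n = Nat.card {v : Fin n // IsRep A v.1} := by
    rw [countReps, Finset.sum_range fun i => if IsRep A i then 1 else 0, Finset.sum_boole,
      Nat.card_eq_fintype_card, Fintype.card_subtype]
    simp
  rw [e, cc]
  refine (Nat.card_congr (Equiv.ofBijective
    (fun v : {v : Fin n // IsRep A v.1} => G.connectedComponentMk v.1) ⟨?_, ?_⟩)).symm
  · intro v w h
    exact Subtype.ext (hA.eq_of_isRep v.2 w.2 (SimpleGraph.ConnectedComponent.exact h))
  · intro C
    induction C using SimpleGraph.ConnectedComponent.ind with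
    | h v =>
      obtain ⟨w, hw, hr⟩ := hA.exists_isRep v
      exact ⟨⟨w, hw⟩, SimpleGraph.ConnectedComponent.sound hr⟩

theorem compIndex_eq_of_reachable {v w : Fin n} (h : G.Reachable v w) :
    compIndex A v = compIndex A w := by
  rw [compIndex, compIndex, hA.label_eq_of_reachable h]

theorem reachable_of_compIndex_eq {v w : Fin n} (h : compIndex A v = compIndex A w) :
    G.Reachable v w := by
  rw [compIndex, compIndex, countReps_eq_count, countReps_eq_count] at h
  have e := Nat.count_injective (hA.isRep_label v) (hA.isRep_label w) h
  obtain ⟨l, hl, hr, -⟩ := hA.exists_label v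
  obtain ⟨l', hl', hr', -⟩ := hA.exists_label w
  have : l = l' := Fin.ext (by rw [← hl, ← hl', e])
  subst this
  exact hr.trans hr'.symm

theorem compIndex_lt (v : Fin n) : compIndex A v < countReps A n := by
  rw [compIndex, countReps_eq_count, countReps_eq_count]
  exact Nat.count_strict_mono (hA.isRep_label v) (hA.label_lt v)

end Represents

theorem exists_compIndex_eq {j : ℕ} (hj : j < countReps A n) :
    ∃ v : Fin n, compIndex A v = j := by
  rw [countReps_eq_count] at hj
  obtain ⟨m, hm, hp, rfl⟩ := exists_of_lt_count hj
  refine ⟨⟨m, hm⟩, ?_⟩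
  rw [compIndex, countReps_eq_count, show (labels A).getD m 0 = m from hp]

/-! ### The pattern with an additional isolated vertex. -/

/-- A graph with an additional isolated vertex. -/
def withIsolated (G : SimpleGraph (Fin n)) : SimpleGraph (Fin (n + 1)) := G.map Fin.castSuccEmb

theorem withIsolated_adj {x y : Fin (n + 1)} : (withIsolated G).Adj x y ↔
    ∃ u v : Fin n, G.Adj u v ∧ u.castSucc = x ∧ v.castSucc = y :=
  SimpleGraph.map_adj Fin.castSuccEmb G x y

theorem withIsolated_adj_castSucc {u v : Fin n} :
    (withIsolated G).Adj u.castSucc v.castSucc ↔ G.Adj u v := by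
  rw [withIsolated_adj]
  constructor
  · rintro ⟨u', v', h, hu, hv⟩
    rw [Fin.castSucc_inj] at hu hv
    exact hu ▸ hv ▸ h
  · exact fun h => ⟨u, v, h, rfl, rfl⟩

theorem Represents.withIsolated_adj_iff (hA : Represents A G) (x y : Fin (n + 1)) :
    (withIsolated G).Adj x y ↔ adjAt A x y = true := by
  rw [withIsolated_adj]
  constructor
  · rintro ⟨u, v, h, rfl, rfl⟩
    exact (hA.adj_iff u v).2 h
  · intro h
    obtain ⟨hx, hy⟩ := hA.lt_of_adj _ _ h
    exact ⟨⟨x, hx⟩, ⟨y, hy⟩, (hA.adj_iff ⟨x, hx⟩ ⟨y, hy⟩).1 h, rfl, rfl⟩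

theorem isContained_of_embedsOn {g : ℕ} {H : SimpleGraph (Fin n)} {G : SimpleGraph (Fin g)}
    {η : Fin (n + 1) → Fin g}
    (h : EmbedsOn G (withIsolated H) η {x | x ≠ Fin.last n} Set.univ) : H.IsContained G := by
  have hne : ∀ i : Fin n, i.castSucc ≠ Fin.last n := fun i => Fin.castSucc_ne_last i
  refine ⟨⟨⟨fun i => η i.castSucc, fun {i j} hij => ?_⟩, fun i j e => ?_⟩⟩
  · exact h.2.2 _ (hne i) _ (hne j) (withIsolated_adj_castSucc.2 hij)
  · exact Fin.castSucc_injective n (h.2.1 (hne i) (hne j) e)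

theorem exists_placement {g : ℕ} [NeZero g] {H : SimpleGraph (Fin n)} {G : SimpleGraph (Fin g)}
    (h : H.IsContained G) : ∃ η f, Placement G (withIsolated H) (Fin.last n) η f := by
  classical
  obtain ⟨φ⟩ := h
  -- The image of the additional vertex is arbitrary; it only has to exist, which is why the host
  -- must be nonempty.
  obtain ⟨η, hφ⟩ : ∃ η : Fin (n + 1) → Fin g, ∀ x : Fin n, η x.castSucc = φ x :=
    ⟨Fin.lastCases 0 φ, fun x => by simp⟩
  refine ⟨η, fun w => if hw : ∃ x, φ x = w then hw.choose.castSucc else Fin.last n,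
    fun x hx => ?_, fun w x hx => ?_, fun x y hxy => ?_⟩
  · obtain ⟨u, v, -, hu, -⟩ := withIsolated_adj.1 hx
    exact Fin.castSucc_ne_last u hu
  · obtain ⟨x, rfl⟩ : ∃ y : Fin n, y.castSucc = x := ⟨x.castPred hx, Fin.castSucc_castPred x hx⟩
    rw [hφ]
    split_ifs with hw
    · rw [Fin.castSucc_inj]
      refine ⟨fun e => e ▸ hw.choose_spec, fun e => φ.injective ?_⟩
      exact hw.choose_spec.trans e.symm
    · exact ⟨fun e => absurd e.symm hx, fun e => absurd ⟨x, e⟩ hw⟩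
  · obtain ⟨u, v, huv, rfl, rfl⟩ := withIsolated_adj.1 hxy
    rw [hφ, hφ]
    exact φ.toHom.map_adj huv

end Components

/-! ### Correctness of the algorithm -/

section Determinant

theorem entry₂_table₂ {n : ℕ} (f : ℕ → ℕ → ℕ) {i j : ℕ} (hi : i < n) (hj : j < n) :
    entry₂ (table₂ n f) i j = f i j := by
  rw [entry₂, table₂, getD_map_range _ _ hi, getD_map_range _ _ hj]

/-- The matrix over `ZMod m` given by a list of rows. -/
def zmodMatrix (m n : ℕ) (M : List (List ℕ)) : Matrix (Fin n) (Fin n) (ZMod m) :=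
  Matrix.of fun i j => (entry₂ M i j : ZMod m)

/-- Programs work with natural numbers, so multiplication by `p` replaces a change of sign in
`birdMod` and `Env.sign`. -/
theorem natCast_pred (p : ℕ) : (p : ZMod (p + 1)) = -1 := by
  rw [eq_neg_iff_add_eq_zero]
  exact_mod_cast ZMod.natCast_self (p + 1)

theorem zmodMatrix_birdMod (p n : ℕ) (M X : List (List ℕ)) :
    zmodMatrix (p + 1) n (birdMod p n M X)
      = birdStep (zmodMatrix (p + 1) n M) (zmodMatrix (p + 1) n X) := by
  ext i j
  simp only [zmodMatrix, birdStep, Matrix.of_apply, birdMod]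
  rw [entry₂_table₂ _ i.2 j.2, ZMod.natCast_mod, Nat.cast_sum, Finset.sum_range]
  refine Finset.sum_congr rfl fun r _ => ?_
  rw [Nat.cast_mul]
  congr 1
  simp only [Fin.ext_iff, Fin.lt_def]
  split_ifs
  · rw [Nat.cast_sum, Finset.sum_range]
    refine Finset.sum_congr rfl fun s _ => ?_
    split_ifs <;> simp
  · rw [Nat.cast_mul, natCast_pred, neg_one_mul]
  · simp

theorem natCast_detMod (p n : ℕ) (M : List (List ℕ)) :
    (detMod p (n + 1) M : ZMod (p + 1)) = (zmodMatrix (p + 1) (n + 1) M).det := by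
  have h : ∀ d X, zmodMatrix (p + 1) (n + 1) ((birdMod p (n + 1) M)^[d] X)
      = (birdStep (zmodMatrix (p + 1) (n + 1) M))^[d] (zmodMatrix (p + 1) (n + 1) X) := by
    intro d
    induction d with
    | zero => intro X; rfl
    | succ d ih => intro X; rw [Function.iterate_succ_apply, Function.iterate_succ_apply, ih,
        zmodMatrix_birdMod]
  rw [← birdStep_iterate_eq_det, ← h]
  rfl

end Determinant

theorem natCast_foldn_mul_mod (p n : ℕ) (P : ℕ → Prop) [DecidablePred P] (f : ℕ → ℕ) :
    ((foldn n (fun i s => if P i then s * f i % (p + 1) else s) 1 : ℕ) : ZMod (p + 1))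
      = ∏ i ∈ Finset.range n, if P i then (f i : ZMod (p + 1)) else 1 := by
  induction n with
  | zero => simp [foldn]
  | succ n ih =>
    rw [foldn, Finset.prod_range_succ, ← ih]
    split_ifs <;> simp

/-- The number of the component of a vertex; the additional vertex gets an irrelevant number. -/
def compFun (A : BoolMat) (n : ℕ) (x : Fin (n + 1)) : ℕ := compIndex A x

/-- The least vertices of the components. -/
def repSet (A : BoolMat) (n : ℕ) : Finset (Fin n) := Finset.univ.filter fun w => IsRep A w

namespace Env

variable {h g : ℕ} {H : SimpleGraph (Fin h)} {G : SimpleGraph (Fin g)} {e : Env}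

/-- The point at which the polynomial is evaluated. -/
def evalPoint (e : Env) (h g : ℕ) (x : Fin (h + 1)) (w : Fin g) : ZMod (e.pred + 1) :=
  (e.point x w : ZMod (e.pred + 1))

/-- The values that the table contains after `d` rounds. -/
noncomputable def tableValue (e : Env) (H : SimpleGraph (Fin h)) (G : SimpleGraph (Fin g))
    (t d : ℕ) : Fin (h + 1) → Fin (h + 1) → Fin g → Fin g → ZMod (e.pred + 1) :=
  arcValue G (withIsolated H) (e.evalPoint h g)
    (fun x w => rootFun (Fin.last h) (compFun e.matH h) (e.evalPoint h g) x w t) d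

theorem natCast_rootPoint (hH : Represents e.matH H) (t : ℕ) (x : Fin (h + 1)) (w : Fin g) :
    (e.rootPoint t x w : ZMod (e.pred + 1))
      = rootFun (Fin.last h) (compFun e.matH h) (e.evalPoint h g) x w t := by
  have hl : e.h = h := hH.length
  simp only [rootPoint, rootFun, evalPoint, compFun, Fin.ext_iff, Fin.val_last, hl]
  split_ifs <;> simp_all

theorem natCast_freeValue (hH : Represents e.matH H) (t d : ℕ) (T : List (List (List (List ℕ))))
    (hT : ∀ (a x : Fin (h + 1)) (v w : Fin g),
      (entry₄ T a x v w : ZMod (e.pred + 1)) = e.tableValue H G t d a x v w) (v w : Fin g) :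
    (e.freeValue t T v w : ZMod (e.pred + 1)) = branchValue G (withIsolated H) (e.evalPoint h g)
      (fun x w => rootFun (Fin.last h) (compFun e.matH h) (e.evalPoint h g) x w t) d v w := by
  have hl : e.h = h := hH.length
  rw [freeValue, ZMod.natCast_mod, hl, Nat.cast_sum, Finset.sum_range, branchValue]
  refine Finset.sum_congr rfl fun x _ => ?_
  rw [Nat.cast_mul, hT, natCast_rootPoint hH]
  rfl

theorem succH_iff (hH : Represents e.matH H) (a x y : Fin (h + 1)) :
    e.succH a x y ↔ (withIsolated H).Adj x y ∧ y ≠ a := by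
  rw [succH, hH.withIsolated_adj_iff, Ne, Ne, Fin.ext_iff]

theorem succG_iff (hG : Represents e.matG G) (v w i : Fin g) :
    e.succG v w i ↔ G.Adj w i ∧ i ≠ v := by
  rw [succG, hG.adj_iff, Ne, Ne, Fin.ext_iff]

-- Indices below `g` are host vertices and the others are pattern vertices shifted by `g`, as in
-- `finSumFinEquiv`.
open Classical in
theorem natCast_detMod_matchEntry (hH : Represents e.matH H) (hG : Represents e.matG G) (t d : ℕ)
    (T : List (List (List (List ℕ)))) (hT : ∀ (a x : Fin (h + 1)) (v w : Fin g),
      (entry₄ T a x v w : ZMod (e.pred + 1)) = e.tableValue H G t d a x v w)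
    (a x : Fin (h + 1)) (v w : Fin g) :
    (detMod e.pred (g + (h + 1)) (table₂ (g + (h + 1)) fun i j => e.matchEntry t T a x v w i j) :
      ZMod (e.pred + 1)) = e.tableValue H G t (d + 1) a x v w := by
  have hg : e.g = g := hG.length
  rw [tableValue, arcValue_succ, show g + (h + 1) = (g + h) + 1 from rfl, natCast_detMod,
    ← Matrix.det_submatrix_equiv_self (finSumFinEquiv : Fin g ⊕ Fin (h + 1) ≃ _)]
  have key : (zmodMatrix (e.pred + 1) (g + h + 1) (table₂ (g + h + 1) fun i j =>
      e.matchEntry t T a x v w i j)).submatrix (finSumFinEquiv : Fin g ⊕ Fin (h + 1) ≃ _)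
        (finSumFinEquiv : Fin g ⊕ Fin (h + 1) ≃ _) = matchMatrix G (withIsolated H) (e.evalPoint h g)
      (e.tableValue H G t d) (branchValue G (withIsolated H) (e.evalPoint h g)
      (fun x w => rootFun (Fin.last h) (compFun e.matH h) (e.evalPoint h g) x w t) d) a x v w := by
    ext i j
    rw [Matrix.submatrix_apply, zmodMatrix, Matrix.of_apply,
      entry₂_table₂ _ (Fin.is_lt _) (Fin.is_lt _)]
    rcases i with i | i <;> rcases j with j | j
    · simp only [finSumFinEquiv_apply_left, Fin.val_castAdd, matchEntry, hg, i.2, j.2, if_true,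
        matchMatrix, Matrix.of_apply, succG_iff hG, ← Fin.ext_iff]
      split_ifs
      · exact natCast_freeValue hH t d T hT w i
      · simp
      · simp
    · have : ¬ (g + j.1 < g) := by omega
      simp only [finSumFinEquiv_apply_left, finSumFinEquiv_apply_right, Fin.val_castAdd,
        Fin.val_natAdd, matchEntry, hg, i.2, if_true, this, if_false, Nat.add_sub_cancel_left,
        matchMatrix, Matrix.of_apply, succG_iff hG, succH_iff hH]
      split_ifs
      · rw [Nat.cast_mul, hT]; rfl
      · simp
    · have : ¬ (g + i.1 < g) := by omega
      simp only [finSumFinEquiv_apply_left, finSumFinEquiv_apply_right, Fin.val_castAdd,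
        Fin.val_natAdd, matchEntry, hg, j.2, if_true, this, if_false, Nat.add_sub_cancel_left,
        matchMatrix, Matrix.of_apply, succG_iff hG, succH_iff hH]
      split_ifs
      · rfl
      · simp
    · have h1 : ¬ (g + i.1 < g) := by omega
      have h2 : ¬ (g + j.1 < g) := by omega
      simp only [finSumFinEquiv_apply_right,
        Fin.val_natAdd, matchEntry, hg, h1, h2, if_false, Nat.add_sub_cancel_left,
        matchMatrix, Matrix.of_apply, succH_iff hH, Nat.add_left_cancel_iff, ← Fin.ext_iff]
      split_ifs <;> simp
  rw [key]
  unfold tableValue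
  convert rfl

/-- The empty initial table reads as zero everywhere, which is the value at depth zero; each round
adds one to the depth. -/
theorem natCast_entry₄ (hH : Represents e.matH H) (hG : Represents e.matG G) (t d : ℕ)
    (a x : Fin (h + 1)) (v w : Fin g) :
    (entry₄ ((e.tableStep t)^[d] []) a x v w : ZMod (e.pred + 1))
      = e.tableValue H G t d a x v w := by
  have hh : e.h = h := hH.length
  have hg : e.g = g := hG.length
  induction d generalizing a x v w with
  | zero => simp [entry₄, tableValue, arcValue]
  | succ d ih =>
    rw [Function.iterate_succ_apply', tableStep, entry₄, hh, hg, getD_map_range _ _ a.2,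
      getD_map_range _ _ x.2, getD_map_range _ _ v.2, getD_map_range _ _ w.2, ZMod.natCast_mod]
    exact natCast_detMod_matchEntry hH hG t d _ ih a x v w

theorem natCast_total (hH : Represents e.matH H) (hG : Represents e.matG G) (t : ℕ) :
    (e.total t : ZMod (e.pred + 1)) = ∏ w ∈ repSet e.matG g, branchValue G (withIsolated H)
      (e.evalPoint h g) (fun x w => rootFun (Fin.last h) (compFun e.matH h) (e.evalPoint h g) x w t)
      (Fintype.card (Fin g)) w w := by
  have hg : e.g = g := hG.length
  rw [total, natCast_foldn_mul_mod, hg, Finset.prod_range, repSet, Finset.prod_filter]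
  refine Finset.prod_congr rfl fun w _ => ?_
  rw [valueTable, hg, Fintype.card_fin, natCast_freeValue hH t g _ (natCast_entry₄ hH hG t g)]

theorem natCast_sign (hH : Represents e.matH H) (t : ℕ) :
    (e.sign t : ZMod (e.pred + 1)) = setSign _ (countReps e.matH h) t := by
  have hh : e.h = h := hH.length
  have := natCast_foldn_mul_mod e.pred (countReps e.matH h) (fun j => ¬ t.testBit j = true)
    fun _ => e.pred
  simp only [ite_not] at this
  rw [sign, hh, setSign, this, natCast_pred]

theorem natCast_result (hH : Represents e.matH H) (hG : Represents e.matG G)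
    (hs : e.sets = 2 ^ countReps e.matH h) :
    (e.result : ZMod (e.pred + 1)) = altSum G (withIsolated H) (Fin.last h) (compFun e.matH h)
      (countReps e.matH h) (repSet e.matG g) (e.evalPoint h g) := by
  rw [result, ZMod.natCast_mod, hs, Nat.cast_sum, altSum]
  refine Finset.sum_congr rfl fun t _ => ?_
  rw [Nat.cast_mul, natCast_sign hH, natCast_total hH hG]

theorem natCast_point (x w : ℕ) : (e.point x w : ZMod (e.pred + 1))
    = (ofBitFun e.width (fun j => e.bits.getD ((x * e.g + w) * e.width + j) false) :
      ZMod (e.pred + 1)) := by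
  rw [point, ofBitFun]
  have : ∀ n, ((foldn n (fun i s =>
      (s + s + if e.bits.getD ((x * e.g + w) * e.width + i) false then 1 else 0) % (e.pred + 1)) 0 :
      ℕ) : ZMod (e.pred + 1)) = (foldn n (fun i s =>
      s + s + if e.bits.getD ((x * e.g + w) * e.width + i) false then 1 else 0) 0 : ℕ) := by
    intro n
    induction n with
    | zero => rfl
    | succ n ih =>
      rw [foldn, foldn, ZMod.natCast_mod, Nat.cast_add, Nat.cast_add, ih]
      push_cast
      rfl
  exact this _

theorem result_eq_zero_iff (hH : Represents e.matH H) (hG : Represents e.matG G)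
    (hs : e.sets = 2 ^ countReps e.matH h) {q b : ℕ} (hq : e.pred = q) (hb : e.width = b) :
    e.result = 0 ↔ altSum G (withIsolated H) (Fin.last h) (compFun e.matH h) (countReps e.matH h)
      (repSet e.matG g) (fun x w => (ofBitFun b (fun j =>
        e.bits.getD ((x.1 * g + w.1) * b + j) false) : ZMod (q + 1))) = 0 := by
  subst hq hb
  have hg : e.g = g := hG.length
  have hp : (fun (x : Fin (h + 1)) (w : Fin g) => (ofBitFun e.width (fun j =>
      e.bits.getD ((x.1 * g + w.1) * e.width + j) false) : ZMod (e.pred + 1)))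
      = e.evalPoint h g := by
    funext x w
    rw [evalPoint, natCast_point, hg]
  rw [hp, ← natCast_result hH hG hs, ZMod.natCast_eq_zero_iff]
  refine ⟨fun h => h ▸ dvd_zero _, fun h => Nat.eq_zero_of_dvd_of_lt h ?_⟩
  -- The result is reduced modulo `e.pred + 1`, so its residue vanishes only if the number does.
  exact Nat.mod_lt _ e.pred.succ_pos

end Env

/-! ### The polynomial that is tested -/

section TestPoly

open MvPolynomial

variable {h g : ℕ} {H : SimpleGraph (Fin h)} {G : SimpleGraph (Fin g)} {A B : BoolMat}

theorem exists_castSucc_eq {n : ℕ} {x : Fin (n + 1)} (hx : x ≠ Fin.last n) :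
    ∃ i : Fin n, i.castSucc = x := ⟨x.castPred hx, Fin.castSucc_castPred x hx⟩

namespace Represents

theorem compFun_eq_of_adj (hA : Represents A H) (x y : Fin (h + 1))
    (hxy : (withIsolated H).Adj x y) : compFun A h x = compFun A h y := by
  obtain ⟨u, v, huv, rfl, rfl⟩ := withIsolated_adj.1 hxy
  exact hA.compIndex_eq_of_reachable huv.reachable

theorem reachable_of_compFun_eq (hA : Represents A H) (x y : Fin (h + 1)) (hx : x ≠ Fin.last h)
    (hy : y ≠ Fin.last h) (e : compFun A h x = compFun A h y) :
    (withIsolated H).Reachable x y := by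
  obtain ⟨u, rfl⟩ := exists_castSucc_eq hx
  obtain ⟨v, rfl⟩ := exists_castSucc_eq hy
  let φ : H →g withIsolated H := ⟨Fin.castSucc, withIsolated_adj_castSucc.2⟩
  exact (hA.reachable_of_compIndex_eq e).map φ

theorem compFun_lt (hA : Represents A H) (x : Fin (h + 1)) (hx : x ≠ Fin.last h) :
    compFun A h x < countReps A h := by
  obtain ⟨u, rfl⟩ := exists_castSucc_eq hx
  exact hA.compIndex_lt u

theorem eq_of_mem_repSet (hB : Represents B G) :
    ∀ w ∈ repSet B g, ∀ w' ∈ repSet B g, G.Reachable w w' → w = w' := fun _ hw _ hw' hr =>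
  hB.eq_of_isRep (Finset.mem_filter.1 hw).2 (Finset.mem_filter.1 hw').2 hr

theorem isContained_of_altSum_ne_zero {K : Type*} [CommRing K] (hA : Represents A H)
    (hB : Represents B G) (hG : G.IsAcyclic) {ξ : Fin (h + 1) → Fin g → K}
    (hne : altSum G (withIsolated H) (Fin.last h) (compFun A h) (countReps A h) (repSet B g) ξ
      ≠ 0) : H.IsContained G := by
  rcases exists_embedsOn hG.noReturn hA.compFun_eq_of_adj hA.reachable_of_compFun_eq
    hA.compFun_lt ξ _ _ hB.eq_of_mem_repSet hne with h0 | ⟨η, hη⟩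
  -- Only the additional vertex exists, so the pattern is empty.
  · have : ∀ i : Fin h, False := fun i => Fin.castSucc_ne_last i (h0 _)
    exact ⟨⟨⟨fun i => (this i).elim, fun {i} => (this i).elim⟩, fun i => (this i).elim⟩⟩
  · exact isContained_of_embedsOn hη

end Represents

/-- The alternating sum with a variable for each pair of vertices. -/
noncomputable def testPoly (K : Type*) [CommRing K] (A B : BoolMat) (H : SimpleGraph (Fin h))
    (G : SimpleGraph (Fin g)) : MvPolynomial (Fin ((h + 1) * g)) K :=
  altSum G (withIsolated H) (Fin.last h) (compFun A h) (countReps A h) (repSet B g)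
    fun x w => X (finProdFinEquiv (x, w))

variable {K : Type*}

theorem eval_testPoly [CommRing K] (ξ : Fin ((h + 1) * g) → K) : eval ξ (testPoly K A B H G) =
    altSum G (withIsolated H) (Fin.last h) (compFun A h) (countReps A h) (repSet B g)
      fun x w => ξ (finProdFinEquiv (x, w)) := by
  rw [testPoly, map_altSum]
  simp only [eval_X]

theorem totalDegree_testPoly_le [CommRing K] [Nontrivial K] (hB : Represents B G)
    (hG : G.IsAcyclic) : (testPoly K A B H G).totalDegree ≤ (g + (h + 1) + 1) * g := by
  have := totalDegree_altSum_le (H := withIsolated H) hG.noReturn (Fin.last h) (compFun A h)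
    (countReps A h) hB.eq_of_mem_repSet
    (fun x w => (X (finProdFinEquiv (x, w)) : MvPolynomial (Fin ((h + 1) * g)) K))
    fun x w => (totalDegree_X _).le
  rw [Fintype.card_fin, Fintype.card_fin] at this
  exact this

theorem testPoly_ne_zero [CommRing K] [Nontrivial K] (hA : Represents A H) (hB : Represents B G)
    (hG : G.IsAcyclic) (hc : H.IsContained G) : testPoly K A B H G ≠ 0 := by
  rcases Nat.eq_zero_or_pos g with rfl | hg
  -- Without host vertices the pattern is empty as well, and the polynomial is the constant `1`.
  · obtain ⟨φ⟩ := hc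
    obtain rfl : h = 0 := by
      by_contra hh
      exact (φ ⟨0, Nat.pos_of_ne_zero hh⟩).elim0
    simp [testPoly, altSum, countReps, setSign, Finset.eq_empty_of_isEmpty (repSet B 0)]
  · have : NeZero g := ⟨hg.ne'⟩
    obtain ⟨η, f, hp⟩ := exists_placement hc
    have hne := altSum_place_ne_zero (K := K) hG.noReturn hp hA.compFun_eq_of_adj
      (k := countReps A h) (fun j hj => by
        obtain ⟨v, hv⟩ := exists_compIndex_eq hj
        exact ⟨v.castSucc, Fin.castSucc_ne_last v, hv⟩) (s := repSet B g) (fun v => by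
        obtain ⟨w, hw, hr⟩ := hB.exists_isRep v
        exact ⟨w, Finset.mem_filter.2 ⟨Finset.mem_univ _, hw⟩, hr⟩) hA.compFun_lt
    intro h0
    apply hne
    have := eval_testPoly (A := A) (B := B) (H := H) (G := G) (K := K) fun i =>
      placePoint f (fun _ => 1) (finProdFinEquiv.symm i).1 (finProdFinEquiv.symm i).2
    simp only [Equiv.symm_apply_apply] at this
    rw [← this, h0, map_zero]

end TestPoly

/-! ### The main result -/

/-- The answer of a program is determined by the input and the coin outcomes. -/
theorem Eval.unique {p : Prog} {x y y' : Data} {r s s' : List Bool} {t t' : ℕ}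
    (h : Eval p x r y s t) (h' : Eval p x r y' s' t') : y = y' ∧ s = s' := by
  induction h generalizing y' s' t' with
  | id => cases h'; exact ⟨rfl, rfl⟩
  | nil => cases h'; exact ⟨rfl, rfl⟩
  | fst => cases h'; exact ⟨rfl, rfl⟩
  | snd => cases h'; exact ⟨rfl, rfl⟩
  | flip => cases h'; exact ⟨rfl, rfl⟩
  | pair _ _ ih₁ ih₂ =>
    cases h' with
    | pair k₁ k₂ =>
      obtain ⟨rfl, rfl⟩ := ih₁ k₁
      obtain ⟨rfl, rfl⟩ := ih₂ k₂
      exact ⟨rfl, rfl⟩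
  | seq _ _ ih₁ ih₂ =>
    cases h' with
    | seq k₁ k₂ =>
      obtain ⟨rfl, rfl⟩ := ih₁ k₁
      exact ih₂ k₂
  | ite_true _ hv _ ih₁ ih₂ =>
    cases h' with
    | ite_true k₁ _ k₂ =>
      obtain ⟨rfl, rfl⟩ := ih₁ k₁
      exact ih₂ k₂
    | ite_false k₁ _ => exact absurd (ih₁ k₁).1 hv
  | ite_false _ _ ih₁ ih₂ =>
    cases h' with
    | ite_true k₁ hv _ => exact absurd (ih₁ k₁).1.symm hv
    | ite_false k₁ k₂ =>
      obtain ⟨-, rfl⟩ := ih₁ k₁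
      exact ih₂ k₂
  | loop_done _ ih =>
    cases h' with
    | loop_done k => exact ⟨rfl, (ih k).2⟩
    | loop_step k hv _ _ => exact absurd (ih k).1.symm hv
  | loop_step _ hv _ _ ih₁ ih₂ ih₃ =>
    cases h' with
    | loop_done k => exact absurd (ih₁ k).1 hv
    | loop_step k₁ _ k₂ k₃ =>
      obtain ⟨rfl, rfl⟩ := ih₁ k₁
      obtain ⟨rfl, rfl⟩ := ih₂ k₂
      exact ih₃ k₃

theorem getD_reverse_take_ofFn {T L : ℕ} (hL : L ≤ T) (r : Fin T → Bool) (i : Fin T)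
    (hi : i.1 < L) : (((List.ofFn r).take L).reverse).getD (L - 1 - i.1) false = r i := by
  have h : ((List.ofFn r).take L).length = L := by simp [hL]
  rw [List.getD_eq_getElem _ _ (by rw [List.length_reverse, h]; omega), List.getElem_reverse]
  simp only [List.getElem_take, List.getElem_ofFn]
  congr 1
  ext
  simp only [h]
  omega

theorem mu_adjMat_le {n : ℕ} (G : SimpleGraph (Fin n)) : Enc.mu (adjMat G) ≤ n * (n + 1) := by
  have hrow : ∀ f : Fin n → Bool, Enc.mu (List.ofFn f) ≤ n := fun f => by
    rw [List.ofFn_eq_map]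
    exact (PT.mu_map_le f (List.finRange n) 0 fun _ _ => le_rfl).trans (by simp)
  rw [adjMat, List.ofFn_eq_map]
  refine (PT.mu_map_le _ (List.finRange n) n fun _ _ => hrow _).trans ?_
  rw [List.length_finRange]

/-- For `k ≥ 2` the logarithm is at least one; the factor two is needed for `k = 1`, where it is
zero. -/
theorem two_pow_le_mul_rpow (k : ℕ) :
    (2 : ℝ) ^ k ≤ 2 * (2 : ℝ) ^ ((k : ℝ) * Real.logb 2 (k : ℝ)) := by
  rcases Nat.lt_or_ge k 2 with hk | hk
  · interval_cases k <;> norm_num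
  · have hk' : (2 : ℝ) ≤ k := by exact_mod_cast hk
    have hlog : 1 ≤ Real.logb 2 (k : ℝ) := by
      rw [Real.le_logb_iff_rpow_le (by norm_num) (by linarith), Real.rpow_one]
      exact hk'
    calc (2 : ℝ) ^ k = (2 : ℝ) ^ (k : ℝ) := (Real.rpow_natCast 2 k).symm
      _ ≤ (2 : ℝ) ^ ((k : ℝ) * Real.logb 2 (k : ℝ)) :=
        Real.rpow_le_rpow_of_exponent_le (by norm_num) (by nlinarith)
      _ ≤ _ := by
        have : 0 ≤ (2 : ℝ) ^ ((k : ℝ) * Real.logb 2 (k : ℝ)) := by positivity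
        linarith

/-- The running time. -/
def timeBound (c k n : ℕ) : ℕ := if n < 2 then 0 else (2 ^ k + 2 * (n * (n + 1)) + 2) ^ c

theorem mul_logb_nonneg (k : ℕ) : 0 ≤ (k : ℝ) * Real.logb 2 (k : ℝ) := by
  rcases Nat.eq_zero_or_pos k with rfl | hk
  · simp
  · exact mul_nonneg (Nat.cast_nonneg _)
      (Real.logb_nonneg (by norm_num) (by exact_mod_cast hk))

theorem exists_timeBound_le (c : ℕ) : ∃ d : ℕ, ∀ k n : ℕ, (timeBound c k n : ℝ) ≤
    (d : ℝ) * (2 : ℝ) ^ ((d : ℝ) * ((k : ℝ) * Real.logb 2 (k : ℝ))) * (n : ℝ) ^ d := by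
  -- The summand `2 ^ c` absorbs the constant factor, and `5 * c` is the degree in `n`; the sum also
  -- exceeds `c`, the factor of the exponent. For `n < 2` the time bound was set to zero because the
  -- right-hand side may vanish there.
  refine ⟨2 ^ c + 5 * c, fun k n => ?_⟩
  rw [timeBound]
  split_ifs with hn
  · rw [Nat.cast_zero]
    positivity
  push Not at hn
  have h1 : 2 ^ k + 2 * (n * (n + 1)) + 2 ≤ 2 ^ k * n ^ 5 := by
    have h2 : 2 * (n * (n + 1)) + 2 ≤ n ^ 4 := by
      obtain ⟨m, rfl⟩ := Nat.exists_eq_add_of_le hn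
      ring_nf
      nlinarith [Nat.zero_le m, sq_nonneg m]
    have h3 : 1 ≤ 2 ^ k := Nat.one_le_two_pow
    have h4 : 1 ≤ n ^ 4 := Nat.one_le_pow _ _ (by omega)
    have h5 : 2 ^ k * n ^ 5 = n * (2 ^ k * n ^ 4) := by ring
    rw [h5]
    nlinarith [Nat.mul_le_mul h3 h4, Nat.mul_le_mul_left (2 ^ k * n ^ 4) hn]
  have h2 : ((2 ^ k + 2 * (n * (n + 1)) + 2) ^ c : ℕ) ≤ (2 ^ k * n ^ 5) ^ c :=
    Nat.pow_le_pow_left h1 c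
  set E : ℝ := (k : ℝ) * Real.logb 2 (k : ℝ) with hE
  have hE0 : 0 ≤ E := mul_logb_nonneg k
  have hn1 : (1 : ℝ) ≤ n := by exact_mod_cast (by omega : 1 ≤ n)
  have h2' : (((2 ^ k + 2 * (n * (n + 1)) + 2) ^ c : ℕ) : ℝ)
      ≤ ((2 : ℝ) ^ k * (n : ℝ) ^ 5) ^ c := by exact_mod_cast h2
  have h3 : ((2 : ℝ) ^ k) ^ c ≤ 2 ^ c * (2 : ℝ) ^ ((c : ℝ) * E) := by
    calc ((2 : ℝ) ^ k) ^ c ≤ (2 * (2 : ℝ) ^ E) ^ c := by gcongr; exact two_pow_le_mul_rpow k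
      _ = _ := by rw [mul_pow, ← Real.rpow_mul_natCast (by norm_num), mul_comm E]
  have hcd : (c : ℝ) ≤ ((2 ^ c + 5 * c : ℕ) : ℝ) := by
    exact_mod_cast Nat.le_add_left_of_le (Nat.le_mul_of_pos_left c (by norm_num))
  calc (((2 ^ k + 2 * (n * (n + 1)) + 2) ^ c : ℕ) : ℝ) ≤ ((2 : ℝ) ^ k * (n : ℝ) ^ 5) ^ c := h2'
    _ = ((2 : ℝ) ^ k) ^ c * (n : ℝ) ^ (5 * c) := by rw [mul_pow, pow_mul]
    _ ≤ (2 ^ c * (2 : ℝ) ^ ((c : ℝ) * E)) * (n : ℝ) ^ (5 * c) := by gcongr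
    _ ≤ _ := by
      refine mul_le_mul (mul_le_mul ?_ ?_ (by positivity) (by positivity)) ?_ (by positivity)
        (by positivity)
      · push_cast
        have : (0 : ℝ) ≤ c := Nat.cast_nonneg c
        linarith
      · exact Real.rpow_le_rpow_of_exponent_le (by norm_num) (by gcongr)
      · exact pow_le_pow_right₀ hn1 (Nat.le_add_left _ _)

/-- The computation with the coin outcomes `l`. -/
noncomputable def testEnv {h g : ℕ} (H : SimpleGraph (Fin h)) (G : SimpleGraph (Fin g))
    (l : List Bool) : Env := ((Inp.params ⟨adjMat H, adjMat G⟩).1, l)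

/-! ### The test on encoded graphs. -/

section TestEnv

variable {h g : ℕ} {H : SimpleGraph (Fin h)} {G : SimpleGraph (Fin g)}

theorem testEnv_sets (l : List Bool) :
    (testEnv H G l).sets = 2 ^ countReps (adjMat H) h := by
  have : (adjMat H).length = h := (represents_adjMat H).length
  show foldn (countReps (adjMat H) (adjMat H).length) (fun _ s => s + s) 1 = _
  rw [foldn_double, this]

theorem isContained_of_result_ne_zero (hG : G.IsAcyclic) {l : List Bool}
    (hl : (testEnv H G l).result ≠ 0) : H.IsContained G := by
  rw [Ne, Env.result_eq_zero_iff (e := testEnv H G l) (represents_adjMat H) (represents_adjMat G)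
    (testEnv_sets l) rfl rfl] at hl
  exact (represents_adjMat H).isContained_of_altSum_ne_zero (represents_adjMat G) hG hl

/-- Schwartz-Zippel for `testPoly` over `ZMod (q + 1)`. Since `2 * D + 1 ≤ 2 ^ b ≤ q`, the numbers
of `b` bits are distinct residues and at least twice as many as the degree. -/
theorem card_result_eq_zero_le (hG : G.IsAcyclic) (hc : H.IsContained G) {T L : ℕ}
    (hL : L = (Inp.params ⟨adjMat H, adjMat G⟩).2) (hT : L ≤ T) :
    2 * Nat.card {r : Fin T → Bool //
      (testEnv H G ((List.ofFn r).take L).reverse).result = 0} ≤ 2 ^ T := by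
  have lenH : (adjMat H).length = h := (represents_adjMat H).length
  have lenG : (adjMat G).length = g := (represents_adjMat G).length
  set D := (g + (h + 1) + 1) * g with hD
  have hdeg : Inp.degBound ⟨adjMat H, adjMat G⟩ = 2 * D + 1 := by
    simp only [Inp.degBound, lenH, lenG, hD]
  obtain ⟨b, hb⟩ : ∃ b, b = (widthPow (2 * D + 1)).1 := ⟨_, rfl⟩
  obtain ⟨q, hq⟩ : ∃ q, q = primePred (widthPow (2 * D + 1)).2 := ⟨_, rfl⟩
  have hb2 : (widthPow (2 * D + 1)).2 = 2 ^ b := by rw [hb, widthPow_snd]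
  have hDb : 2 * D + 1 ≤ 2 ^ b := hb2 ▸ le_widthPow _
  have hspec := primePred_spec (Q := (widthPow (2 * D + 1)).2) (by rw [hb2]; positivity)
  rw [← hq, hb2] at hspec
  have hLb : (h + 1) * g * b = L := by
    rw [hL, Inp.params, hdeg]
    simp only [lenH, lenG, hb]
  have hpred : ∀ l, (testEnv H G l).pred = q := fun l => by
    show primePred (widthPow (Inp.degBound ⟨adjMat H, adjMat G⟩)).2 = q
    rw [hdeg, hq]
  have hwidth : ∀ l, (testEnv H G l).width = b := fun l => by
    show (widthPow (Inp.degBound ⟨adjMat H, adjMat G⟩)).1 = b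
    rw [hdeg, hb]
  have : Fact (q + 1).Prime := ⟨hspec.2⟩
  have key := card_eval_eq_zero_le (K := ZMod (q + 1)) (n := (h + 1) * g) (b := b) (D := D)
    (T := T) (by omega) (testPoly_ne_zero (represents_adjMat H) (represents_adjMat G) hG hc)
    (totalDegree_testPoly_le (represents_adjMat G) hG) (by omega)
    (fun i hi j hj hij => by
      rw [ZMod.natCast_eq_natCast_iff', Nat.mod_eq_of_lt (by omega), Nat.mod_eq_of_lt (by omega)]
        at hij
      exact hij)
    (fun r i => (((List.ofFn r).take L).reverse).getD i false)
    (fun r r' hrr i hi => by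
      rw [hLb] at hi hrr
      rw [← getD_reverse_take_ofFn hT r i hi, ← getD_reverse_take_ofFn hT r' i hi]
      exact hrr _ (by omega))
  refine le_trans (Nat.mul_le_mul_left 2 (le_of_eq (Nat.card_congr
    (Equiv.subtypeEquivRight fun r => ?_)))) key
  rw [Env.result_eq_zero_iff (e := testEnv H G _) (represents_adjMat H) (represents_adjMat G)
    (testEnv_sets _) (hpred _) (hwidth _), eval_testPoly]
  -- The variable of `(x, w)` has number `w + g * x`, which is the block of coins read by
  -- `Env.point`.
  simp only [finProdFinEquiv_apply_val, Nat.add_comm, Nat.mul_comm g]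
  rfl

end TestEnv

/-- Subgraph isomorphism for forests as hosts is decided by a randomized algorithm with false
negatives whose running time depends polynomially on the number of vertices and at most
exponentially on the number of components of the pattern. -/
theorem mainTheorem6 :
    ∃ (p : Prog) (T : ℕ → ℕ → ℕ) (c : ℕ),
      (∀ k n : ℕ, (T k n : ℝ) ≤
        (c : ℝ) * (2 : ℝ) ^ ((c : ℝ) * ((k : ℝ) * Real.logb 2 (k : ℝ))) * (n : ℝ) ^ c) ∧
      ∀ (h g : ℕ) (H : SimpleGraph (Fin h)) (G : SimpleGraph (Fin g)), G.IsAcyclic →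
        p.DecidesWithFalseNegatives (Data.cons (encodeGraph H) (encodeGraph G))
          (H.IsContained G) (T (cc H) (max 2 (h + g))) := by
  obtain ⟨p, T, ⟨c, hT⟩, hL, hrun⟩ := PT.exists_randomized PT.params
    (B := fun e : Env => decide (¬ e.result = 0)) (by fun_prop)
  obtain ⟨d, hd⟩ := exists_timeBound_le c
  refine ⟨p, timeBound c, d, hd, fun h g H G hG => ?_⟩
  set N := timeBound c (cc H) (max 2 (h + g)) with hN
  set i : Inp := ⟨adjMat H, adjMat G⟩ with hi
  have hmu : Enc.mu i + 2 ≤ 2 ^ cc H + 2 * (max 2 (h + g) * (max 2 (h + g) + 1)) + 2 := by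
    have e : Enc.mu i = 2 ^ countReps (adjMat H) (adjMat H).length
      + (Enc.mu (adjMat H) + Enc.mu (adjMat G)) := rfl
    have hh : h ≤ max 2 (h + g) := by omega
    have hg : g ≤ max 2 (h + g) := by omega
    have h1 := (mu_adjMat_le H).trans (Nat.mul_le_mul hh (Nat.succ_le_succ hh))
    have h2 := (mu_adjMat_le G).trans (Nat.mul_le_mul hg (Nat.succ_le_succ hg))
    rw [e, (represents_adjMat H).length, ← (represents_adjMat H).cc_eq]
    simp only [Nat.succ_eq_add_one] at h1 h2
    omega
  have hTN : T i ≤ N := by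
    rw [hN, timeBound, if_neg (by omega)]
    exact (hT i).trans (Nat.pow_le_pow_left hmu c)
  have henc : Data.cons (encodeGraph H) (encodeGraph G) = Enc.enc i := by
    rw [← enc_adjMat, ← enc_adjMat]
    rfl
  have hLN : i.params.2 ≤ N := (hL i).trans hTN
  have hans : ∀ r : Fin N → Bool, p.Answers (Enc.enc i) N (List.ofFn r)
      (decide (¬ (testEnv H G ((List.ofFn r).take i.params.2).reverse).result = 0)) := fun r => by
    obtain ⟨t, ht, he⟩ := hrun i (List.ofFn r) (by rw [List.length_ofFn]; exact hLN)
    exact ⟨_, t, ht.trans hTN, he⟩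
  rw [henc]
  refine ⟨fun r => ⟨_, hans r⟩, fun hQ r => ?_, fun hQ => ?_⟩
  · have h0 : (testEnv H G ((List.ofFn r).take i.params.2).reverse).result = 0 := by
      by_contra hne
      exact hQ (isContained_of_result_ne_zero hG hne)
    simpa only [h0, not_true_eq_false, decide_false] using hans r
  · have hcard := card_result_eq_zero_le hG hQ rfl hLN
    -- Evaluation is deterministic once the coins are fixed, so the answer NO forces the result to
    -- be zero.
    have hle : Nat.card {r : Fin N → Bool // p.Answers (Enc.enc i) N (List.ofFn r) false}
        ≤ Nat.card {r : Fin N → Bool //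
          (testEnv H G ((List.ofFn r).take i.params.2).reverse).result = 0} := by
      refine Nat.card_le_card_of_injective (Subtype.map id fun r hr => ?_)
        (Subtype.map_injective _ Function.injective_id)
      obtain ⟨_, _, _, he⟩ := hr
      obtain ⟨_, _, _, he'⟩ := hans r
      have e := (he.unique he').1
      by_contra hne
      simp only [id_eq] at hne
      simp [hne, Data.ofBool] at e
    rw [Prog.answerProb, div_le_div_iff₀ (by positivity) (by norm_num), one_mul]
    have : 2 * Nat.card {r : Fin N → Bool // p.Answers (Enc.enc i) N (List.ofFn r) false}
        ≤ 2 ^ N := (Nat.mul_le_mul_left 2 hle).trans hcard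
    rw [mul_comm]
    exact_mod_cast this
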